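/- Let $\mathcal R\subset V=\mathbb R^N$ be a Coxeter root system (a finite set of nonzero vectors, stable under the orthogonal reflections $s_\alpha$, $\alpha\in\mathcal R$, with $\mathcal R\cap\mathbb R\alpha=\{\pm\alpha\}$), $\mathcal R_+$ a positive half of it, $W$ the finite Coxeter group generated by the $s_\alpha$, and $g:\mathcal R\to\mathbb C$, $\alpha\mapsto g_\alpha$, any $W$-invariant function. Let $e_1,\dots,e_N$ be the standard basis. For $\xi,\eta\in V$ put $$S_{\xi\eta}=(\xi,\eta)+\sum_{\alpha\in\mathcal R_+}\frac{2g_\alpha(\alpha,\xi)(\alpha,\eta)}{(\alpha,\alpha)}s_\alpha\in\mathbb CW,\qquad \nabla_\xi=\partial_\xi-\sum_{\alpha\in\mathcal R_+}\frac{g_\alpha(\alpha,\xi)}{(\alpha,x)}s_\alpha,$$ $$M_{\xi\eta}=(x,\xi)\nabla_\eta-(x,\eta)\nabla_\xi,\qquad E_{\xi\eta}=(x,\xi)\nabla_\eta,\qquad M_{ij}=M_{e_ie_j},\quad E_{ij}=E_{e_ie_j},\quad S_{ij}=S_{e_ie_j},$$ where the operators act on rational functions of $x_1,\dots,x_N$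 over $\mathbb C$. Let $H_g^{so(N)}(W)$, respectively $H_g^{gl(N)}(W)$, be the algebra of operators generated by $W$ and all $M_{\xi\eta}$, respectively by $W$ and all $E_{\xi\eta}$. Let $H_g(W)$ be the rational Cherednik algebra, i.e. the quotient of $T(V_{\mathbb C}\oplus V_{\mathbb C})\#\mathbb CW$ with generators $x_\xi,y_\xi$ by $[x_\xi,x_\eta]=[y_\xi,y_\eta]=0$, $[y_\xi,x_\eta]=S_{\xi\eta}$. Here $\#$ denotes the smash product, $V_{\mathbb C}$ the complexification of $V$, and all exterior and tensor products and tensor algebras below are those of $V_{\mathbb C}$ over $\mathbb C$. Then: (1) Let $A$ be the quotient of $T(\Lambda^2V)\#\mathbb CW$ by the relations $$[M_{\xi\eta},M_{\varphi\psi}]=M_{\xi\psi}S_{\eta\varphi}+M_{\eta\varphi}S_{\xi\psi}-M_{\xi\varphi}S_{\eta\psi}-M_{\eta\psi}S_{\xi\varphi},$$ $$M_{\xi\eta}M_{\varphi\psi}+M_{\eta\varphi}M_{\xi\psi}+M_{\varphi\xi}M_{\eta\psi}=M_{\varphi\xi}S_{\eta\psi}+M_{\xi\eta}S_{\varphi\psi}+M_{\eta\varphi}S_{\xi\psi}$$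 for all $\xi,\eta,\varphi,\psi\in V$, where $M_{\xi\eta}$ stands for $\xi\wedge\eta\in\Lambda^2V$. Then $\xi\wedge\eta\mapsto M_{\xi\eta}$, $w\mapsto w$ induces an isomorphism of algebras $A\cong H_g^{so(N)}(W)$, and $\xi\wedge\eta\mapsto x_\xi y_\eta-x_\eta y_\xi$, $w\mapsto w$ induces an isomorphism of $A$ with the subalgebra of $H_g(W)$ generated by $W$ and all $x_\xi y_\eta-x_\eta y_\xi$. The monomials $M_{i_1j_1}^{n_1}\cdots M_{i_kj_k}^{n_k}w$ with $k\ge0$, $n_s>0$, $i_s<j_s$, $w\in W$, with $i_1\le\dots\le i_k$ and $j_s<j_{s+1}$ whenever $i_s=i_{s+1}$, and with the non-crossing condition $i_s<i_t<j_s\Rightarrow j_t\le j_s$ for all $s,t$, form a basis of $A$. Moreover $A$ is a nonhomogeneous quadratic algebra over $\mathbb CW$ of PBW type: for the filtration by degree in the $M_{\xi\eta}$, the canonical map from the quotient of $T(\Lambda^2V)\#\mathbb CW$ by the quadratic parts of the relations (the same relations with all $S$ replaced by $0$) to the associated graded algebra $\operatorname{gr}A$ is an isomorphism. (2) Let $A'$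 be the quotient of $T(V\otimes V)\#\mathbb CW$ by the relations $$E_{ij}E_{kl}-E_{il}E_{kj}=E_{il}S_{kj}-E_{ij}S_{kl},\qquad [E_{ij},E_{kl}]=E_{il}S_{jk}-S_{il}E_{kj}+[S_{kl},E_{ij}]$$ for $1\le i,j,k,l\le N$, where $E_{ij}$ stands for $e_i\otimes e_j$. Then $\xi\otimes\eta\mapsto E_{\xi\eta}$, $w\mapsto w$ induces an isomorphism of algebras $A'\cong H_g^{gl(N)}(W)$, and $\xi\otimes\eta\mapsto x_\xi y_\eta$, $w\mapsto w$ induces an isomorphism of $A'$ with the subalgebra of $H_g(W)$ generated by $W$ and all $x_\xi y_\eta$. The monomials $E_{i_1j_1}^{n_1}\cdots E_{i_kj_k}^{n_k}w$ with $k\ge0$, $n_s>0$, $w\in W$, distinct consecutive pairs $(i_s,j_s)$, $i_1\le\dots\le i_k$ and $j_1\le\dots\le j_k$ form a basis of $A'$, and $A'$ is a nonhomogeneous quadratic algebra over $\mathbb CW$ of PBW type in the sense of (1). In particular the bases do not depend on $g$ (flat families). -/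

import Mathlib

open scoped TensorProduct

noncomputable section

namespace DunklAngular

/-! ### Finite reflection groups -/

/-- The Euclidean space `V = ℝ^N`. -/
abbrev Vec (N : ℕ) : Type := EuclideanSpace ℝ (Fin N)

/-- The standard basis vector `e_i`. -/
def e {N : ℕ} (i : Fin N) : Vec N := EuclideanSpace.single i 1

/-- The orthogonal reflection in the hyperplane `(α, x) = 0`. -/
def refl {N : ℕ} (α : Vec N) : Vec N ≃ₗᵢ[ℝ] Vec N := (Submodule.span ℝ {α})ᗮ.reflection

/-- A Coxeter root system: a finite set of nonzero vectors which meets every line spanned by one of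
its elements `α` in `{α, -α}` and is stable under the reflections in its elements. It is neither
required to be crystallographic nor to span the space. -/
structure CoxeterRootSystem (N : ℕ) where
  roots : Finset (Vec N)
  zero_notMem : (0 : Vec N) ∉ roots
  eq_or_eq_neg : ∀ α ∈ roots, ∀ c : ℝ, c • α ∈ roots → c = 1 ∨ c = -1
  refl_mem : ∀ α ∈ roots, ∀ β ∈ roots, refl α β ∈ roots

/-- A positive half of a root system: exactly one of `α`, `-α` is chosen for each root `α`. -/
structure CoxeterRootSystem.PositiveHalf {N : ℕ} (R : CoxeterRootSystem N) where
  pos : Finset (Vec N)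
  subset : pos ⊆ R.roots
  mem_iff : ∀ α ∈ R.roots, (α ∈ pos ↔ -α ∉ pos)

/-- The finite Coxeter group `W` generated by the reflections in the roots. -/
def CoxeterRootSystem.W {N : ℕ} (R : CoxeterRootSystem N) : Subgroup (Vec N ≃ₗᵢ[ℝ] Vec N) :=
  Subgroup.closure {s | ∃ α ∈ R.roots, s = refl α}

/-- The reflection `s_α` as an element of `W`. -/
def CoxeterRootSystem.s {N : ℕ} (R : CoxeterRootSystem N) (α : Vec N) (hα : α ∈ R.roots) : R.W :=
  ⟨refl α, Subgroup.subset_closure ⟨α, hα, rfl⟩⟩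

/-- The group algebra `ℂW`. -/
abbrev CoxeterRootSystem.CW {N : ℕ} (R : CoxeterRootSystem N) : Type := MonoidAlgebra ℂ R.W

/-- `S_{ξη} = (ξ, η) + ∑_{α > 0} 2 g_α (α, ξ) (α, η) / (α, α) s_α` in the group algebra. -/
def S {N : ℕ} {R : CoxeterRootSystem N} (P : R.PositiveHalf) (g : Vec N → ℂ) (ξ η : Vec N) : R.CW :=
  ((inner ℝ ξ η : ℝ) : ℂ) • 1 +
    ∑ α : {α // α ∈ P.pos},
      (2 * g α.1 * ((inner ℝ α.1 ξ * inner ℝ α.1 η / inner ℝ α.1 α.1 : ℝ) : ℂ)) •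
        MonoidAlgebra.of ℂ R.W (R.s α.1 (P.subset α.2))

/-! ### Smash products of tensor algebras with group algebras -/

section Smash

variable {G U : Type} [Group G] [AddCommGroup U] [Module ℂ U]

/-- The tensor algebra `T(U)` of a representation, with the induced action of the group. -/
def RepTensorAlgebra (_ρ : Representation ℂ G U) : Type := TensorAlgebra ℂ U

instance (ρ : Representation ℂ G U) : Ring (RepTensorAlgebra ρ) :=
  inferInstanceAs (Ring (TensorAlgebra ℂ U))

instance (ρ : Representation ℂ G U) : Algebra ℂ (RepTensorAlgebra ρ) :=
  inferInstanceAs (Algebra ℂ (TensorAlgebra ℂ U))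

/-- The inclusion `U → T(U)`. -/
def RepTensorAlgebra.ι (ρ : Representation ℂ G U) : U →ₗ[ℂ] RepTensorAlgebra ρ :=
  TensorAlgebra.ι ℂ

/-- The algebra endomorphism of `T(U)` induced by a group element. -/
def RepTensorAlgebra.act (ρ : Representation ℂ G U) (w : G) :
    RepTensorAlgebra ρ →ₐ[ℂ] RepTensorAlgebra ρ :=
  TensorAlgebra.lift ℂ (RepTensorAlgebra.ι ρ ∘ₗ ρ w)

theorem RepTensorAlgebra.act_ι (ρ : Representation ℂ G U) (w : G) (u : U) :
    RepTensorAlgebra.act ρ w (RepTensorAlgebra.ι ρ u) = RepTensorAlgebra.ι ρ (ρ w u) :=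
  TensorAlgebra.lift_ι_apply _ _

theorem RepTensorAlgebra.hom_ext (ρ : Representation ℂ G U)
    {f f' : RepTensorAlgebra ρ →ₐ[ℂ] RepTensorAlgebra ρ}
    (h : ∀ u, f (RepTensorAlgebra.ι ρ u) = f' (RepTensorAlgebra.ι ρ u)) : f = f' :=
  TensorAlgebra.hom_ext (LinearMap.ext h)

theorem RepTensorAlgebra.act_one (ρ : Representation ℂ G U) :
    RepTensorAlgebra.act ρ 1 = AlgHom.id ℂ _ :=
  RepTensorAlgebra.hom_ext ρ fun u => by simp [RepTensorAlgebra.act_ι]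

theorem RepTensorAlgebra.act_mul (ρ : Representation ℂ G U) (v w : G) :
    RepTensorAlgebra.act ρ (v * w) =
      (RepTensorAlgebra.act ρ v).comp (RepTensorAlgebra.act ρ w) :=
  RepTensorAlgebra.hom_ext ρ fun u => by simp [RepTensorAlgebra.act_ι]

instance (ρ : Representation ℂ G U) : MulSemiringAction G (RepTensorAlgebra ρ) where
  smul w t := RepTensorAlgebra.act ρ w t
  one_smul t := by
    change RepTensorAlgebra.act ρ 1 t = t
    rw [RepTensorAlgebra.act_one]; rfl
  mul_smul v w t := by
    change RepTensorAlgebra.act ρ (v * w) t =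
      RepTensorAlgebra.act ρ v (RepTensorAlgebra.act ρ w t)
    rw [RepTensorAlgebra.act_mul]; rfl
  smul_zero w := map_zero (RepTensorAlgebra.act ρ w)
  smul_add w := map_add (RepTensorAlgebra.act ρ w)
  smul_one w := map_one (RepTensorAlgebra.act ρ w)
  smul_mul w := map_mul (RepTensorAlgebra.act ρ w)

theorem RepTensorAlgebra.smul_def (ρ : Representation ℂ G U) (w : G) (t : RepTensorAlgebra ρ) :
    w • t = RepTensorAlgebra.act ρ w t := rfl

instance (ρ : Representation ℂ G U) : SMulCommClass G ℂ (RepTensorAlgebra ρ) where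
  smul_comm w c t := map_smul (RepTensorAlgebra.act ρ w) c t

/-- The smash product `T(U) # ℂG`: finite sums of `t w` with `t ∈ T(U)`, `w ∈ G`, multiplied by
`(t v) (t' w) = (t (v • t')) (v w)`. -/
abbrev Smash (ρ : Representation ℂ G U) : Type := SkewMonoidAlgebra (RepTensorAlgebra ρ) G

/-- A vector of `U` as an element of the smash product. -/
def Smash.gen (ρ : Representation ℂ G U) (u : U) : Smash ρ :=
  SkewMonoidAlgebra.single 1 (RepTensorAlgebra.ι ρ u)

/-- A group element as an element of the smash product. -/
def Smash.grp (ρ : Representation ℂ G U) : G →* Smash ρ :=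
  SkewMonoidAlgebra.of (RepTensorAlgebra ρ) G

/-- The inclusion of the group algebra in the smash product. -/
def Smash.grpAlg (ρ : Representation ℂ G U) : MonoidAlgebra ℂ G →ₐ[ℂ] Smash ρ :=
  MonoidAlgebra.lift ℂ (Smash ρ) G (Smash.grp ρ)

/-- The component `T^n(U) # ℂG` of degree `n`: elements of `U` have degree one and
group elements have degree zero. -/
def Smash.component (ρ : Representation ℂ G U) (n : ℕ) : Submodule ℂ (Smash ρ) :=
  Submodule.span ℂ {a | ∃ (w : G) (t : RepTensorAlgebra ρ),
    t ∈ LinearMap.range (RepTensorAlgebra.ι ρ) ^ n ∧ a = SkewMonoidAlgebra.single w t}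

/-- The part of degree less than `n` of the smash product. -/
def Smash.degreeLT (ρ : Representation ℂ G U) (n : ℕ) : Submodule ℂ (Smash ρ) :=
  ⨆ m ∈ Set.Iio n, Smash.component ρ m

/-- The Poincaré–Birkhoff–Witt property of nonhomogeneous quadratic relations `r` over `ℂG` with
homogeneous leading part `r₀`. Let `Q` and `B` be the quotients of `T(U) # ℂG` by `r` and `r₀`. The
condition says that the kernel of the canonical surjection `T^n(U) # ℂG → F_n Q / F_{n-1} Q` is the
kernel of `T^n(U) # ℂG → B`, i.e. that `B → gr Q` is (well defined and) an isomorphism. -/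
def IsPBW (ρ : Representation ℂ G U) (r r₀ : Smash ρ → Smash ρ → Prop) : Prop :=
  ∀ n : ℕ, ∀ t ∈ Smash.component ρ n,
    (RingQuot.mkAlgHom ℂ r t ∈
        (Smash.degreeLT ρ n).map (RingQuot.mkAlgHom ℂ r).toLinearMap ↔
      RingQuot.mkAlgHom ℂ r₀ t = 0)

end Smash

section Representations

variable {N : ℕ} (R : CoxeterRootSystem N)

/-- The complexification of `V`. -/
abbrev VC (N : ℕ) : Type := ℂ ⊗[ℝ] Vec N

/-- A real vector as an element of the complexification. -/
def cx {N : ℕ} (ξ : Vec N) : VC N := (1 : ℂ) ⊗ₜ[ℝ] ξ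

/-- The complexified reflection representation of `W`. -/
def repV : Representation ℂ R.W (VC N) where
  toFun w := LinearMap.baseChange ℂ (w.1.toLinearEquiv : Vec N →ₗ[ℝ] Vec N)
  map_one' := by ext; simp
  map_mul' v w := by ext; simp

theorem repV_cx (w : R.W) (ξ : Vec N) : repV R w (cx ξ) = cx (w.1 ξ) := by
  simp [repV, cx]

/-- The second exterior power of the reflection representation. -/
def repLambda : Representation ℂ R.W (⋀[ℂ]^2 (VC N)) where
  toFun w := exteriorPower.map 2 (repV R w)
  map_one' := by rw [map_one]; exact exteriorPower.map_id (R := ℂ) (M := VC N) (n := 2)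
  map_mul' v w := by
    rw [map_mul, Module.End.mul_eq_comp, exteriorPower.map_comp]; rfl

/-- The representation `V ⊗ V`. -/
def repTensor : Representation ℂ R.W (VC N ⊗[ℂ] VC N) := (repV R).tprod (repV R)

/-- The representation `V ⊕ V` (the first copy for the coordinates `x`, identified with vectors by
the inner product, the second one for the momenta `y`). -/
def repSum : Representation ℂ R.W (VC N × VC N) := (repV R).prod (repV R)

end Representations

/-! ### The rational Cherednik algebra -/

section Cherednik

variable {N : ℕ} {R : CoxeterRootSystem N}

/-- `x_ξ`, which stands for the linear function `(x, ξ)`. -/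
def chX (R : CoxeterRootSystem N) (ξ : Vec N) : Smash (repSum R) := Smash.gen (repSum R) (cx ξ, 0)

/-- `y_ξ`, which stands for the Dunkl operator in the direction `ξ`. -/
def chY (R : CoxeterRootSystem N) (ξ : Vec N) : Smash (repSum R) := Smash.gen (repSum R) (0, cx ξ)

/-- The defining relations of the rational Cherednik algebra in `T(V ⊕ V) # ℂW`. -/
inductive CherednikRel (P : R.PositiveHalf) (g : Vec N → ℂ) :
    Smash (repSum R) → Smash (repSum R) → Prop
  | xx (ξ η : Vec N) : CherednikRel P g (chX R ξ * chX R η) (chX R η * chX R ξ)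
  | yy (ξ η : Vec N) : CherednikRel P g (chY R ξ * chY R η) (chY R η * chY R ξ)
  | yx (ξ η : Vec N) : CherednikRel P g (chY R ξ * chX R η - chX R η * chY R ξ)
      (Smash.grpAlg (repSum R) (S P g ξ η))

/-- The rational Cherednik algebra `H_g(W)`. -/
abbrev Cherednik (P : R.PositiveHalf) (g : Vec N → ℂ) : Type := RingQuot (CherednikRel P g)

/-- The generator `x_ξ` of `H_g(W)`. -/
def Cherednik.x (P : R.PositiveHalf) (g : Vec N → ℂ) (ξ : Vec N) : Cherednik P g :=
  RingQuot.mkAlgHom ℂ (CherednikRel P g) (chX R ξ)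

/-- The generator `y_ξ` of `H_g(W)`. -/
def Cherednik.y (P : R.PositiveHalf) (g : Vec N → ℂ) (ξ : Vec N) : Cherednik P g :=
  RingQuot.mkAlgHom ℂ (CherednikRel P g) (chY R ξ)

/-- The group elements in `H_g(W)`. -/
def Cherednik.grp (P : R.PositiveHalf) (g : Vec N → ℂ) (w : R.W) : Cherednik P g :=
  RingQuot.mkAlgHom ℂ (CherednikRel P g) (Smash.grp (repSum R) w)

/-- The subalgebra of `H_g(W)` generated by all `x_ξ y_η - x_η y_ξ` and `W`. -/
def Cherednik.soSubalgebra (P : R.PositiveHalf) (g : Vec N → ℂ) : Subalgebra ℂ (Cherednik P g) :=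
  Algebra.adjoin ℂ
    ({a | ∃ ξ η : Vec N, a = Cherednik.x P g ξ * Cherednik.y P g η -
        Cherednik.x P g η * Cherednik.y P g ξ} ∪ Set.range (Cherednik.grp P g))

/-- The subalgebra of `H_g(W)` generated by all `x_ξ y_η` and `W`. -/
def Cherednik.glSubalgebra (P : R.PositiveHalf) (g : Vec N → ℂ) : Subalgebra ℂ (Cherednik P g) :=
  Algebra.adjoin ℂ
    ({a | ∃ ξ η : Vec N, a = Cherednik.x P g ξ * Cherednik.y P g η} ∪
      Set.range (Cherednik.grp P g))

end Cherednik

/-! ### Dunkl operators on rational functions -/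

section Operators

open MvPolynomial

variable {N : ℕ}

/-- The field of rational functions in the coordinates `x_1, …, x_N`. -/
abbrev RatFun (N : ℕ) : Type := FractionRing (MvPolynomial (Fin N) ℂ)

/-- The linear function `(x, ξ)` as a polynomial. -/
def linForm (ξ : Vec N) : MvPolynomial (Fin N) ℂ := ∑ i, C ((ξ i : ℝ) : ℂ) * X i

/-- The linear function `(x, ξ)` as a rational function. -/
def linRat (ξ : Vec N) : RatFun N := algebraMap (MvPolynomial (Fin N) ℂ) (RatFun N) (linForm ξ)

/-- The substitution `x ↦ w⁻¹ x` in polynomials; it sends `(x, ξ)` to `(x, w ξ)`. -/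
def polyHom (w : Vec N ≃ₗᵢ[ℝ] Vec N) : MvPolynomial (Fin N) ℂ →ₐ[ℂ] MvPolynomial (Fin N) ℂ :=
  aeval fun i => linForm (w (e i))

theorem polyHom_linForm (w : Vec N ≃ₗᵢ[ℝ] Vec N) (ξ : Vec N) :
    polyHom w (linForm ξ) = linForm (w ξ) := by
  have hξ : ξ = ∑ i, ξ i • e i := by
    ext j
    simp [e, Pi.single_apply]
  have hw : ∀ j, (w ξ) j = ∑ i, ξ i * (w (e i)) j := by
    intro j
    conv_lhs => rw [hξ]
    simp
  simp only [polyHom, linForm, map_sum, map_mul, aeval_X, algHom_C, algebraMap_eq, hw,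
    Complex.ofReal_sum, Complex.ofReal_mul, Finset.mul_sum, Finset.sum_mul]
  rw [Finset.sum_comm]
  refine Finset.sum_congr rfl fun i _ => Finset.sum_congr rfl fun j _ => ?_
  ring

theorem linForm_e (i : Fin N) : linForm (e i) = X i := by
  classical
  simp [linForm, e, apply_ite, ite_mul]

theorem polyHom_comp_inv (w v : Vec N ≃ₗᵢ[ℝ] Vec N) (h : ∀ ξ, w (v ξ) = ξ) :
    (polyHom w).comp (polyHom v) = AlgHom.id ℂ _ := by
  ext1 i
  rw [AlgHom.comp_apply, ← linForm_e, polyHom_linForm, polyHom_linForm, h]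
  rfl

/-- The substitution `x ↦ w⁻¹ x` as an automorphism of the polynomial ring. -/
def polyAct (w : Vec N ≃ₗᵢ[ℝ] Vec N) : MvPolynomial (Fin N) ℂ ≃ₐ[ℂ] MvPolynomial (Fin N) ℂ :=
  AlgEquiv.ofAlgHom (polyHom w) (polyHom w.symm)
    (polyHom_comp_inv _ _ fun ξ => w.apply_symm_apply ξ)
    (polyHom_comp_inv _ _ fun ξ => w.symm_apply_apply ξ)

/-- The action `(w ψ)(x) = ψ(w⁻¹ x)` on rational functions. -/
def opW (w : Vec N ≃ₗᵢ[ℝ] Vec N) : Module.End ℂ (RatFun N) :=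
  (IsFractionRing.algEquivOfAlgEquiv (K := RatFun N) (L := RatFun N) (polyAct w)).toLinearMap

theorem opW_algebraMap (w : Vec N ≃ₗᵢ[ℝ] Vec N) (p : MvPolynomial (Fin N) ℂ) :
    opW w (algebraMap _ (RatFun N) p) = algebraMap _ (RatFun N) (polyHom w p) := by
  simp [opW, polyAct]

/-- Evaluation at `x_j + δ_{ij} ε` with `ε² = 0`, on polynomials. -/
def shiftPoly (i : Fin N) : MvPolynomial (Fin N) ℂ →ₐ[ℂ] TrivSqZeroExt (RatFun N) (RatFun N) :=
  aeval fun j => TrivSqZeroExt.inl (algebraMap (MvPolynomial (Fin N) ℂ) (RatFun N) (X j)) +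
    TrivSqZeroExt.inr (if j = i then 1 else 0)

theorem fst_shiftPoly (i : Fin N) (p : MvPolynomial (Fin N) ℂ) :
    (shiftPoly i p).fst = algebraMap _ (RatFun N) p := by
  have h : (TrivSqZeroExt.fstHom ℂ (RatFun N) (RatFun N)).comp (shiftPoly i) =
      IsScalarTower.toAlgHom ℂ (MvPolynomial (Fin N) ℂ) (RatFun N) := by
    ext j
    by_cases hj : j = i <;> simp [shiftPoly, hj]
  exact DFunLike.congr_fun h p

/-- Evaluation at `x_j + δ_{ij} ε` with `ε² = 0`, on rational functions. -/
def shift (i : Fin N) : RatFun N →ₐ[ℂ] TrivSqZeroExt (RatFun N) (RatFun N) :=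
  IsLocalization.liftAlgHom (M := nonZeroDivisors (MvPolynomial (Fin N) ℂ)) (f := shiftPoly i)
    fun p => by
      rw [TrivSqZeroExt.isUnit_iff_isUnit_fst, fst_shiftPoly]
      exact IsLocalization.map_units (RatFun N) p

theorem fst_shift (i : Fin N) (f : RatFun N) : (shift i f).fst = f := by
  have h : (TrivSqZeroExt.fstHom ℂ (RatFun N) (RatFun N)).comp (shift i) = AlgHom.id ℂ (RatFun N) := by
    refine IsLocalization.algHom_ext (nonZeroDivisors (MvPolynomial (Fin N) ℂ)) ?_
    refine AlgHom.ext fun p => ?_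
    have h1 : shift i (algebraMap _ (RatFun N) p) = shiftPoly i p := by simp [shift]
    change (shift i (algebraMap _ (RatFun N) p)).fst = algebraMap _ (RatFun N) p
    rw [h1, fst_shiftPoly]
  exact DFunLike.congr_fun h f

/-- The partial derivative `∂_i` on rational functions: the coefficient of `ε` in
`f(x + ε e_i)`. -/
def partialD (i : Fin N) : Derivation ℂ (RatFun N) (RatFun N) :=
  Derivation.mk' ((TrivSqZeroExt.sndHom (RatFun N) (RatFun N)).restrictScalars ℂ ∘ₗ
    (shift i).toLinearMap) fun a b => by
      simp [fst_shift, mul_comm]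

/-- `∂_i` is the usual partial derivative on polynomials. -/
theorem partialD_algebraMap (i : Fin N) (p : MvPolynomial (Fin N) ℂ) :
    partialD i (algebraMap _ (RatFun N) p) = algebraMap _ (RatFun N) (pderiv i p) := by
  have key : ((Derivation.compAlgebraMap (MvPolynomial (Fin N) ℂ) (partialD i)) :
      Derivation ℂ (MvPolynomial (Fin N) ℂ) (RatFun N)) =
      (Algebra.linearMap (MvPolynomial (Fin N) ℂ) (RatFun N)).compDer (pderiv i) := by
    refine MvPolynomial.derivation_ext fun j => ?_
    by_cases h : j = i <;> simp [partialD, shift, shiftPoly, pderiv_X, h]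
  exact DFunLike.congr_fun key p

variable {R : CoxeterRootSystem N}

/-- The Dunkl operator `∇_ξ = ∂_ξ - ∑_{α > 0} g_α (α, ξ) / (α, x) s_α`. -/
def nabla (P : R.PositiveHalf) (g : Vec N → ℂ) (ξ : Vec N) : Module.End ℂ (RatFun N) :=
  ∑ i, ((ξ i : ℝ) : ℂ) • (partialD i : RatFun N →ₗ[ℂ] RatFun N) -
    ∑ α ∈ P.pos, (g α * ((inner ℝ α ξ : ℝ) : ℂ)) •
      (LinearMap.mulLeft ℂ (linRat α)⁻¹ ∘ₗ opW (refl α))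

/-- Multiplication by `(x, ξ)`. -/
def opX (ξ : Vec N) : Module.End ℂ (RatFun N) := LinearMap.mulLeft ℂ (linRat ξ)

/-- The Dunkl angular momentum operator `M_{ξη} = (x, ξ) ∇_η - (x, η) ∇_ξ`. -/
def opM (P : R.PositiveHalf) (g : Vec N → ℂ) (ξ η : Vec N) : Module.End ℂ (RatFun N) :=
  opX ξ * nabla P g η - opX η * nabla P g ξ

/-- The operator `E_{ξη} = (x, ξ) ∇_η`. -/
def opE (P : R.PositiveHalf) (g : Vec N → ℂ) (ξ η : Vec N) : Module.End ℂ (RatFun N) :=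
  opX ξ * nabla P g η

/-- The Dunkl angular momenta algebra `H_g^{so(N)}(W)`: the algebra of operators generated by all
`M_{ξη}` and by `W`. -/
def soAlgebra (P : R.PositiveHalf) (g : Vec N → ℂ) : Subalgebra ℂ (Module.End ℂ (RatFun N)) :=
  Algebra.adjoin ℂ ({a | ∃ ξ η : Vec N, a = opM P g ξ η} ∪ {a | ∃ w : R.W, a = opW w.1})

/-- The algebra `H_g^{gl(N)}(W)`: the algebra of operators generated by all `E_{ξη}` and by `W`. -/
def glAlgebra (P : R.PositiveHalf) (g : Vec N → ℂ) : Subalgebra ℂ (Module.End ℂ (RatFun N)) :=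
  Algebra.adjoin ℂ ({a | ∃ ξ η : Vec N, a = opE P g ξ η} ∪ {a | ∃ w : R.W, a = opW w.1})

end Operators

/-! ### The `so(N)` presentation -/

section So

variable {N : ℕ} {R : CoxeterRootSystem N}

/-- `M_{ξη}`, i.e. `ξ ∧ η ∈ Λ²V`, as an element of the smash product. -/
def smM (R : CoxeterRootSystem N) (ξ η : Vec N) : Smash (repLambda R) :=
  Smash.gen (repLambda R) (exteriorPower.ιMulti ℂ 2 ![cx ξ, cx η])

/-- The commutation relations and the crossing relations in `T(Λ²V) # ℂW`, for a family `σ` of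
elements of the group algebra (`σ = S P g` gives the relations of `H_g^{so(N)}(W)`, and `σ = 0`
gives their quadratic parts). -/
inductive SoRel (R : CoxeterRootSystem N) (σ : Vec N → Vec N → R.CW) :
    Smash (repLambda R) → Smash (repLambda R) → Prop
  | comm (ξ η φ ψ : Vec N) : SoRel R σ
      (smM R ξ η * smM R φ ψ - smM R φ ψ * smM R ξ η)
      (smM R ξ ψ * Smash.grpAlg _ (σ η φ) + smM R η φ * Smash.grpAlg _ (σ ξ ψ)
        - smM R ξ φ * Smash.grpAlg _ (σ η ψ) - smM R η ψ * Smash.grpAlg _ (σ ξ φ))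
  | cross (ξ η φ ψ : Vec N) : SoRel R σ
      (smM R ξ η * smM R φ ψ + smM R η φ * smM R ξ ψ + smM R φ ξ * smM R η ψ)
      (smM R φ ξ * Smash.grpAlg _ (σ η ψ) + smM R ξ η * Smash.grpAlg _ (σ φ ψ)
        + smM R η φ * Smash.grpAlg _ (σ ξ ψ))

/-- The quotient of `T(Λ²V) # ℂW` by the commutation and crossing relations. -/
abbrev SoQuot (P : R.PositiveHalf) (g : Vec N → ℂ) : Type := RingQuot (SoRel R (S P g))

/-- The class of `M_{ξη}`. -/
def SoQuot.M (P : R.PositiveHalf) (g : Vec N → ℂ) (ξ η : Vec N) : SoQuot P g :=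
  RingQuot.mkAlgHom ℂ (SoRel R (S P g)) (smM R ξ η)

/-- The class of a group element. -/
def SoQuot.grp (P : R.PositiveHalf) (g : Vec N → ℂ) (w : R.W) : SoQuot P g :=
  RingQuot.mkAlgHom ℂ (SoRel R (S P g)) (Smash.grp (repLambda R) w)

/-- Words `(i_1, j_1) … (i_k, j_k)` with `i_s < j_s`, in lexicographic order (equal letters are
repeated, which amounts to the exponents of `M_{i_1 j_1}^{n_1} … M_{i_k j_k}^{n_k}`), and without
crossings: `i_s < i_t < j_s` implies `j_t ≤ j_s`. -/
def SoWord (N : ℕ) : Type :=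
  {l : List (Fin N × Fin N) //
    (∀ p ∈ l, p.1 < p.2) ∧
    l.Pairwise (fun p q => p.1 < q.1 ∨ (p.1 = q.1 ∧ p.2 ≤ q.2)) ∧
    ∀ p ∈ l, ∀ q ∈ l, p.1 < q.1 → q.1 < p.2 → q.2 ≤ p.2}

/-- The monomial `M_{i_1 j_1} … M_{i_k j_k} w`. -/
def SoQuot.monomial (P : R.PositiveHalf) (g : Vec N → ℂ) (a : SoWord N × R.W) : SoQuot P g :=
  (a.1.1.map fun p => SoQuot.M P g (e p.1) (e p.2)).prod * SoQuot.grp P g a.2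

end So

/-! ### The `gl(N)` presentation -/

section Gl

variable {N : ℕ} {R : CoxeterRootSystem N}

/-- `E_{ξη}`, i.e. `ξ ⊗ η ∈ V ⊗ V`, as an element of the smash product. -/
def smE (R : CoxeterRootSystem N) (ξ η : Vec N) : Smash (repTensor R) :=
  Smash.gen (repTensor R) (cx ξ ⊗ₜ[ℂ] cx η)

/-- The crossing relations `E_ij E_kl - E_il E_kj = E_il S_kj - E_ij S_kl` and the commutation
relations `[E_ij, E_kl] = E_il S_jk - S_il E_kj + [S_kl, E_ij]` in `T(V ⊗ V) # ℂW`, for a family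
`σ` of elements of the group algebra (`σ = S P g` gives the relations of `H_g^{gl(N)}(W)`, and
`σ = 0` gives their quadratic parts). -/
inductive GlRel (R : CoxeterRootSystem N) (σ : Vec N → Vec N → R.CW) :
    Smash (repTensor R) → Smash (repTensor R) → Prop
  | cross (i j k l : Fin N) : GlRel R σ
      (smE R (e i) (e j) * smE R (e k) (e l) - smE R (e i) (e l) * smE R (e k) (e j))
      (smE R (e i) (e l) * Smash.grpAlg _ (σ (e k) (e j))
        - smE R (e i) (e j) * Smash.grpAlg _ (σ (e k) (e l)))
  | comm (i j k l : Fin N) : GlRel R σ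
      (smE R (e i) (e j) * smE R (e k) (e l) - smE R (e k) (e l) * smE R (e i) (e j))
      (smE R (e i) (e l) * Smash.grpAlg _ (σ (e j) (e k))
        - Smash.grpAlg _ (σ (e i) (e l)) * smE R (e k) (e j)
        + (Smash.grpAlg _ (σ (e k) (e l)) * smE R (e i) (e j)
          - smE R (e i) (e j) * Smash.grpAlg _ (σ (e k) (e l))))

/-- The quotient of `T(V ⊗ V) # ℂW` by the crossing and commutation relations. -/
abbrev GlQuot (P : R.PositiveHalf) (g : Vec N → ℂ) : Type := RingQuot (GlRel R (S P g))

/-- The class of `E_{ξη}`. -/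
def GlQuot.E (P : R.PositiveHalf) (g : Vec N → ℂ) (ξ η : Vec N) :
    GlQuot P g :=
  RingQuot.mkAlgHom ℂ (GlRel R (S P g)) (smE R ξ η)

/-- The class of a group element. -/
def GlQuot.grp (P : R.PositiveHalf) (g : Vec N → ℂ) (w : R.W) : GlQuot P g :=
  RingQuot.mkAlgHom ℂ (GlRel R (S P g)) (Smash.grp (repTensor R) w)

/-- Words `(i_1, j_1) … (i_k, j_k)` with `i_1 ≤ … ≤ i_k` and `j_1 ≤ … ≤ j_k` (equal letters are
repeated, which amounts to the exponents of `E_{i_1 j_1}^{n_1} … E_{i_k j_k}^{n_k}`). -/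
def GlWord (N : ℕ) : Type :=
  {l : List (Fin N × Fin N) // l.Pairwise (fun p q => p.1 ≤ q.1 ∧ p.2 ≤ q.2)}

/-- The monomial `E_{i_1 j_1} … E_{i_k j_k} w`. -/
def GlQuot.monomial (P : R.PositiveHalf) (g : Vec N → ℂ) (a : GlWord N × R.W) : GlQuot P g :=
  (a.1.1.map fun p => GlQuot.E P g (e p.1) (e p.2)).prod * GlQuot.grp P g a.2

end Gl

end DunklAngular

end

/-! Both quotients follow one scheme: straightening shows that the monomials span, the Dunkl
representation shows that they are independent, and the remaining claims are formal consequences.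

Relations. They hold in any algebra with commuting X's, commuting Y's and symmetric commutators
[Y_ξ, X_η]. Moving y past x expresses x_a y_b x_c y_d through an ordered product and double
commutators, which are symmetric in all indices by the Jacobi identity (`exists_normal_form`).
Through `Realization` this applies to H_g(W), to Dunkl operators (which commute by `nabla_commute`),
and, with every S replaced by 0, to multiplication operators on W × V.

Spanning. Up to lower degree the generators commute, and the crossing relations exchange second
indices (gl) or resolve a crossing pair of chords into a nested pair plus a disjoint pair (so). The
submodule `negligible` records that a step is valid in the homogeneous quotient and, up to lower
degree, in the deformed one, so one straightening serves both (`gl_word_congr`, `so_word_mem`).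

Independence. Let k have a free W-orbit. An operator in the algebra sends exp(t(x,k)) to a sum of
q_v(t) exp(t(x,vk)) with q_v polynomial in t, and exponentials with distinct frequencies are
independent over such polynomials (`eq_zero_of_sum_mul_expSeries`). The reflection terms of ∇ do not
raise the degree in t. Hence, for every g, the top coefficient of a monomial ending in w is its
classical symbol, a product of factors x_i p_j or x_i p_j - x_j p_i evaluated at p = wk and
supported at v = w. The symbols are independent because the leading term, a product of the x_i at
left ends and the p_j at right ends, determines the word; for non-crossing words this is bracket
matching (`NonCrossing.perm`).

Conclusion. A spanning family with independent image makes the Dunkl map injective. That map factors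
through H_g(W), so the map into H_g(W) is injective as well, without the PBW theorem for H_g(W).
Independence of the same monomials in the deformed and the homogeneous quotient gives the PBW
property (`isPBW_of_linearIndependent`). -/

noncomputable section

namespace DunklAngular

open scoped Pointwise

/-! ### Smash products: universal property and grading by words. -/

section SmashGeneral

variable {G U : Type} [Group G] [AddCommGroup U] [Module ℂ U] (ρ : Representation ℂ G U)
variable {T : Type} [Ring T] [Algebra ℂ T]

/-- The algebra map on `T(U)` induced by a linear map on `U`. -/
def RepTensorAlgebra.lift (f : U →ₗ[ℂ] T) : RepTensorAlgebra ρ →ₐ[ℂ] T := TensorAlgebra.lift ℂ f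

theorem RepTensorAlgebra.lift_ι (f : U →ₗ[ℂ] T) (u : U) :
    RepTensorAlgebra.lift ρ f (RepTensorAlgebra.ι ρ u) = f u :=
  TensorAlgebra.lift_ι_apply _ _

theorem RepTensorAlgebra.induction {C : RepTensorAlgebra ρ → Prop}
    (algebraMap : ∀ c : ℂ, C (algebraMap ℂ _ c)) (ι : ∀ u, C (RepTensorAlgebra.ι ρ u))
    (mul : ∀ a b, C a → C b → C (a * b)) (add : ∀ a b, C a → C b → C (a + b))
    (t : RepTensorAlgebra ρ) : C t :=
  TensorAlgebra.induction (C := C) algebraMap ι mul add t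

theorem RepTensorAlgebra.iSup_range_pow :
    (⨆ n : ℕ, (LinearMap.range (RepTensorAlgebra.ι ρ) ^ n : Submodule ℂ (RepTensorAlgebra ρ))) =
      ⊤ :=
  (DirectSum.Decomposition.isInternal
    ((LinearMap.range (TensorAlgebra.ι ℂ : U →ₗ[ℂ] TensorAlgebra ℂ U) ^ ·) :
      ℕ → Submodule ℂ _)).submodule_iSup_eq_top

/-- Conjugation by `φ w` is multiplicative, so compatibility on `U` propagates to all tensors. This
is the condition for gluing maps out of T(U) and out of the group. -/
theorem RepTensorAlgebra.lift_smul_mul (f : U →ₗ[ℂ] T) (φ : G →* T)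
    (h : ∀ w u, f (ρ w u) * φ w = φ w * f u) (w : G) (t : RepTensorAlgebra ρ) :
    RepTensorAlgebra.lift ρ f (w • t) * φ w = φ w * RepTensorAlgebra.lift ρ f t := by
  refine RepTensorAlgebra.induction ρ (C := fun t =>
    RepTensorAlgebra.lift ρ f (w • t) * φ w = φ w * RepTensorAlgebra.lift ρ f t)
    (fun c => ?_) (fun u => ?_) (fun a b ha hb => ?_) (fun a b ha hb => ?_) t
  · change RepTensorAlgebra.lift ρ f (RepTensorAlgebra.act ρ w (algebraMap ℂ _ c)) * _ =
      _ * RepTensorAlgebra.lift ρ f (algebraMap ℂ _ c)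
    rw [AlgHom.commutes, AlgHom.commutes, Algebra.commutes]
  · change RepTensorAlgebra.lift ρ f (RepTensorAlgebra.act ρ w (RepTensorAlgebra.ι ρ u)) * _ =
      _ * RepTensorAlgebra.lift ρ f (RepTensorAlgebra.ι ρ u)
    rw [RepTensorAlgebra.act_ι, RepTensorAlgebra.lift_ι, RepTensorAlgebra.lift_ι, h]
  · rw [smul_mul', map_mul, map_mul, mul_assoc, hb, ← mul_assoc, ha, mul_assoc]
  · rw [smul_add, map_add, map_add, add_mul, mul_add, ha, hb]

/-- The universal property of the smash product. -/
def Smash.lift (f : U →ₗ[ℂ] T) (φ : G →* T) (h : ∀ w u, f (ρ w u) * φ w = φ w * f u) :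
    Smash ρ →ₐ[ℂ] T :=
  SkewMonoidAlgebra.liftNCAlgHom (RepTensorAlgebra.lift ρ f) φ
    (fun {t w} => RepTensorAlgebra.lift_smul_mul ρ f φ h w t)

variable {ρ}

theorem Smash.lift_gen (f : U →ₗ[ℂ] T) (φ : G →* T) (h : ∀ w u, f (ρ w u) * φ w = φ w * f u)
    (u : U) : Smash.lift ρ f φ h (Smash.gen ρ u) = f u := by
  have := SkewMonoidAlgebra.liftNC_single
    (RepTensorAlgebra.lift ρ f : RepTensorAlgebra ρ →+ T) (⇑φ) 1
    (RepTensorAlgebra.ι ρ u)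
  refine this.trans ?_
  simp [RepTensorAlgebra.lift_ι]

theorem Smash.lift_grp (f : U →ₗ[ℂ] T) (φ : G →* T) (h : ∀ w u, f (ρ w u) * φ w = φ w * f u)
    (w : G) : Smash.lift ρ f φ h (Smash.grp ρ w) = φ w := by
  have := SkewMonoidAlgebra.liftNC_single
    (RepTensorAlgebra.lift ρ f : RepTensorAlgebra ρ →+ T) (⇑φ) w
    (1 : RepTensorAlgebra ρ)
  refine this.trans ?_
  simp

theorem Smash.grpAlg_of (w : G) :
    Smash.grpAlg ρ (MonoidAlgebra.of ℂ G w) = Smash.grp ρ w := by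
  simp [Smash.grpAlg]

theorem Smash.map_grpAlg (F : Smash ρ →ₐ[ℂ] T) (φ : G →* T) (h : ∀ w, F (Smash.grp ρ w) = φ w)
    (a : MonoidAlgebra ℂ G) : F (Smash.grpAlg ρ a) = MonoidAlgebra.lift ℂ T G φ a := by
  induction a using MonoidAlgebra.induction_on with
  | of w => rw [Smash.grpAlg_of, h]; simp
  | add a b ha hb => rw [map_add, map_add, map_add, ha, hb]
  | smul c a ha => rw [map_smul, map_smul, map_smul, ha]

theorem Smash.gen_add (u v : U) : Smash.gen ρ (u + v) = Smash.gen ρ u + Smash.gen ρ v := by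
  simp [Smash.gen, SkewMonoidAlgebra.single_add]

theorem Smash.gen_smul (c : ℂ) (u : U) : Smash.gen ρ (c • u) = c • Smash.gen ρ u := by
  simp [Smash.gen, SkewMonoidAlgebra.smul_single]

/-- The inclusion of `U` as a linear map. -/
def Smash.genLin (ρ : Representation ℂ G U) : U →ₗ[ℂ] Smash ρ where
  toFun := Smash.gen ρ
  map_add' := Smash.gen_add
  map_smul' := Smash.gen_smul

theorem Smash.grp_mul_gen (w : G) (u : U) :
    Smash.grp ρ w * Smash.gen ρ u = Smash.gen ρ (ρ w u) * Smash.grp ρ w := by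
  have h : w • RepTensorAlgebra.ι ρ u = RepTensorAlgebra.ι ρ (ρ w u) :=
    RepTensorAlgebra.act_ι ρ w u
  simp [Smash.grp, Smash.gen, SkewMonoidAlgebra.single_mul_single, h]

/-- The inclusion of the tensor algebra in the smash product. -/
def Smash.ofTensor (ρ : Representation ℂ G U) : RepTensorAlgebra ρ →ₐ[ℂ] Smash ρ :=
  RepTensorAlgebra.lift ρ (Smash.genLin ρ)

theorem Smash.ofTensor_apply (t : RepTensorAlgebra ρ) :
    Smash.ofTensor ρ t = SkewMonoidAlgebra.single 1 t := by
  refine RepTensorAlgebra.induction ρ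
    (C := fun t => Smash.ofTensor ρ t = SkewMonoidAlgebra.single 1 t)
    (fun c => ?_) (fun u => ?_) (fun a b ha hb => ?_) (fun a b ha hb => ?_) t
  · refine ((Smash.ofTensor ρ).commutes c).trans ?_
    rw [SkewMonoidAlgebra.coe_algebraMap]
    rfl
  · exact RepTensorAlgebra.lift_ι _ _ _
  · rw [map_mul, ha, hb, SkewMonoidAlgebra.single_mul_single, one_smul, one_mul]
  · rw [map_add, ha, hb, SkewMonoidAlgebra.single_add]

theorem Smash.single_eq (w : G) (t : RepTensorAlgebra ρ) :
    (SkewMonoidAlgebra.single w t : Smash ρ) = Smash.ofTensor ρ t * Smash.grp ρ w := by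
  rw [Smash.ofTensor_apply]
  simp [Smash.grp, SkewMonoidAlgebra.single_mul_single]

/-- The product of the generators given by a list. -/
def Smash.word {Γ : Type} (ρ : Representation ℂ G U) (β : Γ → U) (l : List Γ) : Smash ρ :=
  (l.map fun c => Smash.gen ρ (β c)).prod

theorem Smash.word_append {Γ : Type} (β : Γ → U) (l l' : List Γ) :
    Smash.word ρ β (l ++ l') = Smash.word ρ β l * Smash.word ρ β l' := by
  simp [Smash.word]

theorem Smash.word_cons {Γ : Type} (β : Γ → U) (c : Γ) (l : List Γ) :
    Smash.word ρ β (c :: l) = Smash.gen ρ (β c) * Smash.word ρ β l := by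
  simp [Smash.word]

theorem Smash.grp_mul_word (w : G) (l : List U) :
    Smash.grp ρ w * Smash.word ρ id l = Smash.word ρ id (l.map (ρ w)) * Smash.grp ρ w := by
  induction l with
  | nil => simp [Smash.word]
  | cons u l ih =>
    rw [List.map_cons, Smash.word_cons, Smash.word_cons, ← mul_assoc, id, id, Smash.grp_mul_gen,
      mul_assoc, ih, mul_assoc]

/-- A power of a span is spanned by products of spanning elements. The alphabet is left free: all
pairs serve for gl, only the pairs i < j for so, and all of `U` for arguments that involve the group
action. -/
theorem Smash.component_eq_span {Γ : Type} (β : Γ → U) (hβ : Submodule.span ℂ (Set.range β) = ⊤)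
    (n : ℕ) : Smash.component ρ n =
      Submodule.span ℂ {a | ∃ (l : List Γ) (w : G), l.length = n ∧
        a = Smash.word ρ β l * Smash.grp ρ w} := by
  apply le_antisymm
  · refine Submodule.span_le.2 ?_
    rintro _ ⟨w, t, ht, rfl⟩
    rw [Smash.single_eq]
    have h1 : LinearMap.range (RepTensorAlgebra.ι ρ) =
        Submodule.span ℂ (Set.range fun c => RepTensorAlgebra.ι ρ (β c)) := by
      rw [LinearMap.range_eq_map, ← hβ, Submodule.map_span, ← Set.range_comp]
      rfl
    rw [h1, Submodule.span_pow] at ht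
    have h2 : Submodule.span ℂ ((Set.range fun c => RepTensorAlgebra.ι ρ (β c)) ^ n) ≤
        Submodule.comap ((LinearMap.mulRight ℂ (Smash.grp ρ w)).comp (Smash.ofTensor ρ).toLinearMap)
        (Submodule.span ℂ {a | ∃ (l : List Γ) (w : G), l.length = n ∧
        a = Smash.word ρ β l * Smash.grp ρ w}) := by
      refine Submodule.span_le.2 ?_
      intro x hx
      obtain ⟨f, rfl⟩ := Set.mem_pow.1 hx
      choose c hc using fun i => (f i).2
      refine Submodule.subset_span ⟨List.ofFn c, w, by simp, ?_⟩
      have : ∀ i, Smash.ofTensor ρ (f i : RepTensorAlgebra ρ) = Smash.gen ρ (β (c i)) := by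
        intro i
        rw [← hc i]
        exact RepTensorAlgebra.lift_ι _ _ _
      simp only [LinearMap.comp_apply, LinearMap.mulRight_apply, AlgHom.toLinearMap_apply,
        map_list_prod, List.map_ofFn, Smash.word]
      congr 3
      funext i
      exact this i
    exact h2 ht
  · refine Submodule.span_le.2 ?_
    rintro _ ⟨l, w, rfl, rfl⟩
    refine Submodule.subset_span ⟨w, (l.map fun c => RepTensorAlgebra.ι ρ (β c)).prod, ?_, ?_⟩
    · induction l with
      | nil =>
        rw [List.map_nil, List.prod_nil, List.length_nil, pow_zero]
        exact Submodule.one_le.1 le_rfl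
      | cons c l ih =>
        rw [List.map_cons, List.prod_cons, List.length_cons, pow_succ']
        exact Submodule.mul_mem_mul ⟨_, rfl⟩ ih
    · rw [Smash.single_eq, map_list_prod, List.map_map]
      congr 1
      exact congrArg List.prod
        (List.map_congr_left fun c _ => (RepTensorAlgebra.lift_ι ρ (Smash.genLin ρ) (β c)).symm)

theorem Smash.word_mul_grp_mem {Γ : Type} (β : Γ → U) (l : List Γ) (w : G) :
    Smash.word ρ β l * Smash.grp ρ w ∈ Smash.component ρ l.length := by
  rw [Smash.component_eq_span (id : U → U) (by simp)]
  exact Submodule.subset_span ⟨l.map β, w, by simp, by simp [Smash.word, Function.comp_def]⟩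

theorem Smash.word_mem {Γ : Type} (β : Γ → U) (l : List Γ) :
    Smash.word ρ β l ∈ Smash.component ρ l.length := by
  simpa using Smash.word_mul_grp_mem (ρ := ρ) β l 1

theorem Smash.gen_mem (u : U) : Smash.gen ρ u ∈ Smash.component ρ 1 := by
  simpa [Smash.word] using Smash.word_mem (ρ := ρ) id [u]

theorem Smash.grp_mem (w : G) : Smash.grp ρ w ∈ Smash.component ρ 0 := by
  simpa [Smash.word] using Smash.word_mul_grp_mem (ρ := ρ) (id : U → U) [] w

theorem Smash.grpAlg_mem (a : MonoidAlgebra ℂ G) : Smash.grpAlg ρ a ∈ Smash.component ρ 0 := by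
  induction a using MonoidAlgebra.induction_on with
  | of w => rw [Smash.grpAlg_of]; exact Smash.grp_mem w
  | add a b ha hb => rw [map_add]; exact add_mem ha hb
  | smul c a ha => rw [map_smul]; exact Submodule.smul_mem _ _ ha

theorem Smash.mul_mem {m n : ℕ} {a b : Smash ρ} (ha : a ∈ Smash.component ρ m)
    (hb : b ∈ Smash.component ρ n) : a * b ∈ Smash.component ρ (m + n) := by
  -- The alphabet must be stable under the group, since a group element passes a word by acting on
  -- its letters; hence all of `U`.
  rw [Smash.component_eq_span (id : U → U) (by simp)] at ha hb
  induction ha using Submodule.span_induction with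
  | zero => rw [zero_mul]; exact zero_mem _
  | add x y _ _ hx hy => rw [add_mul]; exact add_mem hx hy
  | smul c x _ hx => rw [smul_mul_assoc]; exact Submodule.smul_mem _ _ hx
  | mem x hx =>
    obtain ⟨l, w, rfl, rfl⟩ := hx
    induction hb using Submodule.span_induction with
    | zero => rw [mul_zero]; exact zero_mem _
    | add x y _ _ hx hy => rw [mul_add]; exact add_mem hx hy
    | smul c x _ hx => rw [mul_smul_comm]; exact Submodule.smul_mem _ _ hx
    | mem x hx =>
      obtain ⟨l', w', rfl, rfl⟩ := hx
      have h := Smash.word_mul_grp_mem (ρ := ρ) id (l ++ l'.map (ρ w)) (w * w')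
      rw [List.length_append, List.length_map] at h
      convert h using 1
      rw [Smash.word_append, map_mul, mul_assoc, ← mul_assoc (Smash.grp ρ w), Smash.grp_mul_word]
      simp only [mul_assoc]

theorem Smash.iSup_component : ⨆ n, Smash.component ρ n = ⊤ := by
  rw [eq_top_iff]
  intro a _
  induction a using SkewMonoidAlgebra.induction_on with
  | zero => exact zero_mem _
  | add a b ha hb => exact add_mem (ha trivial) (hb trivial)
  | single w t =>
    have ht : t ∈ (⨆ n : ℕ, (LinearMap.range (RepTensorAlgebra.ι ρ) ^ n :
        Submodule ℂ (RepTensorAlgebra ρ))) := by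
      rw [RepTensorAlgebra.iSup_range_pow]; trivial
    induction ht using Submodule.iSup_induction' with
    | mem n x hx =>
      exact Submodule.mem_iSup_of_mem n (Submodule.subset_span ⟨w, x, hx, rfl⟩)
    | zero => rw [SkewMonoidAlgebra.single_zero]; exact zero_mem _
    | add x y _ _ hx hy =>
      rw [SkewMonoidAlgebra.single_add]
      exact add_mem (hx trivial) (hy trivial)

theorem Smash.component_le_degreeLT {m n : ℕ} (h : m < n) :
    Smash.component ρ m ≤ Smash.degreeLT ρ n :=
  le_iSup₂_of_le m h le_rfl

theorem Smash.mul_mem_degreeLT {m n : ℕ} {a b : Smash ρ} (ha : a ∈ Smash.component ρ m)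
    (hb : b ∈ Smash.degreeLT ρ n) : a * b ∈ Smash.degreeLT ρ (m + n) := by
  have : Smash.degreeLT ρ n ≤ (Smash.degreeLT ρ (m + n)).comap (LinearMap.mulLeft ℂ a) :=
    iSup₂_le fun k hk x hx => Smash.component_le_degreeLT (Nat.add_lt_add_left hk m)
      (Smash.mul_mem ha hx)
  exact this hb

theorem Smash.degreeLT_mul_mem {m n : ℕ} {a b : Smash ρ} (ha : a ∈ Smash.component ρ m)
    (hb : b ∈ Smash.degreeLT ρ n) : b * a ∈ Smash.degreeLT ρ (n + m) := by
  have : Smash.degreeLT ρ n ≤ (Smash.degreeLT ρ (n + m)).comap (LinearMap.mulRight ℂ a) :=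
    iSup₂_le fun k hk x hx => Smash.component_le_degreeLT (Nat.add_lt_add_right hk m)
      (Smash.mul_mem hx ha)
  exact this hb

/-! ### Straightening up to lower degree, and the PBW criterion. -/

variable (r r₀ : Smash ρ → Smash ρ → Prop)

/-- Elements which vanish modulo the homogeneous relations `r₀` and have degree less than `n`
modulo the relations `r`. -/
def negligible (n : ℕ) : Submodule ℂ (Smash ρ) :=
  LinearMap.ker (RingQuot.mkAlgHom ℂ r₀).toLinearMap ⊓
    ((Smash.degreeLT ρ n).map (RingQuot.mkAlgHom ℂ r).toLinearMap).comap
      (RingQuot.mkAlgHom ℂ r).toLinearMap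

variable {r r₀}

theorem mem_negligible {n : ℕ} {t : Smash ρ} : t ∈ negligible r r₀ n ↔
    RingQuot.mkAlgHom ℂ r₀ t = 0 ∧
      ∃ b ∈ Smash.degreeLT ρ n, RingQuot.mkAlgHom ℂ r b = RingQuot.mkAlgHom ℂ r t :=
  Iff.rfl

/-- With its right-handed twin this makes rewriting local: replacing a factor inside a word changes
the word by a negligible element of the degree of the word. -/
theorem mul_mem_negligible {m n : ℕ} {a t : Smash ρ} (ha : a ∈ Smash.component ρ m)
    (ht : t ∈ negligible r r₀ n) : a * t ∈ negligible r r₀ (m + n) := by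
  obtain ⟨h0, b, hb, h⟩ := mem_negligible.1 ht
  exact mem_negligible.2 ⟨by rw [map_mul, h0, mul_zero], a * b, Smash.mul_mem_degreeLT ha hb,
    by rw [map_mul, map_mul, h]⟩

theorem negligible_mul_mem {m n : ℕ} {a t : Smash ρ} (ha : a ∈ Smash.component ρ m)
    (ht : t ∈ negligible r r₀ n) : t * a ∈ negligible r r₀ (n + m) := by
  obtain ⟨h0, b, hb, h⟩ := mem_negligible.1 ht
  exact mem_negligible.2 ⟨by rw [map_mul, h0, zero_mul], b * a, Smash.degreeLT_mul_mem ha hb,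
    by rw [map_mul, map_mul, h]⟩

/-- The source of negligible elements: the leading part of a relation is zero in the homogeneous
quotient and equals its lower order right side in the deformed one. -/
theorem mem_negligible_of_rel {n : ℕ} {a b : Smash ρ} (h : r a b) (h₀ : r₀ a 0)
    (hb : b ∈ Smash.degreeLT ρ n) : a ∈ negligible r r₀ n :=
  mem_negligible.2 ⟨by rw [RingQuot.mkAlgHom_rel ℂ h₀, map_zero], b, hb,
    (RingQuot.mkAlgHom_rel ℂ h).symm⟩

section PBW

variable {I : Type} (len : I → ℕ) (m : I → Smash ρ)

/-- The family of monomials `m_i w`. -/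
def monomialFamily (a : I × G) : Smash ρ := m a.1 * Smash.grp ρ a.2

variable {len m}

/-- It suffices to straighten words without group elements, because the latter can be multiplied on
the right afterwards without changing degrees. -/
theorem component_le_of_word_mem {Γ : Type} (β : Γ → U)
    (hβ : Submodule.span ℂ (Set.range β) = ⊤)
    (h : ∀ l : List Γ, Smash.word ρ β l ∈
      Submodule.span ℂ (m '' {i | len i = l.length}) ⊔ negligible r r₀ l.length) (n : ℕ) :
    Smash.component ρ n ≤
      Submodule.span ℂ (monomialFamily m '' {a | len a.1 = n}) ⊔ negligible r r₀ n := by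
  rw [Smash.component_eq_span β hβ]
  refine Submodule.span_le.2 ?_
  rintro _ ⟨l, w, rfl, rfl⟩
  obtain ⟨s, hs, j, hj, hsj⟩ := Submodule.mem_sup.1 (h l)
  rw [← hsj, add_mul]
  refine Submodule.add_mem_sup ?_ (by simpa using negligible_mul_mem (Smash.grp_mem w) hj)
  have : Submodule.span ℂ (m '' {i | len i = l.length}) ≤
      (Submodule.span ℂ (monomialFamily m '' {a : I × G | len a.1 = l.length})).comap
        (LinearMap.mulRight ℂ (Smash.grp ρ w)) := by
    refine Submodule.span_le.2 ?_
    rintro _ ⟨i, hi, rfl⟩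
    exact Submodule.subset_span ⟨(i, w), hi, rfl⟩
  exact this hs

/-- Straightening in degree k leaves monomials of degree k and a negligible remainder. Modulo `r`
the remainder has degree below k, where induction applies. -/
theorem map_degreeLT_le
    (hspan : ∀ n, Smash.component ρ n ≤
      Submodule.span ℂ (monomialFamily m '' {a | len a.1 = n}) ⊔ negligible r r₀ n)
    (n : ℕ) :
    (Smash.degreeLT ρ n).map (RingQuot.mkAlgHom ℂ r).toLinearMap ≤
      (Submodule.span ℂ (monomialFamily m '' {a | len a.1 < n})).map
        (RingQuot.mkAlgHom ℂ r).toLinearMap := by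
  induction n using Nat.strong_induction_on with
  | _ n ih =>
    rw [Submodule.map_le_iff_le_comap]
    refine iSup₂_le fun k hk t ht => ?_
    obtain ⟨s, hs, j, hj, rfl⟩ := Submodule.mem_sup.1 (hspan k ht)
    rw [Submodule.mem_comap, map_add]
    refine add_mem (Submodule.mem_map_of_mem (Submodule.span_mono (Set.image_mono ?_) hs)) ?_
    · intro a ha
      exact lt_of_eq_of_lt ha hk
    · refine Submodule.map_mono (Submodule.span_mono (Set.image_mono ?_)) (ih k hk hj.2)
      intro a ha
      exact lt_trans (show len a.1 < k from ha) hk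

theorem span_monomials_eq_top
    (hspan : ∀ n, Smash.component ρ n ≤
      Submodule.span ℂ (monomialFamily m '' {a | len a.1 = n}) ⊔ negligible r r₀ n) :
    ⊤ ≤ Submodule.span ℂ (Set.range fun a : I × G =>
      RingQuot.mkAlgHom ℂ r (monomialFamily m a)) := by
  intro x _
  obtain ⟨t, rfl⟩ := RingQuot.mkAlgHom_surjective ℂ r x
  have ht : t ∈ ⨆ n, Smash.component ρ n := by rw [Smash.iSup_component]; trivial
  have h : ⨆ n, Smash.component ρ n ≤ (Submodule.span ℂ (Set.range fun a : I × G =>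
      RingQuot.mkAlgHom ℂ r (monomialFamily m a))).comap (RingQuot.mkAlgHom ℂ r).toLinearMap := by
    refine iSup_le fun n => ?_
    refine (Smash.component_le_degreeLT (Nat.lt_succ_self n)).trans ?_
    rw [← Submodule.map_le_iff_le_comap]
    refine (map_degreeLT_le hspan _).trans ?_
    rw [Submodule.map_span, ← Set.image_comp]
    refine Submodule.span_mono ?_
    rintro _ ⟨a, _, rfl⟩
    exact ⟨a, rfl⟩
  exact h ht

/-- Write t = s + j with s a combination of monomials of degree n and j negligible. Both sides of
the equivalence amount to s = 0. In the homogeneous quotient t and s agree, and the monomials are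
independent there. In the deformed quotient, t being of degree < n puts s in the span of the
monomials of smaller degree, which meets the span of those of degree n only in 0. -/
theorem isPBW_of_linearIndependent
    (hspan : ∀ n, Smash.component ρ n ≤
      Submodule.span ℂ (monomialFamily m '' {a | len a.1 = n}) ⊔ negligible r r₀ n)
    (hind : LinearIndependent ℂ fun a : I × G => RingQuot.mkAlgHom ℂ r (monomialFamily m a))
    (hind₀ : LinearIndependent ℂ fun a : I × G => RingQuot.mkAlgHom ℂ r₀ (monomialFamily m a)) :
    IsPBW ρ r r₀ := by
  have inj : ∀ {r' : Smash ρ → Smash ρ → Prop},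
      (LinearIndependent ℂ fun a : I × G => RingQuot.mkAlgHom ℂ r' (monomialFamily m a)) →
      ∀ s ∈ Submodule.span ℂ (Set.range (monomialFamily m)), RingQuot.mkAlgHom ℂ r' s = 0 →
        s = 0 := by
    intro r' hr' s hs h0
    obtain ⟨c, rfl⟩ := (Finsupp.mem_span_range_iff_exists_finsupp).1 hs
    have : c = 0 := by
      refine (linearIndependent_iff.1 hr') c ?_
      rw [Finsupp.linearCombination_apply]
      simpa [Finsupp.sum, map_sum] using h0
    rw [this, Finsupp.sum_zero_index]
  intro n t ht
  obtain ⟨s, hs, j, hj, rfl⟩ := Submodule.mem_sup.1 (hspan n ht)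
  have hs' : s ∈ Submodule.span ℂ (Set.range (monomialFamily m)) :=
    Submodule.span_mono (Set.image_subset_range _ _) hs
  constructor
  · intro h
    rw [map_add] at h
    have h1 : RingQuot.mkAlgHom ℂ r s ∈
        (Smash.degreeLT ρ n).map (RingQuot.mkAlgHom ℂ r).toLinearMap :=
      (Submodule.add_mem_iff_left _ (show RingQuot.mkAlgHom ℂ r j ∈ _ from hj.2)).1 h
    have h2 := map_degreeLT_le hspan n h1
    have h3 : RingQuot.mkAlgHom ℂ r s ∈ (Submodule.span ℂ
        (monomialFamily m '' {a : I × G | len a.1 = n})).map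
          (RingQuot.mkAlgHom ℂ r).toLinearMap := Submodule.mem_map_of_mem hs
    rw [Submodule.map_span, ← Set.image_comp] at h2 h3
    have hd : Disjoint {a : I × G | len a.1 < n} {a : I × G | len a.1 = n} :=
      Set.disjoint_left.2 fun a h h' => (ne_of_lt h) h'
    have h4 : RingQuot.mkAlgHom ℂ r s = 0 :=
      Submodule.disjoint_def.1 (hind.disjoint_span_image hd) _ h2 h3
    rw [inj hind s hs' h4, zero_add]
    exact hj.1
  · intro h
    rw [map_add, (mem_negligible.1 hj).1, add_zero] at h
    rw [inj hind₀ s hs' h, zero_add]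
    exact hj.2

end PBW

end SmashGeneral

/-! ### The quadratic relations from commuting x, commuting y and symmetric [y, x]. -/

section QuadraticRelations

variable {ι T : Type} [Ring T] {x y : ι → T} {s : ι → ι → T}

/-- The Jacobi identity for y_a, y_b, x_c, in which the term with [y_a, y_b] drops out. -/
theorem commutator_y_symm (yy : ∀ a b, y a * y b = y b * y a)
    (yx : ∀ a b, y a * x b - x b * y a = s a b) (a b c : ι) :
    s b c * y a - y a * s b c = s a c * y b - y b * s a c := by
  have h := yy a b
  have h1 : y a * (y b * x c) = y b * (y a * x c) := by rw [← mul_assoc, h, mul_assoc]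
  have h2 : x c * y b * y a = x c * y a * y b := by rw [mul_assoc, ← h, mul_assoc]
  rw [← yx, ← yx]
  simp only [sub_mul, mul_sub, h1, h2, mul_assoc]
  simp only [h]
  abel

theorem commutator_x_symm (xx : ∀ a b, x a * x b = x b * x a)
    (yx : ∀ a b, y a * x b - x b * y a = s a b) (a b c : ι) :
    s c b * x a - x a * s c b = s c a * x b - x b * s c a := by
  have h := xx a b
  have h1 : y c * x b * x a = y c * x a * x b := by rw [mul_assoc, ← h, mul_assoc]
  have h2 : x a * (x b * y c) = x b * (x a * y c) := by rw [← mul_assoc, h, mul_assoc]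
  rw [← yx, ← yx]
  simp only [sub_mul, mul_sub, h1, h2, mul_assoc]
  abel

/-- Here q is the ordered product x x y y, and D, D' are the commutators [s, y], [s, x], symmetric
in all three indices by Jacobi. Hiding them behind an existential leaves symbols with known
symmetries, so that each of the four quadratic relations reduces to additive cancellation. -/
theorem exists_normal_form (xx : ∀ a b, x a * x b = x b * x a)
    (yy : ∀ a b, y a * y b = y b * y a)
    (yx : ∀ a b, y a * x b - x b * y a = s a b) (ss : ∀ a b, s a b = s b a) :
    ∃ (q : ι → ι → ι → ι → T) (D D' : ι → ι → ι → T),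
      (∀ a b c d, x a * y b * (x c * y d) = q a c b d + x a * y d * s b c + x a * D b c d) ∧
      (∀ a b c d, s a b * (x c * y d) = x c * y d * s a b + x c * D a b d + D' a b c * y d) ∧
      (∀ a b c d, q a b c d = q b a c d) ∧ (∀ a b c d, q a b c d = q a b d c) ∧
      (∀ a b c, D a b c = D b a c) ∧ (∀ a b c, D a b c = D a c b) ∧
      (∀ a b c, D' a b c = D' b a c) ∧ (∀ a b c, D' a b c = D' a c b) := by
  refine ⟨fun a b c d => x a * x b * (y c * y d), fun a b c => s a b * y c - y c * s a b,
    fun a b c => s a b * x c - x c * s a b, fun a b c d => ?_, fun a b c d => ?_,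
    fun a b c d => ?_, fun a b c d => ?_, fun a b c => ?_, fun a b c => ?_, fun a b c => ?_,
    fun a b c => ?_⟩
  · have h : y b * x c = x c * y b + s b c := by rw [← yx]; abel
    have : x a * y b * (x c * y d) = x a * (y b * x c) * y d := by simp only [mul_assoc]
    rw [this, h]
    noncomm_ring
  · noncomm_ring
  · simp only [xx]
  · simp only [yy]
  · simp only [ss a b]
  · simp only [ss a]
    exact commutator_y_symm yy yx c b a
  · simp only [ss a b]
  · exact commutator_x_symm xx yx c b a

theorem so_comm_relation (xx : ∀ a b, x a * x b = x b * x a)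
    (yy : ∀ a b, y a * y b = y b * y a)
    (yx : ∀ a b, y a * x b - x b * y a = s a b) (ss : ∀ a b, s a b = s b a) (a b c d : ι) :
    (x a * y b - x b * y a) * (x c * y d - x d * y c) -
        (x c * y d - x d * y c) * (x a * y b - x b * y a) =
      (x a * y d - x d * y a) * s b c + (x b * y c - x c * y b) * s a d
        - (x a * y c - x c * y a) * s b d - (x b * y d - x d * y b) * s a c := by
  obtain ⟨q, D, D', h1, -, hq, hq', hD, hD', -, -⟩ := exists_normal_form xx yy yx ss
  simp only [sub_mul, mul_sub, h1]
  simp only [hq, hq', hD, hD', ss]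
  abel

theorem so_cross_relation (xx : ∀ a b, x a * x b = x b * x a)
    (yy : ∀ a b, y a * y b = y b * y a)
    (yx : ∀ a b, y a * x b - x b * y a = s a b) (ss : ∀ a b, s a b = s b a) (a b c d : ι) :
    (x a * y b - x b * y a) * (x c * y d - x d * y c) +
        (x b * y c - x c * y b) * (x a * y d - x d * y a) +
        (x c * y a - x a * y c) * (x b * y d - x d * y b) =
      (x c * y a - x a * y c) * s b d + (x a * y b - x b * y a) * s c d
        + (x b * y c - x c * y b) * s a d := by
  obtain ⟨q, D, D', h1, -, hq, hq', hD, hD', -, -⟩ := exists_normal_form xx yy yx ss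
  simp only [sub_mul, mul_sub, h1]
  simp only [hq, hq', hD, hD', ss]
  abel

theorem gl_cross_relation (xx : ∀ a b, x a * x b = x b * x a)
    (yy : ∀ a b, y a * y b = y b * y a)
    (yx : ∀ a b, y a * x b - x b * y a = s a b) (ss : ∀ a b, s a b = s b a) (a b c d : ι) :
    x a * y b * (x c * y d) - x a * y d * (x c * y b) =
      x a * y d * s c b - x a * y b * s c d := by
  obtain ⟨q, D, D', h1, -, hq, hq', hD, hD', -, -⟩ := exists_normal_form xx yy yx ss
  simp only [h1]
  simp only [hq', hD, hD', ss]
  abel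

theorem gl_comm_relation (xx : ∀ a b, x a * x b = x b * x a)
    (yy : ∀ a b, y a * y b = y b * y a)
    (yx : ∀ a b, y a * x b - x b * y a = s a b) (ss : ∀ a b, s a b = s b a) (a b c d : ι) :
    x a * y b * (x c * y d) - x c * y d * (x a * y b) =
      x a * y d * s b c - s a d * (x c * y b) + (s c d * (x a * y b) - x a * y b * s c d) := by
  obtain ⟨q, D, D', h1, h2, hq, hq', hD, hD', hE, hE'⟩ := exists_normal_form xx yy yx ss
  simp only [h1, h2]
  simp only [hq, hq', hD, hD', ss, hE, hE']
  abel

end QuadraticRelations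

/-! ### Linear maps on the complexification of V. -/

section Complexification

variable {N : ℕ}

/-- The standard basis of the complexification. -/
def vcBasis (N : ℕ) : Module.Basis (Fin N) ℂ (VC N) :=
  Algebra.TensorProduct.basis ℂ (EuclideanSpace.basisFun (Fin N) ℝ).toBasis

theorem vcBasis_apply (i : Fin N) : vcBasis N i = cx (e i) := by
  simp [vcBasis, cx, e]

theorem eq_sum_e (ξ : Vec N) : ξ = ∑ i, ξ i • e i := by
  ext j
  simp [e, Pi.single_apply]

theorem cx_eq_sum (ξ : Vec N) : cx ξ = ∑ i, ((ξ i : ℝ) : ℂ) • cx (e i) := by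
  conv_lhs => rw [eq_sum_e ξ]
  simp only [cx, TensorProduct.tmul_sum, TensorProduct.tmul_smul]
  refine Finset.sum_congr rfl fun i _ => ?_
  rw [TensorProduct.smul_tmul', TensorProduct.smul_tmul']
  simp

theorem span_cx : Submodule.span ℂ (Set.range fun i : Fin N => cx (e i)) = ⊤ := by
  rw [← (vcBasis N).span_eq]
  congr 2
  funext i
  exact (vcBasis_apply i).symm

theorem vc_induction {p : VC N → Prop} (cx : ∀ ξ, p (cx ξ)) (zero : p 0)
    (add : ∀ u v, p u → p v → p (u + v)) (smul : ∀ (c : ℂ) u, p u → p (c • u)) (u : VC N) :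
    p u := by
  have hu : u ∈ Submodule.span ℂ (Set.range fun i : Fin N => DunklAngular.cx (e i)) := by
    rw [span_cx]; trivial
  induction hu using Submodule.span_induction with
  | mem x hx => obtain ⟨i, rfl⟩ := hx; exact cx _
  | zero => exact zero
  | add x y _ _ hx hy => exact add x y hx hy
  | smul c x _ hx => exact smul c x hx

variable {T : Type} [AddCommGroup T] [Module ℂ T]

/-- The linear map on the complexification with prescribed values on the standard basis. -/
def vcLift (f : Fin N → T) : VC N →ₗ[ℂ] T := (vcBasis N).constr ℂ f

theorem vcLift_cx (f : Fin N → T) (ξ : Vec N) :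
    vcLift f (cx ξ) = ∑ i, ((ξ i : ℝ) : ℂ) • f i := by
  rw [cx_eq_sum, map_sum]
  refine Finset.sum_congr rfl fun i _ => ?_
  rw [map_smul, ← vcBasis_apply, vcLift, Module.Basis.constr_basis]

end Complexification

/-! ### Realizations of the Cherednik relations and the representations they induce. -/

section Realization

variable {N : ℕ} {R : CoxeterRootSystem N}

/-- Elements `X_u`, `Y_u`, `w` of an algebra which satisfy the relations of the rational Cherednik
algebra, with an arbitrary symmetric family `σ` of elements of the group algebra as the commutators
of `Y` and `X`. -/
structure Realization (R : CoxeterRootSystem N) (σ : Vec N → Vec N → R.CW) (T : Type) [Ring T]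
    [Algebra ℂ T] where
  X : VC N →ₗ[ℂ] T
  Y : VC N →ₗ[ℂ] T
  grp : R.W →* T
  symm : ∀ ξ η, σ ξ η = σ η ξ
  XX : ∀ ξ η, X (cx ξ) * X (cx η) = X (cx η) * X (cx ξ)
  YY : ∀ ξ η, Y (cx ξ) * Y (cx η) = Y (cx η) * Y (cx ξ)
  YX : ∀ ξ η, Y (cx ξ) * X (cx η) - X (cx η) * Y (cx ξ) =
    MonoidAlgebra.lift ℂ T R.W grp (σ ξ η)
  grp_X_cx : ∀ w ξ, grp w * X (cx ξ) = X (cx (w.1 ξ)) * grp w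
  grp_Y_cx : ∀ w ξ, grp w * Y (cx ξ) = Y (cx (w.1 ξ)) * grp w

variable {σ : Vec N → Vec N → R.CW} {T : Type} [Ring T] [Algebra ℂ T] (D : Realization R σ T)

namespace Realization

theorem grp_X (w : R.W) (u : VC N) : D.grp w * D.X u = D.X (repV R w u) * D.grp w := by
  induction u using vc_induction with
  | cx ξ => rw [repV_cx, D.grp_X_cx]
  | zero => simp
  | add u v hu hv => simp only [map_add, mul_add, add_mul, hu, hv]
  | smul c u hu => simp only [map_smul, mul_smul_comm, smul_mul_assoc, hu]

theorem grp_Y (w : R.W) (u : VC N) : D.grp w * D.Y u = D.Y (repV R w u) * D.grp w := by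
  induction u using vc_induction with
  | cx ξ => rw [repV_cx, D.grp_Y_cx]
  | zero => simp
  | add u v hu hv => simp only [map_add, mul_add, add_mul, hu, hv]
  | smul c u hu => simp only [map_smul, mul_smul_comm, smul_mul_assoc, hu]

/-- The linear map `u ⊗ v ↦ X_u Y_v`. -/
def tensorMap : VC N ⊗[ℂ] VC N →ₗ[ℂ] T :=
  TensorProduct.lift ((LinearMap.mul ℂ T).compl₁₂ D.X D.Y)

theorem tensorMap_tmul (u v : VC N) : D.tensorMap (u ⊗ₜ v) = D.X u * D.Y v := by
  simp [tensorMap]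

/-- The alternating map `(u, v) ↦ X_u Y_v - X_v Y_u`. -/
def alternating : VC N [⋀^Fin 2]→ₗ[ℂ] T where
  toFun v := D.X (v 0) * D.Y (v 1) - D.X (v 1) * D.Y (v 0)
  map_update_add' v i a b := by
    fin_cases i <;> simp [Function.update, add_mul, mul_add] <;> abel
  map_update_smul' v i c a := by
    fin_cases i <;> simp [Function.update, smul_sub]
  map_eq_zero_of_eq' v i j h hij := by
    have : v 0 = v 1 := by
      fin_cases i <;> fin_cases j <;> simp_all
    simp [this]

/-- The linear map `u ∧ v ↦ X_u Y_v - X_v Y_u`. -/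
def lambdaMap : ⋀[ℂ]^2 (VC N) →ₗ[ℂ] T :=
  exteriorPower.alternatingMapLinearEquiv D.alternating

theorem lambdaMap_ιMulti (v : Fin 2 → VC N) :
    D.lambdaMap (exteriorPower.ιMulti ℂ 2 v) = D.X (v 0) * D.Y (v 1) - D.X (v 1) * D.Y (v 0) :=
  exteriorPower.alternatingMapLinearEquiv_apply_ιMulti _ _

theorem tensorMap_equivariant (w : R.W) (t : VC N ⊗[ℂ] VC N) :
    D.tensorMap (repTensor R w t) * D.grp w = D.grp w * D.tensorMap t := by
  induction t using TensorProduct.induction_on with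
  | zero => simp
  | add s t hs ht => simp only [map_add, mul_add, add_mul, hs, ht]
  | tmul u v =>
    have : repTensor R w (u ⊗ₜ v) = repV R w u ⊗ₜ repV R w v := rfl
    rw [this, tensorMap_tmul, tensorMap_tmul, ← mul_assoc, grp_X, mul_assoc, mul_assoc, grp_Y]

theorem lambdaMap_equivariant (w : R.W) (t : ⋀[ℂ]^2 (VC N)) :
    D.lambdaMap (repLambda R w t) * D.grp w = D.grp w * D.lambdaMap t := by
  have : (LinearMap.mulRight ℂ (D.grp w)).comp (D.lambdaMap.comp (repLambda R w)) =
      (LinearMap.mulLeft ℂ (D.grp w)).comp D.lambdaMap := by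
    refine exteriorPower.linearMap_ext ?_
    ext v
    have h : repLambda R w (exteriorPower.ιMulti ℂ 2 v) =
      exteriorPower.ιMulti ℂ 2 (repV R w ∘ v) := exteriorPower.map_apply_ιMulti _ _
    simp only [LinearMap.compAlternatingMap_apply, LinearMap.comp_apply, h, lambdaMap_ιMulti,
      LinearMap.mulRight_apply, LinearMap.mulLeft_apply, Function.comp_apply, sub_mul, mul_sub]
    rw [mul_assoc, ← grp_Y, ← mul_assoc, ← grp_X, mul_assoc (D.X _), ← grp_Y, ← mul_assoc,
      ← grp_X, mul_assoc, mul_assoc]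
  exact LinearMap.congr_fun this t

theorem sum_equivariant (w : R.W) (t : VC N × VC N) :
    (D.X.coprod D.Y) (repSum R w t) * D.grp w = D.grp w * (D.X.coprod D.Y) t := by
  have : repSum R w t = (repV R w t.1, repV R w t.2) := rfl
  rw [this, LinearMap.coprod_apply, LinearMap.coprod_apply, mul_add, add_mul, grp_X, grp_Y]

/-- The map `T(Λ²V) # ℂW → T` given by a realization. -/
def soSmash : Smash (repLambda R) →ₐ[ℂ] T :=
  Smash.lift _ D.lambdaMap D.grp D.lambdaMap_equivariant

/-- The map `T(V ⊗ V) # ℂW → T` given by a realization. -/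
def glSmash : Smash (repTensor R) →ₐ[ℂ] T :=
  Smash.lift _ D.tensorMap D.grp D.tensorMap_equivariant

/-- The map `T(V ⊕ V) # ℂW → T` given by a realization. -/
def sumSmash : Smash (repSum R) →ₐ[ℂ] T :=
  Smash.lift _ (D.X.coprod D.Y) D.grp D.sum_equivariant

theorem soSmash_M (ξ η : Vec N) : D.soSmash (smM R ξ η) =
    D.X (cx ξ) * D.Y (cx η) - D.X (cx η) * D.Y (cx ξ) :=
  (Smash.lift_gen _ _ _ _).trans (D.lambdaMap_ιMulti _)

theorem glSmash_E (ξ η : Vec N) : D.glSmash (smE R ξ η) = D.X (cx ξ) * D.Y (cx η) :=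
  (Smash.lift_gen _ _ _ _).trans (D.tensorMap_tmul _ _)

theorem soSmash_grp (w : R.W) : D.soSmash (Smash.grp _ w) = D.grp w := Smash.lift_grp _ _ _ _

theorem glSmash_grp (w : R.W) : D.glSmash (Smash.grp _ w) = D.grp w := Smash.lift_grp _ _ _ _

theorem sumSmash_X (ξ : Vec N) : D.sumSmash (chX R ξ) = D.X (cx ξ) :=
  (Smash.lift_gen _ _ _ _).trans (by simp)

theorem sumSmash_Y (ξ : Vec N) : D.sumSmash (chY R ξ) = D.Y (cx ξ) :=
  (Smash.lift_gen _ _ _ _).trans (by simp)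

theorem sumSmash_grp (w : R.W) : D.sumSmash (Smash.grp _ w) = D.grp w := Smash.lift_grp _ _ _ _

theorem soSmash_rel {a b : Smash (repLambda R)} (h : SoRel R σ a b) :
    D.soSmash a = D.soSmash b := by
  have hs : ∀ ξ η, MonoidAlgebra.lift ℂ T R.W D.grp (σ ξ η) =
    MonoidAlgebra.lift ℂ T R.W D.grp (σ η ξ) := fun ξ η => by rw [D.symm]
  cases h with
  | comm ξ η φ ψ =>
    simp only [map_sub, map_mul, map_add, soSmash_M, Smash.map_grpAlg _ D.grp D.soSmash_grp]
    exact so_comm_relation D.XX D.YY D.YX hs ξ η φ ψ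
  | cross ξ η φ ψ =>
    simp only [map_mul, map_add, soSmash_M, Smash.map_grpAlg _ D.grp D.soSmash_grp]
    exact so_cross_relation D.XX D.YY D.YX hs ξ η φ ψ

theorem glSmash_rel {a b : Smash (repTensor R)} (h : GlRel R σ a b) :
    D.glSmash a = D.glSmash b := by
  have hs : ∀ ξ η, MonoidAlgebra.lift ℂ T R.W D.grp (σ ξ η) =
    MonoidAlgebra.lift ℂ T R.W D.grp (σ η ξ) := fun ξ η => by rw [D.symm]
  cases h with
  | comm i j k l =>
    simp only [map_sub, map_mul, map_add, glSmash_E, Smash.map_grpAlg _ D.grp D.glSmash_grp]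
    exact gl_comm_relation D.XX D.YY D.YX hs (e i) (e j) (e k) (e l)
  | cross i j k l =>
    simp only [map_sub, map_mul, glSmash_E, Smash.map_grpAlg _ D.grp D.glSmash_grp]
    exact gl_cross_relation D.XX D.YY D.YX hs (e i) (e j) (e k) (e l)

/-- The representation of the `so(N)` quotient given by a realization. -/
def soHom : RingQuot (SoRel R σ) →ₐ[ℂ] T :=
  RingQuot.liftAlgHom ℂ ⟨D.soSmash, fun _ _ h => D.soSmash_rel h⟩

/-- The representation of the `gl(N)` quotient given by a realization. -/
def glHom : RingQuot (GlRel R σ) →ₐ[ℂ] T :=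
  RingQuot.liftAlgHom ℂ ⟨D.glSmash, fun _ _ h => D.glSmash_rel h⟩

theorem soHom_mk (a : Smash (repLambda R)) :
    D.soHom (RingQuot.mkAlgHom ℂ _ a) = D.soSmash a :=
  RingQuot.liftAlgHom_mkAlgHom_apply _ _ _ _

theorem glHom_mk (a : Smash (repTensor R)) :
    D.glHom (RingQuot.mkAlgHom ℂ _ a) = D.glSmash a :=
  RingQuot.liftAlgHom_mkAlgHom_apply _ _ _ _

end Realization

/-- The representation of the rational Cherednik algebra given by a realization. -/
def Realization.cherednikHom {P : R.PositiveHalf} {g : Vec N → ℂ} (D : Realization R (S P g) T) :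
    Cherednik P g →ₐ[ℂ] T :=
  RingQuot.liftAlgHom ℂ ⟨D.sumSmash, fun a b h => by
    cases h with
    | xx ξ η => rw [map_mul, map_mul, D.sumSmash_X, D.sumSmash_X, D.XX]
    | yy ξ η => rw [map_mul, map_mul, D.sumSmash_Y, D.sumSmash_Y, D.YY]
    | yx ξ η =>
      rw [map_sub, map_mul, map_mul, D.sumSmash_X, D.sumSmash_Y, D.YX,
        Smash.map_grpAlg _ D.grp D.sumSmash_grp]⟩

theorem Realization.cherednikHom_mk {P : R.PositiveHalf} {g : Vec N → ℂ}
    (D : Realization R (S P g) T) (a : Smash (repSum R)) :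
    D.cherednikHom (RingQuot.mkAlgHom ℂ _ a) = D.sumSmash a :=
  RingQuot.liftAlgHom_mkAlgHom_apply _ _ _ _

theorem S_symm (P : R.PositiveHalf) (g : Vec N → ℂ) (ξ η : Vec N) : S P g ξ η = S P g η ξ := by
  simp only [S, real_inner_comm ξ η, mul_comm (inner ℝ _ ξ)]

/-- The tautological realization in the rational Cherednik algebra. -/
def cherednikRealization (P : R.PositiveHalf) (g : Vec N → ℂ) :
    Realization R (S P g) (Cherednik P g) where
  X := (RingQuot.mkAlgHom ℂ (CherednikRel P g)).toLinearMap ∘ₗ Smash.genLin (repSum R) ∘ₗ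
    LinearMap.inl ℂ _ _
  Y := (RingQuot.mkAlgHom ℂ (CherednikRel P g)).toLinearMap ∘ₗ Smash.genLin (repSum R) ∘ₗ
    LinearMap.inr ℂ _ _
  grp := (RingQuot.mkAlgHom ℂ (CherednikRel P g) : Smash (repSum R) →* Cherednik P g).comp
    (Smash.grp (repSum R))
  symm := S_symm P g
  XX ξ η := by
    have := RingQuot.mkAlgHom_rel ℂ (CherednikRel.xx (P := P) (g := g) ξ η)
    rwa [map_mul, map_mul] at this
  YY ξ η := by
    have := RingQuot.mkAlgHom_rel ℂ (CherednikRel.yy (P := P) (g := g) ξ η)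
    rwa [map_mul, map_mul] at this
  YX ξ η := by
    have := RingQuot.mkAlgHom_rel ℂ (CherednikRel.yx (P := P) (g := g) ξ η)
    rw [map_sub, map_mul, map_mul] at this
    exact this.trans (Smash.map_grpAlg _ _ (fun _ => rfl) _)
  grp_X_cx w ξ := by
    have := congrArg (RingQuot.mkAlgHom ℂ (CherednikRel P g))
      (Smash.grp_mul_gen (ρ := repSum R) w (cx ξ, 0))
    rw [map_mul, map_mul] at this
    have h : repSum R w (cx ξ, 0) = (cx (w.1 ξ), 0) :=
      Prod.ext (repV_cx R w ξ) (map_zero (repV R w))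
    rw [h] at this
    exact this
  grp_Y_cx w ξ := by
    have := congrArg (RingQuot.mkAlgHom ℂ (CherednikRel P g))
      (Smash.grp_mul_gen (ρ := repSum R) w (0, cx ξ))
    rw [map_mul, map_mul] at this
    have h : repSum R w (0, cx ξ) = (0, cx (w.1 ξ)) :=
      Prod.ext (map_zero (repV R w)) (repV_cx R w ξ)
    rw [h] at this
    exact this

end Realization

/-! ### Reflections and sums over a positive half. -/

section Reflections

variable {N : ℕ} {R : CoxeterRootSystem N}

theorem refl_apply (α ξ : Vec N) :
    refl α ξ = ξ - (2 * (inner ℝ α ξ / inner ℝ α α)) • α := by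
  rw [refl, Submodule.reflection_orthogonal_apply, Submodule.reflection_singleton_apply,
    real_inner_self_eq_norm_sq]
  simp only [RCLike.ofReal_real_eq_id, id, neg_sub, two_smul, two_mul, add_smul]

theorem refl_self (α : Vec N) : refl α α = -α :=
  Submodule.reflection_orthogonalComplement_singleton_eq_neg α

theorem refl_neg (α : Vec N) : refl (-α) = refl α := by
  ext1 ξ
  simp only [refl_apply, inner_neg_left, inner_neg_right, neg_neg, neg_div, mul_neg, neg_smul,
    smul_neg]

theorem refl_map (w : Vec N ≃ₗᵢ[ℝ] Vec N) (α ξ : Vec N) : refl (w α) (w ξ) = w (refl α ξ) := by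
  simp only [refl_apply, map_sub, map_smul, LinearIsometryEquiv.inner_map_map]

theorem neg_mem_roots {α : Vec N} (hα : α ∈ R.roots) : -α ∈ R.roots := by
  rw [← refl_self]
  exact R.refl_mem α hα α hα

theorem W_map_roots (w : R.W) {α : Vec N} (hα : α ∈ R.roots) : w.1 α ∈ R.roots := by
  have key : ∀ w ∈ R.W, ∀ α ∈ R.roots, w α ∈ R.roots := by
    intro w hw
    induction hw using Subgroup.closure_induction'' with
    | mem s hs =>
      obtain ⟨β, hβ, rfl⟩ := hs
      exact R.refl_mem β hβ
    | inv_mem s hs =>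
      obtain ⟨β, hβ, rfl⟩ := hs
      intro α hα
      have : (refl β)⁻¹ = refl β := Submodule.reflection_symm
      rw [this]
      exact R.refl_mem β hβ α hα
    | one => exact fun α hα => hα
    | mul v w _ _ hv hw => exact fun α hα => hv _ (hw α hα)
  exact key w.1 w.2 α hα

theorem sum_roots_eq {M : Type} [AddCommGroup M] [Module ℂ M] (P : R.PositiveHalf)
    (F : Vec N → M) (hF : ∀ α ∈ R.roots, F (-α) = F α) :
    ∑ α ∈ R.roots, F α = (2 : ℂ) • ∑ α ∈ P.pos, F α := by
  classical
  have h : ∑ α ∈ R.roots.filter (· ∉ P.pos), F α = ∑ α ∈ P.pos, F α := by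
    refine Finset.sum_nbij' (fun α => -α) (fun α => -α) ?_ ?_ ?_ ?_ ?_
    · intro α hα
      rw [Finset.mem_filter] at hα
      by_contra hn
      exact hα.2 ((P.mem_iff α hα.1).2 hn)
    · intro α hα
      have h1 := P.subset hα
      exact Finset.mem_filter.2 ⟨neg_mem_roots h1, (P.mem_iff α h1).1 hα⟩
    · simp
    · simp
    · intro α hα
      exact (hF α (Finset.mem_filter.1 hα).1).symm
  rw [← Finset.sum_filter_add_sum_filter_not R.roots (· ∈ P.pos), h, two_smul]
  congr 1
  refine Finset.sum_congr ?_ fun _ _ => rfl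
  ext α
  rw [Finset.mem_filter]
  exact ⟨fun h => h.2, fun h => ⟨P.subset h, h⟩⟩

/-- A positive half need not be stable under W, but the full root system is, and for an even summand
the sum over a half is half of the full sum. -/
theorem sum_pos_comp {M : Type} [AddCommGroup M] [Module ℂ M] (P : R.PositiveHalf)
    (F : Vec N → M) (hF : ∀ α ∈ R.roots, F (-α) = F α) (w : R.W) :
    ∑ α ∈ P.pos, F (w.1 α) = ∑ α ∈ P.pos, F α := by
  have h1 := sum_roots_eq P F hF
  have h2 := sum_roots_eq P (fun α => F (w.1 α)) fun α hα => by
    rw [map_neg, hF _ (W_map_roots w hα)]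
  have h3 : ∑ α ∈ R.roots, F (w.1 α) = ∑ α ∈ R.roots, F α := by
    refine Finset.sum_nbij' (fun α => w.1 α) (fun α => (w⁻¹).1 α) (fun α hα => W_map_roots w hα)
      (fun α hα => W_map_roots w⁻¹ hα) (fun α _ => ?_) (fun α _ => ?_) (fun _ _ => rfl)
    · change (w.1⁻¹ * w.1) α = α
      rw [inv_mul_cancel]; rfl
    · change (w.1 * w.1⁻¹) α = α
      rw [mul_inv_cancel]; rfl
  rw [h1, h2] at h3
  exact smul_right_injective M (two_ne_zero (α := ℂ)) h3

end Reflections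

/-! ### The Dunkl operators satisfy the Cherednik relations. -/

section Dunkl

open MvPolynomial

variable {N : ℕ} {R : CoxeterRootSystem N}

theorem linForm_add (ξ η : Vec N) : linForm (ξ + η) = linForm ξ + linForm η := by
  simp [linForm, add_mul, Finset.sum_add_distrib]

theorem linForm_smul (c : ℝ) (ξ : Vec N) : linForm (c • ξ) = (c : ℂ) • linForm ξ := by
  simp [linForm, Finset.smul_sum, MvPolynomial.smul_eq_C_mul, mul_assoc]

theorem linRat_add (ξ η : Vec N) : linRat (ξ + η) = linRat ξ + linRat η := by
  simp [linRat, linForm_add]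

theorem linRat_smul (c : ℝ) (ξ : Vec N) : linRat (c • ξ) = (c : ℂ) • linRat ξ := by
  rw [linRat, linForm_smul]
  exact map_smul (IsScalarTower.toAlgHom ℂ (MvPolynomial (Fin N) ℂ) (RatFun N)) _ _

theorem linRat_neg (ξ : Vec N) : linRat (-ξ) = -linRat ξ := by
  simpa using linRat_smul (-1) ξ

theorem linRat_sub (ξ η : Vec N) : linRat (ξ - η) = linRat ξ - linRat η := by
  rw [sub_eq_add_neg, linRat_add, linRat_neg, sub_eq_add_neg]

theorem coeff_linForm (ξ : Vec N) (i : Fin N) :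
    (linForm ξ).coeff (Finsupp.single i 1) = ((ξ i : ℝ) : ℂ) := by
  classical
  simp [linForm, coeff_sum, coeff_C_mul, coeff_X, Finsupp.single_left_inj]

theorem linForm_injective : Function.Injective (linForm : Vec N → _) := by
  intro ξ η h
  ext i
  have := congrArg (coeff (Finsupp.single i 1)) h
  rw [coeff_linForm, coeff_linForm] at this
  exact_mod_cast this

theorem linForm_zero : linForm (0 : Vec N) = 0 := by simp [linForm]

theorem linRat_injective : Function.Injective (linRat : Vec N → _) :=
  (IsFractionRing.injective (MvPolynomial (Fin N) ℂ) (RatFun N)).comp linForm_injective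

theorem linRat_ne_zero {ξ : Vec N} (h : ξ ≠ 0) : linRat ξ ≠ 0 := by
  have h0 : linRat (0 : Vec N) = 0 := by simp [linRat, linForm_zero]
  rw [← h0]
  exact fun h' => h (linRat_injective h')

/-- A denominator-free form of f = p/q: identities are checked on polynomials and extended to
rational functions by cancelling the image of q. -/
theorem ratFun_div (f : RatFun N) : ∃ p q : MvPolynomial (Fin N) ℂ,
    algebraMap _ (RatFun N) q ≠ 0 ∧ f * algebraMap _ (RatFun N) q = algebraMap _ (RatFun N) p := by
  obtain ⟨p, q, hq, rfl⟩ := IsFractionRing.div_surjective (A := MvPolynomial (Fin N) ℂ) f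
  have : algebraMap _ (RatFun N) q ≠ 0 := IsFractionRing.to_map_ne_zero_of_mem_nonZeroDivisors hq
  exact ⟨p, q, this, div_mul_cancel₀ _ this⟩

theorem opW_mul_apply (w : Vec N ≃ₗᵢ[ℝ] Vec N) (f h : RatFun N) :
    opW w (f * h) = opW w f * opW w h :=
  map_mul (IsFractionRing.algEquivOfAlgEquiv (K := RatFun N) (L := RatFun N) (polyAct w)) f h

theorem opW_one_apply (w : Vec N ≃ₗᵢ[ℝ] Vec N) : opW w (1 : RatFun N) = 1 :=
  map_one (IsFractionRing.algEquivOfAlgEquiv (K := RatFun N) (L := RatFun N) (polyAct w))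

theorem opW_inv_apply (w : Vec N ≃ₗᵢ[ℝ] Vec N) (f : RatFun N) : opW w f⁻¹ = (opW w f)⁻¹ :=
  map_inv₀ (IsFractionRing.algEquivOfAlgEquiv (K := RatFun N) (L := RatFun N) (polyAct w)) f

theorem opW_ne_zero (w : Vec N ≃ₗᵢ[ℝ] Vec N) {f : RatFun N} (h : f ≠ 0) : opW w f ≠ 0 :=
  (map_ne_zero (IsFractionRing.algEquivOfAlgEquiv (K := RatFun N) (L := RatFun N)
    (polyAct w))).2 h

theorem opW_linRat (w : Vec N ≃ₗᵢ[ℝ] Vec N) (ξ : Vec N) : opW w (linRat ξ) = linRat (w ξ) := by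
  rw [linRat, opW_algebraMap, polyHom_linForm, linRat]

theorem polyHom_mul (v w : Vec N ≃ₗᵢ[ℝ] Vec N) (p : MvPolynomial (Fin N) ℂ) :
    polyHom (v * w) p = polyHom v (polyHom w p) := by
  have : polyHom (v * w) = (polyHom v).comp (polyHom w) := by
    ext1 i
    rw [AlgHom.comp_apply, ← linForm_e]
    simp only [polyHom_linForm]
    rfl
  rw [this]; rfl

theorem polyHom_one (p : MvPolynomial (Fin N) ℂ) :
    polyHom (1 : Vec N ≃ₗᵢ[ℝ] Vec N) p = p := by
  have : polyHom (1 : Vec N ≃ₗᵢ[ℝ] Vec N) = AlgHom.id ℂ _ := by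
    ext1 i
    rw [← linForm_e, polyHom_linForm]
    rfl
  rw [this]; rfl

theorem opW_mul (v w : Vec N ≃ₗᵢ[ℝ] Vec N) : opW (v * w) = opW v * opW w := by
  ext f
  obtain ⟨p, q, hq, h⟩ := ratFun_div f
  have h1 := congrArg (opW (v * w)) h
  have h2 := congrArg (opW v ∘ opW w) h
  simp only [Function.comp_apply, opW_mul_apply, opW_algebraMap, polyHom_mul] at h1 h2
  rw [← h2] at h1
  refine mul_right_cancel₀ (b := algebraMap _ (RatFun N) (polyHom v (polyHom w q))) ?_ h1
  rw [← opW_algebraMap, ← opW_algebraMap]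
  exact opW_ne_zero _ (opW_ne_zero _ hq)

theorem opW_one : opW (1 : Vec N ≃ₗᵢ[ℝ] Vec N) = 1 := by
  ext f
  obtain ⟨p, q, hq, h⟩ := ratFun_div f
  have h1 := congrArg (opW 1) h
  simp only [opW_mul_apply, opW_algebraMap, polyHom_one] at h1
  exact mul_right_cancel₀ hq (h1.trans h.symm)

/-- The action of `W` on rational functions. -/
def opWHom (R : CoxeterRootSystem N) : R.W →* Module.End ℂ (RatFun N) where
  toFun w := opW w.1
  map_one' := opW_one
  map_mul' v w := opW_mul v.1 w.1

theorem opX_apply (ξ : Vec N) (f : RatFun N) : opX ξ f = linRat ξ * f := rfl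

theorem opW_mul_opX (w : Vec N ≃ₗᵢ[ℝ] Vec N) (ξ : Vec N) :
    opW w * opX ξ = opX (w ξ) * opW w := by
  ext f
  change opW w (linRat ξ * f) = linRat (w ξ) * opW w f
  rw [opW_mul_apply, opW_linRat]

/-- The derivative in the direction `ξ`. -/
def dirD (ξ : Vec N) : Derivation ℂ (RatFun N) (RatFun N) :=
  ∑ i, ((ξ i : ℝ) : ℂ) • partialD i

theorem dirD_apply (ξ : Vec N) (f : RatFun N) :
    dirD ξ f = ∑ i, ((ξ i : ℝ) : ℂ) • partialD i f := by
  have : ∀ s : Finset (Fin N), (∑ i ∈ s, ((ξ i : ℝ) : ℂ) • partialD i : Derivation ℂ (RatFun N)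
      (RatFun N)) f = ∑ i ∈ s, ((ξ i : ℝ) : ℂ) • partialD i f := by
    classical
    intro s
    induction s using Finset.induction_on with
    | empty => simp
    | insert a s ha ih => rw [Finset.sum_insert ha, Finset.sum_insert ha, ← ih]; rfl
  exact this _

theorem dirD_add (ξ η : Vec N) (f : RatFun N) : dirD (ξ + η) f = dirD ξ f + dirD η f := by
  simp [dirD_apply, add_smul, Finset.sum_add_distrib]

theorem dirD_smul (c : ℝ) (ξ : Vec N) (f : RatFun N) : dirD (c • ξ) f = (c : ℂ) • dirD ξ f := by
  simp [dirD_apply, mul_smul, Finset.smul_sum]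

theorem dirD_linRat (ξ η : Vec N) :
    dirD ξ (linRat η) = algebraMap ℂ (RatFun N) ((inner ℝ ξ η : ℝ) : ℂ) := by
  have h : ∀ i, partialD i (linRat η) = algebraMap ℂ (RatFun N) ((η i : ℝ) : ℂ) := by
    intro i
    rw [linRat, partialD_algebraMap, linForm, map_sum,
      IsScalarTower.algebraMap_apply ℂ (MvPolynomial (Fin N) ℂ) (RatFun N)]
    congr 1
    simp [pderiv_X, Pi.single_apply]
  rw [dirD_apply]
  simp only [h, Algebra.smul_def, ← map_mul, ← map_sum]
  congr 1
  rw [PiLp.inner_apply]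
  push_cast
  refine Finset.sum_congr rfl fun i _ => ?_
  simp [mul_comm]

/-- Both sides obey the same Leibniz rule twisted by w, and on coordinates they agree because w is
orthogonal. This gives polynomials, and the Leibniz rule for f q = p gives quotients. -/
theorem opW_dirD (w : Vec N ≃ₗᵢ[ℝ] Vec N) (ξ : Vec N) (f : RatFun N) :
    opW w (dirD ξ f) = dirD (w ξ) (opW w f) := by
  have hmul : ∀ f h : RatFun N, opW w (dirD ξ f) = dirD (w ξ) (opW w f) →
      opW w (dirD ξ h) = dirD (w ξ) (opW w h) →
      opW w (dirD ξ (f * h)) = dirD (w ξ) (opW w (f * h)) := by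
    intro f h hf hh
    simp only [Derivation.leibniz, opW_mul_apply, map_add, smul_eq_mul, hf, hh]
  have hpoly : ∀ p : MvPolynomial (Fin N) ℂ, opW w (dirD ξ (algebraMap _ (RatFun N) p)) =
      dirD (w ξ) (opW w (algebraMap _ (RatFun N) p)) := by
    intro p
    induction p using MvPolynomial.induction_on with
    | C c =>
      have : algebraMap _ (RatFun N) (C c : MvPolynomial (Fin N) ℂ) = algebraMap ℂ _ c := rfl
      rw [this, Derivation.map_algebraMap, map_zero]
      have h2 : opW w (algebraMap ℂ (RatFun N) c) = algebraMap ℂ (RatFun N) c := by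
        rw [Algebra.algebraMap_eq_smul_one, map_smul, opW_one_apply]
      rw [h2, Derivation.map_algebraMap]
    | add p q hp hq => rw [map_add, map_add, map_add, map_add, map_add, hp, hq]
    | mul_X p i hp =>
      rw [map_mul]
      refine hmul _ _ hp ?_
      have : algebraMap _ (RatFun N) (X i : MvPolynomial (Fin N) ℂ) = linRat (e i) := by
        rw [linRat, linForm_e]
      rw [this, opW_linRat, dirD_linRat, dirD_linRat, LinearIsometryEquiv.inner_map_map,
        Algebra.algebraMap_eq_smul_one, map_smul, opW_one_apply]
  obtain ⟨p, q, hq, h⟩ := ratFun_div f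
  have h1 := hpoly p
  rw [← h, Derivation.leibniz, opW_mul_apply, Derivation.leibniz] at h1
  simp only [map_add, smul_eq_mul, opW_mul_apply, hpoly q] at h1
  exact mul_left_cancel₀ (opW_ne_zero w hq) (add_left_cancel h1)

variable (P : R.PositiveHalf) (g : Vec N → ℂ)

theorem nabla_apply (ξ : Vec N) (f : RatFun N) : nabla P g ξ f = dirD ξ f -
    ∑ α ∈ P.pos, (g α * ((inner ℝ α ξ : ℝ) : ℂ)) • ((linRat α)⁻¹ * opW (refl α) f) := by
  simp [nabla, dirD_apply, LinearMap.sub_apply, LinearMap.sum_apply]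

theorem nabla_add (ξ η : Vec N) : nabla P g (ξ + η) = nabla P g ξ + nabla P g η := by
  ext f
  simp only [LinearMap.add_apply, nabla_apply, dirD_add, inner_add_right, Complex.ofReal_add,
    mul_add, add_smul, Finset.sum_add_distrib]
  abel

theorem nabla_smul (c : ℝ) (ξ : Vec N) : nabla P g (c • ξ) = (c : ℂ) • nabla P g ξ := by
  ext f
  simp only [LinearMap.smul_apply, nabla_apply, dirD_smul, inner_smul_right, Complex.ofReal_mul,
    smul_sub, Finset.smul_sum, smul_smul]
  congr 1
  refine Finset.sum_congr rfl fun α _ => ?_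
  congr 1
  ring

theorem nabla_sub (ξ η : Vec N) : nabla P g (ξ - η) = nabla P g ξ - nabla P g η := by
  have := nabla_add P g (ξ - η) η
  rw [sub_add_cancel] at this
  rw [this, add_sub_cancel_right]

theorem opX_add (ξ η : Vec N) : opX (ξ + η) = opX ξ + opX η := by
  ext f; simp [opX_apply, linRat_add, add_mul]

theorem opX_smul (c : ℝ) (ξ : Vec N) : opX (c • ξ) = (c : ℂ) • opX ξ := by
  ext f
  change linRat (c • ξ) * f = (c : ℂ) • (linRat ξ * f)
  rw [linRat_smul, smul_mul_assoc]

/-- This transfers families indexed by real vectors, such as `opX` and `nabla P g`, to the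
complexification, where a realization requires its maps. -/
theorem vcLift_eq_of_linear {T : Type} [AddCommGroup T] [Module ℂ T] (F : Vec N → T)
    (hadd : ∀ ξ η, F (ξ + η) = F ξ + F η) (hsmul : ∀ (c : ℝ) ξ, F (c • ξ) = (c : ℂ) • F ξ)
    (ξ : Vec N) : vcLift (fun i => F (e i)) (cx ξ) = F ξ := by
  rw [vcLift_cx]
  conv_rhs => rw [eq_sum_e ξ]
  have hz : F 0 = 0 := by simpa using hsmul 0 0
  have : F (∑ i, ξ i • e i) = ∑ i, F (ξ i • e i) := map_sum (⟨⟨F, hz⟩, hadd⟩ : Vec N →+ T) _ _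
  rw [this]
  exact Finset.sum_congr rfl fun i _ => (hsmul _ _).symm

variable {g} (hg : ∀ w ∈ R.W, ∀ α ∈ R.roots, g (w α) = g α)

theorem g_neg (hg : ∀ w ∈ R.W, ∀ α ∈ R.roots, g (w α) = g α) {α : Vec N} (hα : α ∈ R.roots) :
    g (-α) = g α := by
  rw [← refl_self]
  exact hg _ (R.s α hα).2 α hα

/-- Conjugation by w turns the term of α into the term of wα, since w s_α w⁻¹ = s_{wα} and g is
invariant. The terms are even in α, as (α, ξ) and (α, x) change sign together, so `sum_pos_comp`
applies. -/
theorem opW_mul_nabla (hg : ∀ w ∈ R.W, ∀ α ∈ R.roots, g (w α) = g α) (w : R.W) (ξ : Vec N) :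
    opW w.1 * nabla P g ξ = nabla P g (w.1 ξ) * opW w.1 := by
  ext f
  change opW w.1 (nabla P g ξ f) = nabla P g (w.1 ξ) (opW w.1 f)
  have key := sum_pos_comp P (fun α => (g α * ((inner ℝ α (w.1 ξ) : ℝ) : ℂ)) •
    ((linRat α)⁻¹ * opW (refl α) (opW w.1 f))) (fun α hα => by
      have hinv : (-linRat α)⁻¹ = -(linRat α)⁻¹ := inv_neg
      simp only [hinv, g_neg hg hα, refl_neg, linRat_neg, inner_neg_left, Complex.ofReal_neg,
        mul_neg, neg_mul, neg_smul, smul_neg, neg_neg]) w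
  rw [nabla_apply, nabla_apply, map_sub, opW_dirD, map_sum, ← key]
  congr 1
  refine Finset.sum_congr rfl fun α hα => ?_
  have hw : opW w.1 (opW (refl α) f) = opW (refl (w.1 α)) (opW w.1 f) := by
    have h : w.1 * refl α = refl (w.1 α) * w.1 := by
      ext1 ζ
      exact (refl_map w.1 α ζ).symm
    have h2 := congrArg (fun v => opW v f) h
    simp only [opW_mul] at h2
    exact h2
  rw [map_smul, opW_mul_apply, opW_inv_apply, opW_linRat, hg _ w.2 α (P.subset hα),
    LinearIsometryEquiv.inner_map_map, hw]

/-- The reflection s_α changes (x, η) by a multiple of (α, x), which cancels the denominator of the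
Dunkl operator and leaves a constant multiple of s_α. -/
theorem nabla_mul_opX (ξ η : Vec N) : nabla P g ξ * opX η - opX η * nabla P g ξ =
    ((inner ℝ ξ η : ℝ) : ℂ) • 1 + ∑ α ∈ P.pos,
      (2 * g α * ((inner ℝ α ξ * inner ℝ α η / inner ℝ α α : ℝ) : ℂ)) • opW (refl α) := by
  ext f
  have key : ∀ α ∈ P.pos, (g α * ((inner ℝ α ξ : ℝ) : ℂ)) •
      ((linRat α)⁻¹ * opW (refl α) (linRat η * f)) =
      linRat η * ((g α * ((inner ℝ α ξ : ℝ) : ℂ)) • ((linRat α)⁻¹ * opW (refl α) f)) -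
      (2 * g α * ((inner ℝ α ξ * inner ℝ α η / inner ℝ α α : ℝ) : ℂ)) • opW (refl α) f := by
    intro α hα
    have hα0 : linRat α ≠ 0 := linRat_ne_zero fun h => R.zero_notMem (h ▸ P.subset hα)
    rw [opW_mul_apply, opW_linRat, refl_apply, linRat_sub, linRat_smul, sub_mul, mul_sub, smul_sub]
    congr 1
    · rw [mul_smul_comm]; congr 1; ring
    · rw [smul_mul_assoc, mul_smul_comm, ← mul_assoc, inv_mul_cancel₀ hα0, one_mul, smul_smul]
      congr 1
      push_cast
      ring
  change nabla P g ξ (linRat η * f) - linRat η * nabla P g ξ f = _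
  rw [nabla_apply, nabla_apply, Finset.sum_congr rfl key, Finset.sum_sub_distrib,
    Derivation.leibniz, dirD_linRat, mul_sub, Finset.mul_sum]
  simp only [LinearMap.add_apply, LinearMap.smul_apply, LinearMap.sum_apply, Module.End.one_apply,
    smul_eq_mul, Algebra.smul_def (R := ℂ) (A := RatFun N)]
  ring

theorem lift_S (ξ η : Vec N) : MonoidAlgebra.lift ℂ (Module.End ℂ (RatFun N)) R.W (opWHom R)
    (S P g ξ η) = ((inner ℝ ξ η : ℝ) : ℂ) • 1 + ∑ α ∈ P.pos,
      (2 * g α * ((inner ℝ α ξ * inner ℝ α η / inner ℝ α α : ℝ) : ℂ)) • opW (refl α) := by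
  rw [S, map_add, map_smul, map_one, map_sum,
    ← Finset.sum_coe_sort P.pos (fun α => (2 * g α *
      ((inner ℝ α ξ * inner ℝ α η / inner ℝ α α : ℝ) : ℂ)) • opW (refl α))]
  congr 1
  refine Finset.sum_congr rfl fun α _ => ?_
  rw [map_smul]
  congr 1
  simp
  rfl

theorem nabla_refl (α ξ : Vec N) : nabla P g (refl α ξ) =
    nabla P g ξ - (2 * ((inner ℝ α ξ / inner ℝ α α : ℝ) : ℂ)) • nabla P g α := by
  rw [refl_apply, nabla_sub, nabla_smul]
  push_cast
  rfl

/-- The commutator C of two Dunkl operators commutes with multiplication by linear forms, hence by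
polynomials, and it kills 1. For f = p/q this gives q C(f) = C(p) = p C(1) = 0. -/
theorem nabla_commute (hg : ∀ w ∈ R.W, ∀ α ∈ R.roots, g (w α) = g α) (ξ η : Vec N) :
    nabla P g ξ * nabla P g η = nabla P g η * nabla P g ξ := by
  have hs : ∀ α ∈ P.pos, ∀ ξ, opW (refl α) * nabla P g ξ = nabla P g ξ * opW (refl α) -
      (2 * ((inner ℝ α ξ / inner ℝ α α : ℝ) : ℂ)) • (nabla P g α * opW (refl α)) := by
    intro α hα ξ
    have := opW_mul_nabla P hg (R.s α (P.subset hα)) ξ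
    change opW (refl α) * _ = nabla P g (refl α ξ) * opW (refl α) at this
    rw [this, nabla_refl, sub_mul, smul_mul_assoc]
  have hC : ∀ ζ, (nabla P g ξ * nabla P g η - nabla P g η * nabla P g ξ) * opX ζ =
      opX ζ * (nabla P g ξ * nabla P g η - nabla P g η * nabla P g ξ) := by
    intro ζ
    -- This is [∇_ξ, S_{ηζ}], with coefficients symmetric in ξ and η. By Jacobi the
    -- antisymmetrization in ξ, η is [C, (x, ζ)], which therefore vanishes.
    have h1 : ∀ ξ η, nabla P g ξ * (nabla P g η * opX ζ - opX ζ * nabla P g η) -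
        (nabla P g η * opX ζ - opX ζ * nabla P g η) * nabla P g ξ = ∑ α ∈ P.pos,
        (2 * g α * ((inner ℝ α η * inner ℝ α ζ / inner ℝ α α : ℝ) : ℂ) *
          (2 * ((inner ℝ α ξ / inner ℝ α α : ℝ) : ℂ))) • (nabla P g α * opW (refl α)) := by
      intro ξ η
      rw [nabla_mul_opX, mul_add, add_mul, mul_smul_comm, smul_mul_assoc, mul_one, one_mul,
        add_sub_add_left_eq_sub, Finset.mul_sum, Finset.sum_mul, ← Finset.sum_sub_distrib]
      refine Finset.sum_congr rfl fun α hα => ?_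
      rw [mul_smul_comm, smul_mul_assoc, hs α hα, smul_sub, sub_sub_cancel, smul_smul]
    have h2 : nabla P g ξ * (nabla P g η * opX ζ - opX ζ * nabla P g η) -
        (nabla P g η * opX ζ - opX ζ * nabla P g η) * nabla P g ξ =
        nabla P g η * (nabla P g ξ * opX ζ - opX ζ * nabla P g ξ) -
        (nabla P g ξ * opX ζ - opX ζ * nabla P g ξ) * nabla P g η := by
      rw [h1, h1]
      refine Finset.sum_congr rfl fun α _ => ?_
      congr 1
      push_cast
      ring
    rw [← sub_eq_zero] at h2 ⊢
    rw [← h2]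
    simp only [mul_sub, sub_mul, mul_assoc]
    abel
  set Cm := nabla P g ξ * nabla P g η - nabla P g η * nabla P g ξ with hCm
  have hpoly : ∀ (p : MvPolynomial (Fin N) ℂ) (f : RatFun N),
      Cm (algebraMap _ (RatFun N) p * f) = algebraMap _ (RatFun N) p * Cm f := by
    intro p
    induction p using MvPolynomial.induction_on with
    | C c =>
      intro f
      have : algebraMap _ (RatFun N) (C c : MvPolynomial (Fin N) ℂ) = algebraMap ℂ _ c := rfl
      rw [this, ← Algebra.smul_def, map_smul, Algebra.smul_def]
    | add p q hp hq => intro f; rw [map_add, add_mul, map_add, hp, hq, add_mul]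
    | mul_X p i hp =>
      intro f
      have : algebraMap _ (RatFun N) (X i : MvPolynomial (Fin N) ℂ) = linRat (e i) := by
        rw [linRat, linForm_e]
      rw [RingHom.map_mul, mul_assoc, hp, this, mul_assoc]
      congr 1
      exact LinearMap.congr_fun (hC (e i)) f
  -- Grouped in this way, each of the three parts is visibly symmetric in ξ and η, so no
  -- cancellation between different roots has to be studied.
  have h1 : ∀ ξ η, nabla P g ξ (nabla P g η 1) =
      ∑ α ∈ P.pos, (g α * ((inner ℝ α η : ℝ) : ℂ) * ((inner ℝ α ξ : ℝ) : ℂ)) • (linRat α)⁻¹ ^ 2 +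
      nabla P g ξ 1 * nabla P g η 1 + ∑ α ∈ P.pos, (g α * ((inner ℝ α ξ : ℝ) : ℂ) *
        (2 * ((inner ℝ α η / inner ℝ α α : ℝ) : ℂ))) • ((linRat α)⁻¹ * nabla P g α 1) := by
    intro ξ η
    have hn : ∀ η, nabla P g η 1 =
        -∑ α ∈ P.pos, (g α * ((inner ℝ α η : ℝ) : ℂ)) • (linRat α)⁻¹ := by
      intro η
      rw [nabla_apply, Derivation.map_one_eq_zero, zero_sub]
      simp only [opW_one_apply, mul_one]
    rw [nabla_apply]
    have hsn : ∀ α ∈ P.pos, opW (refl α) (nabla P g η 1) =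
        nabla P g η 1 - (2 * ((inner ℝ α η / inner ℝ α α : ℝ) : ℂ)) • nabla P g α 1 := by
      intro α hα
      have := LinearMap.congr_fun (hs α hα η) 1
      simpa [opW_one_apply] using this
    have hd : dirD ξ (nabla P g η 1) = ∑ α ∈ P.pos,
        (g α * ((inner ℝ α η : ℝ) : ℂ) * ((inner ℝ α ξ : ℝ) : ℂ)) • (linRat α)⁻¹ ^ 2 := by
      rw [hn, map_neg, map_sum, ← Finset.sum_neg_distrib]
      refine Finset.sum_congr rfl fun α _ => ?_
      rw [Derivation.map_smul, Derivation.leibniz_inv, dirD_linRat, real_inner_comm α ξ]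
      simp only [Algebra.smul_def (R := ℂ) (A := RatFun N), smul_eq_mul, map_mul]
      ring
    rw [hd, add_assoc, sub_eq_add_neg]
    congr 1
    rw [Finset.sum_congr rfl fun α hα => by rw [hsn α hα]]
    rw [hn ξ]
    rw [neg_mul, Finset.sum_mul, ← Finset.sum_neg_distrib, ← Finset.sum_neg_distrib,
      ← Finset.sum_add_distrib]
    refine Finset.sum_congr rfl fun α _ => ?_
    simp only [mul_sub, smul_sub, mul_smul_comm, smul_mul_assoc, smul_smul]
    abel
  have h0 : Cm 1 = 0 := by
    rw [hCm, LinearMap.sub_apply, Module.End.mul_apply, Module.End.mul_apply, h1, h1,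
      mul_comm (nabla P g η 1), sub_eq_zero]
    congr 2
    · refine Finset.sum_congr rfl fun α _ => ?_
      congr 1
      ring
    · funext α
      congr 1
      push_cast
      ring
  rw [← sub_eq_zero, ← hCm]
  ext f
  obtain ⟨p, q, hq, h⟩ := ratFun_div f
  have h2 := hpoly q f
  rw [mul_comm, h] at h2
  have h3 := hpoly p 1
  rw [mul_one, h0, mul_zero] at h3
  rw [h3] at h2
  exact (mul_eq_zero.1 h2.symm).resolve_left hq

/-- The realization of the rational Cherednik algebra by Dunkl operators. -/
def dunklRealization (hg : ∀ w ∈ R.W, ∀ α ∈ R.roots, g (w α) = g α) :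
    Realization R (S P g) (Module.End ℂ (RatFun N)) where
  X := vcLift fun i => opX (e i)
  Y := vcLift fun i => nabla P g (e i)
  grp := opWHom R
  symm := S_symm P g
  XX ξ η := by
    rw [vcLift_eq_of_linear opX opX_add opX_smul, vcLift_eq_of_linear opX opX_add opX_smul]
    ext f
    exact mul_left_comm (linRat ξ) (linRat η) f
  YY ξ η := by
    rw [vcLift_eq_of_linear _ (nabla_add P g) (nabla_smul P g),
      vcLift_eq_of_linear _ (nabla_add P g) (nabla_smul P g), nabla_commute P hg]
  YX ξ η := by
    rw [vcLift_eq_of_linear _ (nabla_add P g) (nabla_smul P g),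
      vcLift_eq_of_linear opX opX_add opX_smul, nabla_mul_opX, lift_S]
  grp_X_cx w ξ := by
    rw [vcLift_eq_of_linear opX opX_add opX_smul, vcLift_eq_of_linear opX opX_add opX_smul]
    exact opW_mul_opX _ _
  grp_Y_cx w ξ := by
    rw [vcLift_eq_of_linear _ (nabla_add P g) (nabla_smul P g),
      vcLift_eq_of_linear _ (nabla_add P g) (nabla_smul P g)]
    exact opW_mul_nabla P hg w ξ

theorem dunklRealization_X (hg : ∀ w ∈ R.W, ∀ α ∈ R.roots, g (w α) = g α) (ξ : Vec N) :
    (dunklRealization P hg).X (cx ξ) = opX ξ :=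
  vcLift_eq_of_linear opX opX_add opX_smul ξ

theorem dunklRealization_Y (hg : ∀ w ∈ R.W, ∀ α ∈ R.roots, g (w α) = g α) (ξ : Vec N) :
    (dunklRealization P hg).Y (cx ξ) = nabla P g ξ :=
  vcLift_eq_of_linear _ (nabla_add P g) (nabla_smul P g) ξ

end Dunkl

/-! ### Independence of exponentials over polynomials in t. -/

section Exponentials

open PowerSeries

variable {K : Type} [Field K] [Algebra ℂ K]

/-- The power series `exp(λ t)`. -/
def expSeries (a : K) : K⟦X⟧ := PowerSeries.mk fun m => ((m.factorial : ℂ)⁻¹) • a ^ m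

theorem coeff_expSeries (a : K) (m : ℕ) :
    coeff m (expSeries a) = ((m.factorial : ℂ)⁻¹) • a ^ m := coeff_mk _ _

theorem factorial_smul (m : ℕ) (a : K) :
    (((m + 1).factorial : ℂ)⁻¹) • (((m + 1 : ℕ) : K) * a) = ((m.factorial : ℂ)⁻¹) • a := by
  have h : ((m + 1 : ℕ) : K) * a = ((m + 1 : ℕ) : ℂ) • a := by simp [Algebra.smul_def]
  have h0 : ((m + 1 : ℕ) : ℂ) ≠ 0 := Nat.cast_ne_zero.2 m.succ_ne_zero
  rw [h, smul_smul, Nat.factorial_succ, Nat.cast_mul, mul_inv, mul_right_comm,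
    inv_mul_cancel₀ h0, one_mul]

theorem expSeries_ne_zero (a : K) : expSeries a ≠ 0 := by
  intro h
  have := congrArg (coeff 0) h
  rw [coeff_expSeries] at this
  simp at this

theorem derivative_expSeries (a : K) :
    derivative K (expSeries a) = C a * expSeries a := by
  ext m
  rw [coeff_derivative, coeff_C_mul, coeff_expSeries, coeff_expSeries]
  have := factorial_smul m (a ^ (m + 1))
  rw [mul_comm, mul_smul_comm, mul_smul_comm, ← pow_succ', ← this]
  push_cast
  rfl

/-- By the Leibniz rule d/dt - a acts on p exp(at) as d/dt acts on p. -/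
theorem pow_derivative_sub_mul_expSeries (a : K) (p : K⟦X⟧) (n : ℕ) :
    (((derivative K : K⟦X⟧ →ₗ[K] K⟦X⟧) - algebraMap K (Module.End K K⟦X⟧) a) ^ n)
      (p * expSeries a) = ((derivative K : K⟦X⟧ → K⟦X⟧)^[n] p) * expSeries a := by
  induction n generalizing p with
  | zero => simp
  | succ n ih =>
    rw [pow_succ, Module.End.mul_apply, Function.iterate_succ_apply, ← ih]
    congr 1
    rw [LinearMap.sub_apply, Module.algebraMap_end_apply]
    change derivative K (p * expSeries a) - _ = _
    rw [Derivation.leibniz, derivative_expSeries, smul_eq_mul, smul_eq_mul, smul_eq_C_mul]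
    ring

/-- A polynomial times exp(at) is a generalized eigenvector of d/dt with eigenvalue a, and
generalized eigenspaces for distinct eigenvalues are independent. -/
theorem eq_zero_of_sum_mul_expSeries {V : Type} [Fintype V] (a : V → K)
    (ha : Function.Injective a) (q : V → K⟦X⟧) (n : ℕ) (hq : ∀ v j, n < j → coeff j (q v) = 0)
    (h : ∑ v, q v * expSeries (a v) = 0) (v : V) : q v = 0 := by
  classical
  have hind := (Module.End.independent_maxGenEigenspace (derivative K : K⟦X⟧ →ₗ[K] K⟦X⟧)).comp ha
  have hmem : ∀ v, q v * expSeries (a v) ∈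
      Module.End.maxGenEigenspace (derivative K : K⟦X⟧ →ₗ[K] K⟦X⟧) (a v) := by
    intro v
    rw [Module.End.mem_maxGenEigenspace]
    -- A polynomial of degree at most n is killed by n + 1 derivatives.
    refine ⟨n + 1, ?_⟩
    have := pow_derivative_sub_mul_expSeries (a v) (q v) (n + 1)
    rw [Algebra.algebraMap_eq_smul_one] at this
    rw [this]
    have h0 : (derivative K : K⟦X⟧ → K⟦X⟧)^[n + 1] (q v) = 0 := by
      ext j
      rw [coeff_iterate_derivative, hq v _ (by omega)]
      simp
    rw [h0, zero_mul]
  have hz : q v * expSeries (a v) = 0 := by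
    refine Submodule.disjoint_def.1 (hind v) _ (hmem v) ?_
    rw [← Finset.add_sum_erase _ _ (Finset.mem_univ v), add_eq_zero_iff_eq_neg] at h
    rw [h]
    refine neg_mem (sum_mem fun u hu => ?_)
    exact Submodule.mem_iSup_of_mem u
      (Submodule.mem_iSup_of_mem (Finset.ne_of_mem_erase hu) (hmem u))
  exact (mul_eq_zero.1 hz).resolve_right (expSeries_ne_zero _)

/-- The coefficientwise action of a derivation on power series. -/
def mapCoeff (D : Derivation ℂ K K) (p : K⟦X⟧) : K⟦X⟧ := PowerSeries.mk fun m => D (coeff m p)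

theorem coeff_mapCoeff (D : Derivation ℂ K K) (p : K⟦X⟧) (m : ℕ) :
    coeff m (mapCoeff D p) = D (coeff m p) := coeff_mk _ _

theorem mapCoeff_mul (D : Derivation ℂ K K) (p q : K⟦X⟧) :
    mapCoeff D (p * q) = mapCoeff D p * q + p * mapCoeff D q := by
  ext m
  simp only [coeff_mapCoeff, coeff_mul, map_add, map_sum, Derivation.leibniz, smul_eq_mul,
    Finset.sum_add_distrib]
  rw [add_comm]
  congr 1
  exact Finset.sum_congr rfl fun _ _ => mul_comm _ _

/-- The factor t produced here is what makes the degree in t count differentiations. -/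
theorem mapCoeff_expSeries (D : Derivation ℂ K K) (a : K) :
    mapCoeff D (expSeries a) = X * (C (D a) * expSeries a) := by
  ext m
  cases m with
  | zero => simp [coeff_mapCoeff, coeff_expSeries]
  | succ m =>
    rw [coeff_mapCoeff, coeff_succ_X_mul, coeff_C_mul, coeff_expSeries, coeff_expSeries,
      Derivation.map_smul, Derivation.leibniz_pow, Nat.add_sub_cancel, mul_smul_comm,
      ← factorial_smul m, smul_eq_mul, nsmul_eq_mul, mul_comm (a ^ m)]

end Exponentials

/-! ### Symbols: the action of operators on exp(t(x,k)). -/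

section Symbols

open PowerSeries

variable {N : ℕ} {R : CoxeterRootSystem N} [Fintype R.W]

/-- The operator `T` maps `exp(t (x, k))` to `∑_v q_v exp(t (x, v k))`, where `q_v` is a polynomial
in `t` of degree at most `n`, with the coefficient `s v` of `t ^ n`. -/
def HasSymbol (R : CoxeterRootSystem N) [Fintype R.W] (k : Vec N) (T : Module.End ℂ (RatFun N))
    (n : ℕ) (s : R.W → RatFun N) : Prop :=
  ∃ q : R.W → (RatFun N)⟦X⟧, (∀ v j, n < j → coeff j (q v) = 0) ∧ (∀ v, coeff n (q v) = s v) ∧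
    ∀ m, T (coeff m (expSeries (linRat k))) = coeff m (∑ v, q v * expSeries (linRat (v.1 k)))

namespace HasSymbol

variable {k : Vec N} {T T' : Module.End ℂ (RatFun N)} {n : ℕ} {s s' : R.W → RatFun N}

theorem zero (n : ℕ) : HasSymbol R k 0 n 0 :=
  ⟨0, by simp, by simp, by simp⟩

theorem add (h : HasSymbol R k T n s) (h' : HasSymbol R k T' n s') :
    HasSymbol R k (T + T') n (s + s') := by
  obtain ⟨q, h1, h2, h3⟩ := h
  obtain ⟨q', h1', h2', h3'⟩ := h'
  refine ⟨q + q', fun v j hj => ?_, fun v => ?_, fun m => ?_⟩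
  · rw [Pi.add_apply, map_add, h1 v j hj, h1' v j hj, add_zero]
  · rw [Pi.add_apply, map_add, h2, h2', Pi.add_apply]
  · rw [LinearMap.add_apply, h3, h3', ← map_add, ← Finset.sum_add_distrib]
    simp only [Pi.add_apply, add_mul]

theorem smul (c : ℂ) (h : HasSymbol R k T n s) : HasSymbol R k (c • T) n (c • s) := by
  obtain ⟨q, h1, h2, h3⟩ := h
  refine ⟨fun v => C (algebraMap ℂ _ c) * q v, fun v j hj => ?_, fun v => ?_, fun m => ?_⟩
  · rw [coeff_C_mul, h1 v j hj, mul_zero]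
  · rw [coeff_C_mul, h2, Pi.smul_apply, Algebra.smul_def]
  · rw [LinearMap.smul_apply, h3, Algebra.smul_def, ← coeff_C_mul, Finset.mul_sum]
    simp only [mul_assoc]

theorem sum {ι : Type} (t : Finset ι) (T : ι → Module.End ℂ (RatFun N))
    (s : ι → R.W → RatFun N) (h : ∀ i ∈ t, HasSymbol R k (T i) n (s i)) :
    HasSymbol R k (∑ i ∈ t, T i) n (∑ i ∈ t, s i) := by
  classical
  induction t using Finset.induction_on with
  | empty => simpa using zero n
  | insert a t ha ih =>
    rw [Finset.sum_insert ha, Finset.sum_insert ha]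
    exact (h a (Finset.mem_insert_self _ _)).add
      (ih fun i hi => h i (Finset.mem_insert_of_mem hi))

/-- The degree n is only an upper bound, so an operator of lower order has zero symbol in a higher
degree. This removes lower order terms. -/
theorem raise (h : HasSymbol R k T n s) {m : ℕ} (hm : n < m) : HasSymbol R k T m 0 := by
  obtain ⟨q, h1, h2, h3⟩ := h
  exact ⟨q, fun v j hj => h1 v j (hm.trans hj), fun v => h1 v m hm, h3⟩

theorem opW_self [DecidableEq R.W] (w : R.W) : HasSymbol R k (opW w.1) 0 (Pi.single w 1) := by
  refine ⟨Pi.single w 1, fun v j hj => ?_, fun v => ?_, fun m => ?_⟩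
  · by_cases h : v = w
    · subst h
      rw [Pi.single_eq_same, coeff_one, if_neg (by omega)]
    · rw [Pi.single_eq_of_ne h, map_zero]
  · by_cases h : v = w
    · subst h
      simp
    · simp [Pi.single_eq_of_ne h]
  · rw [Finset.sum_eq_single w]
    · rw [Pi.single_eq_same, one_mul, coeff_expSeries, coeff_expSeries, map_smul, ← opW_linRat]
      congr 1
      induction m with
      | zero => simp [opW_one_apply]
      | succ m ih => rw [pow_succ, pow_succ, opW_mul_apply, ih]
    · intro v _ hv
      rw [Pi.single_eq_of_ne hv, zero_mul]
    · simp

theorem mulLeft (f : RatFun N) (h : HasSymbol R k T n s) :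
    HasSymbol R k (LinearMap.mulLeft ℂ f * T) n (fun v => f * s v) := by
  obtain ⟨q, h1, h2, h3⟩ := h
  refine ⟨fun v => C f * q v, fun v j hj => ?_, fun v => ?_, fun m => ?_⟩
  · rw [coeff_C_mul, h1 v j hj, mul_zero]
  · rw [coeff_C_mul, h2]
  · rw [Module.End.mul_apply, h3, LinearMap.mulLeft_apply, ← coeff_C_mul, Finset.mul_sum]
    simp only [mul_assoc]

/-- The frequency vk becomes wvk, hence the shift of the index by w⁻¹. -/
theorem opW_mul (w : R.W) (h : HasSymbol R k T n s) :
    HasSymbol R k (opW w.1 * T) n (fun v => opW w.1 (s (w⁻¹ * v))) := by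
  obtain ⟨q, h1, h2, h3⟩ := h
  set F : RatFun N →+* RatFun N :=
    (IsFractionRing.algEquivOfAlgEquiv (K := RatFun N) (L := RatFun N) (polyAct w.1) :
      RatFun N →+* RatFun N)
  have hF : ∀ f, F f = opW w.1 f := fun _ => rfl
  refine ⟨fun v => PowerSeries.map F (q (w⁻¹ * v)), fun v j hj => ?_, fun v => ?_, fun m => ?_⟩
  · rw [coeff_map, h1 _ j hj, map_zero]
  · rw [coeff_map, h2, hF]
  · have hE : ∀ v : R.W, PowerSeries.map F (expSeries (linRat (v.1 k))) =
        expSeries (linRat ((w * v).1 k)) := by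
      intro v
      ext m
      rw [coeff_map, coeff_expSeries, coeff_expSeries, hF, map_smul, ← hF, map_pow, hF, opW_linRat]
      rfl
    rw [Module.End.mul_apply, h3, ← hF, ← coeff_map, map_sum]
    congr 1
    refine Eq.trans ?_ (Equiv.sum_comp (Equiv.mulLeft w) _)
    refine Finset.sum_congr rfl fun v _ => ?_
    simp only [map_mul, hE, Equiv.coe_mulLeft, inv_mul_cancel_left]

/-- Differentiating the coefficients of q_v keeps the degree; differentiating the exponential
multiplies by t(η, vk) and alone reaches degree n + 1. -/
theorem dirD_mul (η : Vec N) (h : HasSymbol R k T n s) :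
    HasSymbol R k ((dirD η : RatFun N →ₗ[ℂ] RatFun N) * T) (n + 1)
      (fun v => algebraMap ℂ _ ((inner ℝ η (v.1 k) : ℝ) : ℂ) * s v) := by
  obtain ⟨q, h1, h2, h3⟩ := h
  refine ⟨fun v => mapCoeff (dirD η) (q v) +
    X * (C (algebraMap ℂ _ ((inner ℝ η (v.1 k) : ℝ) : ℂ)) * q v),
    fun v j hj => ?_, fun v => ?_, fun m => ?_⟩
  · obtain ⟨j, rfl⟩ := Nat.exists_eq_succ_of_ne_zero (show j ≠ 0 by omega)
    rw [map_add, coeff_mapCoeff, h1 v _ (by omega), Nat.succ_eq_add_one, coeff_succ_X_mul,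
      coeff_C_mul, h1 v _ (by omega)]
    simp
  · rw [map_add, coeff_mapCoeff, h1 v _ (by omega), coeff_succ_X_mul, coeff_C_mul, h2]
    simp
  · rw [Module.End.mul_apply, h3]
    change dirD η _ = _
    rw [map_sum, map_sum, map_sum]
    refine Finset.sum_congr rfl fun v _ => ?_
    rw [← coeff_mapCoeff, mapCoeff_mul, mapCoeff_expSeries, dirD_linRat]
    congr 1
    ring

theorem opX_mul (ξ : Vec N) (h : HasSymbol R k T n s) :
    HasSymbol R k (opX ξ * T) n (fun v => linRat ξ * s v) :=
  h.mulLeft _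

/-- The reflection terms keep the degree in t at most n and so are invisible in degree n + 1: the
symbol is that of ∂_η. This is why the monomial bases do not depend on g. -/
theorem nabla_mul (P : R.PositiveHalf) (g : Vec N → ℂ) (η : Vec N) (h : HasSymbol R k T n s) :
    HasSymbol R k (nabla P g η * T) (n + 1)
      (fun v => algebraMap ℂ _ ((inner ℝ η (v.1 k) : ℝ) : ℂ) * s v) := by
  have h1 : nabla P g η = (dirD η : RatFun N →ₗ[ℂ] RatFun N) + ∑ α ∈ P.pos,
      (-(g α * ((inner ℝ α η : ℝ) : ℂ))) • (LinearMap.mulLeft ℂ (linRat α)⁻¹ * opW (refl α)) := by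
    ext f
    rw [nabla_apply]
    simp [LinearMap.add_apply, LinearMap.sum_apply, sub_eq_add_neg]
  have h2 : HasSymbol R k (∑ α ∈ P.pos, (-(g α * ((inner ℝ α η : ℝ) : ℂ))) •
      (LinearMap.mulLeft ℂ (linRat α)⁻¹ * (opW (refl α) * T))) (n + 1) (∑ α ∈ P.pos, 0) := by
    refine sum _ _ _ fun α hα => ?_
    have := (((h.opW_mul (R.s α (P.subset hα))).mulLeft (linRat α)⁻¹).smul
      (-(g α * ((inner ℝ α η : ℝ) : ℂ)))).raise (Nat.lt_succ_self n)
    exact this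
  have h3 := (h.dirD_mul η).add h2
  rw [Finset.sum_const_zero, add_zero] at h3
  rw [h1, add_mul, Finset.sum_mul]
  simpa only [smul_mul_assoc, mul_assoc] using h3

/-- A free orbit makes the frequencies (x, vk) distinct, so `eq_zero_of_sum_mul_expSeries` applies.
-/
theorem eq_zero (h : HasSymbol R k 0 n s)
    (hk : Function.Injective fun v : R.W => v.1 k) : s = 0 := by
  obtain ⟨q, h1, h2, h3⟩ := h
  have : ∑ v, q v * expSeries (linRat (v.1 k)) = 0 := by
    ext m
    rw [← h3]
    simp
  funext v
  rw [← h2, eq_zero_of_sum_mul_expSeries _ (linRat_injective.comp hk) q n h1 this v]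
  simp

end HasSymbol

end Symbols

/-! ### Finiteness of W. -/

section FiniteGroup

variable {N : ℕ} {R : CoxeterRootSystem N}

theorem W_sub_mem_span (w : R.W) (ξ : Vec N) :
    w.1 ξ - ξ ∈ Submodule.span ℝ (R.roots : Set (Vec N)) := by
  have key : ∀ w ∈ R.W, ∀ ξ, w ξ - ξ ∈ Submodule.span ℝ (R.roots : Set (Vec N)) := by
    intro w hw
    induction hw using Subgroup.closure_induction with
    | mem s hs =>
      obtain ⟨β, hβ, rfl⟩ := hs
      intro ξ
      rw [refl_apply, sub_sub_cancel_left]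
      exact neg_mem (Submodule.smul_mem _ _ (Submodule.subset_span hβ))
    | one => intro ξ; simp
    | mul v w _ _ hv hw =>
      intro ξ
      have := add_mem (hv (w ξ)) (hw ξ)
      rwa [sub_add_sub_cancel] at this
    | inv w _ hw =>
      intro ξ
      have h := neg_mem (hw (w⁻¹ ξ))
      have h1 : w (w⁻¹ ξ) = ξ := by
        change (w * w⁻¹) ξ = ξ
        rw [mul_inv_cancel]; rfl
      rwa [h1, neg_sub] at h
  exact key w.1 w.2 ξ

/-- The roots need not span V. The displacement y = wξ - ξ lies in their span, where w is the
identity, so (wξ, y) = (wξ, wy) = (ξ, y) and hence (y, y) = 0. -/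
theorem W_eq_one_of_fix_roots (w : R.W) (h : ∀ α ∈ R.roots, w.1 α = α) : w = 1 := by
  have hfix : ∀ x ∈ Submodule.span ℝ (R.roots : Set (Vec N)), w.1 x = x := by
    intro x hx
    induction hx using Submodule.span_induction with
    | mem x hx => exact h x hx
    | zero => simp
    | add x y _ _ hx hy => rw [map_add, hx, hy]
    | smul c x _ hx => rw [map_smul, hx]
  apply Subtype.ext
  ext1 ξ
  rw [← sub_eq_zero, ← inner_self_eq_zero (𝕜 := ℝ)]
  change inner ℝ (w.1 ξ - ξ) (w.1 ξ - ξ) = 0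
  have hy := W_sub_mem_span w ξ
  rw [inner_sub_left]
  nth_rewrite 1 [← hfix _ hy]
  rw [LinearIsometryEquiv.inner_map_map, sub_self]

/-- W acts faithfully on the finite set of roots. -/
instance : Finite R.W := by
  refine Finite.of_injective (β := R.roots → R.roots)
    (fun w α => ⟨w.1 α.1, W_map_roots w α.2⟩) fun v w h => ?_
  have h1 : w⁻¹ * v = 1 := by
    refine W_eq_one_of_fix_roots _ fun α hα => ?_
    have h2 : v.1 α = w.1 α := congrArg Subtype.val (congrFun h ⟨α, hα⟩)
    change w.1⁻¹ (v.1 α) = α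
    rw [h2]
    change (w.1⁻¹ * w.1) α = α
    rw [inv_mul_cancel]; rfl
  exact (inv_mul_eq_one.1 h1).symm

end FiniteGroup

/-! ### Vectors with free orbit are Zariski dense. -/

section Generic

open MvPolynomial

variable {N : ℕ} {R : CoxeterRootSystem N}

/-- The complex coordinates of a real vector. -/
def coords (k : Vec N) (i : Fin N) : ℂ := ((k i : ℝ) : ℂ)

/-- Vectors with a free orbit under `W`. -/
def IsGeneric (R : CoxeterRootSystem N) (k : Vec N) : Prop :=
  Function.Injective fun v : R.W => v.1 k

theorem eval_linForm (ξ k : Vec N) :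
    eval (coords k) (linForm ξ) = ((inner ℝ ξ k : ℝ) : ℂ) := by
  rw [linForm, map_sum, PiLp.inner_apply]
  push_cast
  refine Finset.sum_congr rfl fun i _ => ?_
  simp [coords, mul_comm]

/-- For v ≠ 1 choose y with vy ≠ y. If vk = k then (y, k) = (vy, vk) = (vy, k), so the nonzero
linear form (y - vy, k) vanishes. The polynomial is the product of these forms. -/
theorem exists_generic_polynomial (R : CoxeterRootSystem N) :
    ∃ Q : MvPolynomial (Fin N) ℂ, Q ≠ 0 ∧ ∀ k, eval (coords k) Q ≠ 0 → IsGeneric R k := by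
  classical
  have : Fintype R.W := Fintype.ofFinite _
  have h : ∀ v : R.W, v ≠ 1 → ∃ y : Vec N, v.1 y ≠ y := by
    intro v hv
    by_contra hn
    push Not at hn
    exact hv (Subtype.ext (LinearIsometryEquiv.ext hn))
  choose! y hy using h
  refine ⟨∏ v ∈ Finset.univ.erase (1 : R.W), linForm (y v - v.1 (y v)), ?_, fun k hk => ?_⟩
  · refine Finset.prod_ne_zero_iff.2 fun v hv h0 => ?_
    rw [← linForm_zero] at h0
    exact hy v (Finset.ne_of_mem_erase hv) (sub_eq_zero.1 (linForm_injective h0)).symm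
  · intro v w hvw
    by_contra hne
    have hne' : w⁻¹ * v ≠ 1 := fun h => hne (inv_mul_eq_one.1 h).symm
    have hfix : (w⁻¹ * v).1 k = k := by
      change w.1⁻¹ (v.1 k) = k
      have h2 : v.1 k = w.1 k := hvw
      rw [h2]
      change (w.1⁻¹ * w.1) k = k
      rw [inv_mul_cancel]; rfl
    rw [map_prod] at hk
    refine Finset.prod_ne_zero_iff.1 hk (w⁻¹ * v) (Finset.mem_erase.2 ⟨hne', Finset.mem_univ _⟩) ?_
    rw [eval_linForm, inner_sub_left]
    nth_rewrite 2 [← hfix]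
    rw [LinearIsometryEquiv.inner_map_map, sub_self, Complex.ofReal_zero]

theorem eq_zero_of_eval_generic (R : CoxeterRootSystem N) (F : MvPolynomial (Fin N) ℂ)
    (h : ∀ k, IsGeneric R k → eval (coords k) F = 0) : F = 0 := by
  obtain ⟨Q, hQ, hgen⟩ := exists_generic_polynomial R
  have h0 : F * Q = 0 := by
    -- Genericity is only defined for real k, but a complex polynomial vanishing on ℝ^N is zero
    -- because ℝ is infinite.
    refine funext_set (fun _ => Set.range ((↑) : ℝ → ℂ))
      (fun _ => Set.infinite_range_of_injective Complex.ofReal_injective) fun x hx => ?_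
    choose k hk using fun i => hx i (Set.mem_univ i)
    have hx : x = coords (WithLp.toLp 2 k) := by
      funext i
      exact (hk i).symm
    rw [hx, map_mul, map_zero]
    by_cases hq : eval (coords (WithLp.toLp 2 k)) Q = 0
    · rw [hq, mul_zero]
    · rw [h _ (hgen _ hq), zero_mul]
  exact (mul_eq_zero.1 h0).resolve_right hQ

theorem eq_zero_of_map_eval_generic (R : CoxeterRootSystem N)
    (F : MvPolynomial (Fin N) (MvPolynomial (Fin N) ℂ))
    (h : ∀ k, IsGeneric R k → map (eval (coords k)) F = 0) : F = 0 := by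
  ext1 m
  rw [coeff_zero]
  refine eq_zero_of_eval_generic R _ fun k hk => ?_
  rw [← coeff_map, h k hk, coeff_zero]

theorem isGeneric_smul (w : R.W) {k : Vec N} (h : IsGeneric R k) : IsGeneric R (w.1 k) := by
  intro u v huv
  exact mul_right_cancel (h (show (u * w).1 k = (v * w).1 k from huv))

/-- Replacing k by w⁻¹k, which is again generic, turns evaluation at wk into evaluation at k. The
combination of symbols then vanishes for all generic momenta and is zero. -/
theorem eq_zero_of_sum_generic {I : Type} {sy : I → MvPolynomial (Fin N) (MvPolynomial (Fin N) ℂ)}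
    (hsy : LinearIndependent ℂ sy) (s : Finset I) (c : I → ℂ) (w : R.W)
    (h : ∀ k, IsGeneric R k → ∑ i ∈ s, c i • map (eval (coords (w.1 k))) (sy i) = 0) :
    ∀ i ∈ s, c i = 0 := by
  refine linearIndependent_iff'.1 hsy s c (eq_zero_of_map_eval_generic R _ fun k hk => ?_)
  have h1 := h (w⁻¹.1 k) (isGeneric_smul w⁻¹ hk)
  have h2 : w.1 (w⁻¹.1 k) = k := by
    change (w.1 * w.1⁻¹) k = k
    rw [mul_inv_cancel]; rfl
  rw [h2] at h1
  rw [← h1, map_sum]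
  refine Finset.sum_congr rfl fun i _ => ?_
  ext1 m
  rw [coeff_map, coeff_smul, coeff_smul, coeff_map, smul_eval, smul_eq_mul]

end Generic

/-! ### Leading terms of the classical symbols. -/

section LeadingTerms

open MvPolynomial MonomialOrder

variable {N : ℕ}

/-- The multidegree of the left ends of a word. -/
def leftEnds (l : List (Fin N × Fin N)) : Fin N →₀ ℕ :=
  (l.map fun p => Finsupp.single p.1 1).sum

/-- The multidegree of the right ends of a word. -/
def rightEnds (l : List (Fin N × Fin N)) : Fin N →₀ ℕ :=
  (l.map fun p => Finsupp.single p.2 1).sum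

/-- `sy` has the leading term `x_i p_j` for `i`, `j` the ends of `p`. -/
def HasLeadingTerm (sy : MvPolynomial (Fin N) (MvPolynomial (Fin N) ℂ)) (p : Fin N × Fin N) :
    Prop :=
  (lex (σ := Fin N)).degree sy = Finsupp.single p.1 1 ∧ (lex (σ := Fin N)).leadingCoeff sy = X p.2

theorem leadingTerm_prod (sy : Fin N × Fin N → MvPolynomial (Fin N) (MvPolynomial (Fin N) ℂ))
    (l : List (Fin N × Fin N)) (h : ∀ p ∈ l, HasLeadingTerm (sy p) p) :
    (l.map sy).prod ≠ 0 ∧ (lex (σ := Fin N)).degree (l.map sy).prod = leftEnds l ∧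
      (lex (σ := Fin N)).leadingCoeff (l.map sy).prod = monomial (rightEnds l) 1 := by
  induction l with
  | nil => simp [leftEnds, rightEnds]
  | cons p l ih =>
    obtain ⟨h1, h2, h3⟩ := ih fun q hq => h q (List.mem_cons_of_mem _ hq)
    obtain ⟨hp1, hp2⟩ := h p List.mem_cons_self
    have hp0 : sy p ≠ 0 := by
      intro h0
      rw [h0, leadingCoeff_zero] at hp2
      exact X_ne_zero _ hp2.symm
    rw [List.map_cons, List.prod_cons]
    refine ⟨mul_ne_zero hp0 h1, ?_, ?_⟩
    · rw [degree_mul hp0 h1, hp1, h2]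
      simp [leftEnds]
    · rw [leadingCoeff_mul, hp2, h3, X, monomial_mul, one_mul]
      simp [rightEnds]

/-- Only the x variables are ordered; the leading coefficient is a monomial in p. Words sharing the
x degree are therefore separated by their p degree. -/
theorem linearIndependent_of_leadingTerm {I : Type} (wd : I → List (Fin N × Fin N))
    (sy : Fin N × Fin N → MvPolynomial (Fin N) (MvPolynomial (Fin N) ℂ))
    (h : ∀ i, ∀ p ∈ wd i, HasLeadingTerm (sy p) p)
    (hinj : ∀ i j, leftEnds (wd i) = leftEnds (wd j) → rightEnds (wd i) = rightEnds (wd j) →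
      i = j) : LinearIndependent ℂ fun i => ((wd i).map sy).prod := by
  classical
  rw [linearIndependent_iff]
  intro c hc
  by_contra hne
  obtain ⟨a, ha, hmax⟩ := Finset.exists_max_image c.support
    (fun i => (lex (σ := Fin N)).toSyn (leftEnds (wd i))) (Finsupp.support_nonempty_iff.2 hne)
  -- Since `a` has the largest x degree, another word could contribute here only with equal left
  -- ends, and then its right ends differ.
  have h1 := congrArg (fun F => coeff (rightEnds (wd a)) (coeff (leftEnds (wd a)) F)) hc
  simp only [Finsupp.linearCombination_apply, Finsupp.sum, coeff_sum, coeff_smul, coeff_zero] at h1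
  rw [Finset.sum_eq_single a] at h1
  · obtain ⟨-, h2, h3⟩ := leadingTerm_prod sy (wd a) (h a)
    rw [← h2] at h1
    change c a • coeff _ ((lex (σ := Fin N)).leadingCoeff _) = 0 at h1
    rw [h3, coeff_monomial, if_pos rfl, smul_eq_mul, mul_one] at h1
    exact Finsupp.mem_support_iff.1 ha h1
  · intro b hb hba
    obtain ⟨-, h2, h3⟩ := leadingTerm_prod sy (wd b) (h b)
    rcases (hmax b hb).lt_or_eq with hlt | heq
    · have h0 : coeff (leftEnds (wd a)) ((wd b).map sy).prod = 0 :=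
        coeff_eq_zero_of_lt (m := lex) (by rw [h2]; exact hlt)
      rw [h0, coeff_zero, smul_zero]
    · have heq' : leftEnds (wd b) = leftEnds (wd a) := (lex (σ := Fin N)).toSyn.injective heq
      rw [← heq', ← h2]
      change c b • coeff _ ((lex (σ := Fin N)).leadingCoeff _) = 0
      rw [h3, coeff_monomial, if_neg fun hr => hba (hinj _ _ heq' hr), smul_zero]
  · intro hn
    exact absurd ha hn

/-- The symbol `x_i p_j` of `E_ij`. -/
def glSymbol (p : Fin N × Fin N) : MvPolynomial (Fin N) (MvPolynomial (Fin N) ℂ) :=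
  X p.1 * C (X p.2)

/-- The symbol `x_i p_j - x_j p_i` of `M_ij`. -/
def soSymbol (p : Fin N × Fin N) : MvPolynomial (Fin N) (MvPolynomial (Fin N) ℂ) :=
  X p.1 * C (X p.2) - X p.2 * C (X p.1)

theorem glSymbol_leadingTerm (p : Fin N × Fin N) : HasLeadingTerm (glSymbol p) p := by
  have h0 : (C (X p.2) : MvPolynomial (Fin N) (MvPolynomial (Fin N) ℂ)) ≠ 0 := by
    simp [X_ne_zero]
  constructor
  · rw [glSymbol, degree_mul (X_ne_zero _) h0, degree_X, degree_C, add_zero]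
  · rw [glSymbol, leadingCoeff_mul, leadingCoeff_X, leadingCoeff_C, one_mul]

/-- In the lexicographic order x_i is larger than x_j for i < j, so x_i p_j dominates x_j p_i. -/
theorem soSymbol_leadingTerm {p : Fin N × Fin N} (hp : p.1 < p.2) :
    HasLeadingTerm (soSymbol p) p := by
  have h1 := glSymbol_leadingTerm p
  have h2 := glSymbol_leadingTerm p.swap
  have h : soSymbol p = glSymbol p - glSymbol p.swap := rfl
  have hlt : (lex (σ := Fin N)).toSyn ((lex (σ := Fin N)).degree (glSymbol p.swap)) <
      (lex (σ := Fin N)).toSyn ((lex (σ := Fin N)).degree (glSymbol p)) := by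
    rw [h1.1, h2.1, lex_lt_iff, Finsupp.Lex.single_lt_iff]
    exact hp
  rw [h]
  refine ⟨?_, ?_⟩
  · rw [degree_sub_of_lt hlt, h1.1]
  · rw [leadingCoeff_sub_of_lt hlt, h1.2]

end LeadingTerms

/-! ### Combinatorics of sorted and non-crossing words. -/

section Words

variable {N : ℕ}

theorem leftEnds_apply (l : List (Fin N × Fin N)) (i : Fin N) :
    leftEnds l i = (l.map Prod.fst).count i := by
  induction l with
  | nil => simp [leftEnds]
  | cons p l ih =>
    have h : leftEnds (p :: l) = Finsupp.single p.1 1 + leftEnds l := by simp [leftEnds]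
    rw [h, Finsupp.add_apply, ih, List.map_cons, List.count_cons, Finsupp.single_apply, add_comm]
    simp

theorem rightEnds_apply (l : List (Fin N × Fin N)) (i : Fin N) :
    rightEnds l i = (l.map Prod.snd).count i := by
  induction l with
  | nil => simp [rightEnds]
  | cons p l ih =>
    have h : rightEnds (p :: l) = Finsupp.single p.2 1 + rightEnds l := by simp [rightEnds]
    rw [h, Finsupp.add_apply, ih, List.map_cons, List.count_cons, Finsupp.single_apply, add_comm]
    simp

theorem perm_fst_of_leftEnds_eq {l l' : List (Fin N × Fin N)} (h : leftEnds l = leftEnds l') :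
    (l.map Prod.fst).Perm (l'.map Prod.fst) :=
  List.perm_iff_count.2 fun i => by rw [← leftEnds_apply, h, leftEnds_apply]

theorem perm_snd_of_rightEnds_eq {l l' : List (Fin N × Fin N)} (h : rightEnds l = rightEnds l') :
    (l.map Prod.snd).Perm (l'.map Prod.snd) :=
  List.perm_iff_count.2 fun i => by rw [← rightEnds_apply, h, rightEnds_apply]

/-- Each coordinate list is sorted, hence determined by its multiset of entries. -/
theorem glWord_injective (a b : GlWord N) (h1 : leftEnds a.1 = leftEnds b.1)
    (h2 : rightEnds a.1 = rightEnds b.1) : a = b := by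
  have hf : a.1.map Prod.fst = b.1.map Prod.fst :=
    (perm_fst_of_leftEnds_eq h1).eq_of_pairwise (fun _ _ _ _ => le_antisymm)
      (List.pairwise_map.2 (a.2.imp fun h => h.1)) (List.pairwise_map.2 (b.2.imp fun h => h.1))
  have hs : a.1.map Prod.snd = b.1.map Prod.snd :=
    (perm_snd_of_rightEnds_eq h2).eq_of_pairwise (fun _ _ _ _ => le_antisymm)
      (List.pairwise_map.2 (a.2.imp fun h => h.2)) (List.pairwise_map.2 (b.2.imp fun h => h.2))
  apply Subtype.ext
  rw [← List.zip_unzip a.1, ← List.zip_unzip b.1, List.unzip_eq_map, List.unzip_eq_map, hf, hs]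

/-- Words of pairs `i < j` without crossings. -/
def NonCrossing (l : List (Fin N × Fin N)) : Prop :=
  (∀ p ∈ l, p.1 < p.2) ∧ ∀ p ∈ l, ∀ q ∈ l, p.1 < q.1 → q.1 < p.2 → q.2 ≤ p.2

theorem NonCrossing.mono {l l' : List (Fin N × Fin N)} (h : NonCrossing l) (hl : l' ⊆ l) :
    NonCrossing l' :=
  ⟨fun p hp => h.1 p (hl hp), fun p hp q hq => h.2 p (hl hp) q (hl hq)⟩

/-- Here j is the first closing end and i the last opening end before it. If a chord ending at j
starts before i, then a chord starting at i cannot cross it, so it ends by j, and at j by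
minimality. -/
theorem NonCrossing.innermost_mem {l : List (Fin N × Fin N)} (h : NonCrossing l) {i j : Fin N}
    (hj : j ∈ l.map Prod.snd) (hjmin : ∀ b ∈ l.map Prod.snd, j ≤ b)
    (hi : i ∈ l.map Prod.fst) (hij : i < j) (himax : ∀ a ∈ l.map Prod.fst, a < j → a ≤ i) :
    (i, j) ∈ l := by
  obtain ⟨r, hr, hrj⟩ := List.mem_map.1 hj
  obtain ⟨p, hp, hpi⟩ := List.mem_map.1 hi
  have hr1 : r.1 < j := hrj ▸ h.1 r hr
  rcases (himax r.1 (List.mem_map_of_mem hr) hr1).lt_or_eq with hlt | heq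
  · have h1 := h.2 r hr p hp (hpi ▸ hlt) (by rw [hpi, hrj]; exact hij)
    have h2 : p.2 = j := le_antisymm (hrj ▸ h1) (hjmin _ (List.mem_map_of_mem hp))
    have : p = (i, j) := Prod.ext hpi h2
    exact this ▸ hp
  · have : r = (i, j) := Prod.ext heq hrj
    exact this ▸ hr

/-- Bracket matching: the innermost chord is read off from the ends alone, so it occurs in both
words and can be removed from both. -/
theorem NonCrossing.perm {l l' : List (Fin N × Fin N)} (h : NonCrossing l) (h' : NonCrossing l')
    (hf : (l.map Prod.fst).Perm (l'.map Prod.fst)) (hs : (l.map Prod.snd).Perm (l'.map Prod.snd)) :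
    l.Perm l' := by
  induction hn : l.length generalizing l l' with
  | zero =>
    have h1 := hf.length_eq
    rw [List.length_map, List.length_map, hn] at h1
    rw [List.length_eq_zero_iff.1 hn, List.length_eq_zero_iff.1 h1.symm]
  | succ n ih =>
    have hne : l ≠ [] := by
      rintro rfl
      simp at hn
    obtain ⟨p, hp⟩ := List.exists_mem_of_ne_nil l hne
    obtain ⟨j, hj, hjmin⟩ := Finset.exists_min_image (l.map Prod.snd).toFinset id
      ⟨p.2, List.mem_toFinset.2 (List.mem_map_of_mem hp)⟩
    rw [List.mem_toFinset] at hj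
    have hjmin' : ∀ b ∈ l.map Prod.snd, j ≤ b := fun b hb => hjmin b (List.mem_toFinset.2 hb)
    obtain ⟨r, hr, hrj⟩ := List.mem_map.1 hj
    obtain ⟨i, hi, himax⟩ := Finset.exists_max_image
      ((l.map Prod.fst).toFinset.filter (· < j)) id
      ⟨r.1, Finset.mem_filter.2 ⟨List.mem_toFinset.2 (List.mem_map_of_mem hr), hrj ▸ h.1 r hr⟩⟩
    rw [Finset.mem_filter, List.mem_toFinset] at hi
    have himax' : ∀ a ∈ l.map Prod.fst, a < j → a ≤ i := fun a ha haj =>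
      himax a (Finset.mem_filter.2 ⟨List.mem_toFinset.2 ha, haj⟩)
    have hm := h.innermost_mem hj hjmin' hi.1 hi.2 himax'
    have hm' := h'.innermost_mem (hs.mem_iff.1 hj) (fun b hb => hjmin' b (hs.mem_iff.2 hb))
      (hf.mem_iff.1 hi.1) hi.2 (fun a ha => himax' a (hf.mem_iff.2 ha))
    have hl := List.perm_cons_erase hm
    have hl' := List.perm_cons_erase hm'
    refine hl.trans (List.Perm.trans (List.Perm.cons _ (ih (h.mono List.erase_subset)
      (h'.mono List.erase_subset) ?_ ?_ ?_)) hl'.symm)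
    · exact List.Perm.cons_inv (((hl.map Prod.fst).symm.trans hf).trans (hl'.map Prod.fst))
    · exact List.Perm.cons_inv (((hl.map Prod.snd).symm.trans hs).trans (hl'.map Prod.snd))
    · rw [List.length_erase_of_mem hm, hn, Nat.add_sub_cancel]

theorem soWord_injective (a b : SoWord N) (h1 : leftEnds a.1 = leftEnds b.1)
    (h2 : rightEnds a.1 = rightEnds b.1) : a = b := by
  have hperm : a.1.Perm b.1 := NonCrossing.perm ⟨a.2.1, a.2.2.2⟩ ⟨b.2.1, b.2.2.2⟩
    (perm_fst_of_leftEnds_eq h1) (perm_snd_of_rightEnds_eq h2)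
  refine Subtype.ext (hperm.eq_of_pairwise (fun p q _ _ hpq hqp => ?_) a.2.2.1 b.2.2.1)
  refine Prod.ext ?_ ?_ <;> omega

/-- The lexicographic order on pairs. -/
def pairLE (p q : Fin N × Fin N) : Prop := p.1 < q.1 ∨ (p.1 = q.1 ∧ p.2 ≤ q.2)

theorem exists_soWord_perm {l : List (Fin N × Fin N)} (h : NonCrossing l) :
    ∃ a : SoWord N, l.Perm a.1 := by
  classical
  have : Std.Total (pairLE (N := N)) := ⟨fun p q => by unfold pairLE; omega⟩
  have : IsTrans _ (pairLE (N := N)) := ⟨fun p q r => by unfold pairLE; omega⟩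
  have hp := List.perm_insertionSort pairLE l
  exact ⟨⟨l.insertionSort pairLE, (h.mono hp.subset).1, List.pairwise_insertionSort pairLE l,
    (h.mono hp.subset).2⟩, hp.symm⟩

/-- Sort the two coordinate lists separately and pair them up again. -/
theorem exists_glWord_perm (l : List (Fin N × Fin N)) :
    ∃ a : GlWord N, (l.map Prod.fst).Perm (a.1.map Prod.fst) ∧
      (l.map Prod.snd).Perm (a.1.map Prod.snd) := by
  have hp := List.perm_insertionSort (· ≤ ·) (l.map Prod.fst)
  have hq := List.perm_insertionSort (· ≤ ·) (l.map Prod.snd)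
  have hlen : ((l.map Prod.fst).insertionSort (· ≤ ·)).length =
      ((l.map Prod.snd).insertionSort (· ≤ ·)).length := by
    rw [hp.length_eq, hq.length_eq, List.length_map, List.length_map]
  set a := ((l.map Prod.fst).insertionSort (· ≤ ·)).zip ((l.map Prod.snd).insertionSort (· ≤ ·))
  have h1 : a.map Prod.fst = (l.map Prod.fst).insertionSort (· ≤ ·) := List.map_fst_zip hlen.le
  have h2 : a.map Prod.snd = (l.map Prod.snd).insertionSort (· ≤ ·) := List.map_snd_zip hlen.ge
  refine ⟨⟨a, List.Pairwise.and ?_ ?_⟩, ?_, ?_⟩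
  · rw [← List.pairwise_map (f := Prod.fst) (R := (· ≤ ·)), h1]
    exact List.pairwise_insertionSort _ _
  · rw [← List.pairwise_map (f := Prod.snd) (R := (· ≤ ·)), h2]
    exact List.pairwise_insertionSort _ _
  · rw [h1]; exact hp.symm
  · rw [h2]; exact hq.symm

/-- The total length of the chords of a word, for a concave length function on the circle; it
decreases when a crossing is resolved. -/
def chordLength (l : List (Fin N × Fin N)) : ℤ :=
  (l.map fun p => ((p.2 : ℤ) - p.1) * (N - (p.2 - p.1))).sum

theorem chordLength_nonneg {l : List (Fin N × Fin N)} (h : ∀ p ∈ l, p.1 < p.2) :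
    0 ≤ chordLength l := by
  refine List.sum_nonneg fun x hx => ?_
  obtain ⟨p, hp, rfl⟩ := List.mem_map.1 hx
  have := h p hp
  exact mul_nonneg (by omega) (by omega)

theorem chordLength_cons (p : Fin N × Fin N) (l : List (Fin N × Fin N)) :
    chordLength (p :: l) = ((p.2 : ℤ) - p.1) * (N - (p.2 - p.1)) + chordLength l := by
  simp [chordLength]

theorem chordLength_perm {l l' : List (Fin N × Fin N)} (h : l.Perm l') :
    chordLength l = chordLength l' :=
  (h.map _).sum_eq

/-- The difference is 2(k - i)(m - j), by strict concavity of d(N - d). -/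
theorem chordLength_nested_lt {i k j m : Fin N} (h1 : i < k) (h3 : j < m)
    (l : List (Fin N × Fin N)) :
    chordLength ((k, j) :: (i, m) :: l) < chordLength ((i, j) :: (k, m) :: l) := by
  simp only [chordLength_cons]
  have a : (0 : ℤ) < (k : ℤ) - i := by omega
  have b : (0 : ℤ) < (m : ℤ) - j := by omega
  nlinarith [mul_pos a b]

/-- The difference is 2(j - k)(N - (m - i)), positive because m - i < N. -/
theorem chordLength_disjoint_lt {i k j m : Fin N} (h2 : k < j)
    (l : List (Fin N × Fin N)) :
    chordLength ((i, k) :: (j, m) :: l) < chordLength ((i, j) :: (k, m) :: l) := by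
  simp only [chordLength_cons]
  have a : (0 : ℤ) < (j : ℤ) - k := by omega
  have b : (0 : ℤ) < (N : ℤ) - (m - i) := by omega
  nlinarith [mul_pos a b]

end Words

/-! ### Rewriting letters inside words. -/

section Straightening

variable {G U : Type} [Group G] [AddCommGroup U] [Module ℂ U] {ρ : Representation ℂ G U}
variable {r r₀ : Smash ρ → Smash ρ → Prop} {Γ : Type} (β : Γ → U)

theorem word_swap_mem
    (hcomm : ∀ p q, Smash.gen ρ (β p) * Smash.gen ρ (β q) - Smash.gen ρ (β q) * Smash.gen ρ (β p) ∈
      negligible r r₀ 2) {l l' : List Γ} (h : l.Perm l') :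
    Smash.word ρ β l - Smash.word ρ β l' ∈ negligible r r₀ l.length := by
  induction h with
  | nil => rw [sub_self]; exact zero_mem _
  | cons p _ ih =>
    rw [Smash.word_cons, Smash.word_cons, ← mul_sub, List.length_cons, add_comm]
    exact mul_mem_negligible (Smash.gen_mem _) ih
  | swap p q l =>
    simp only [Smash.word_cons]
    rw [← mul_assoc, ← mul_assoc, ← sub_mul, List.length_cons, List.length_cons, add_assoc,
      add_comm]
    exact negligible_mul_mem (Smash.word_mem _ _) (hcomm q p)
  | trans h1 _ ih1 ih2 =>
    rw [← sub_add_sub_cancel]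
    rw [← h1.length_eq] at ih2
    exact add_mem ih1 ih2

variable {β}

theorem word_mul_mem {a b : Smash ρ} (hab : a - b ∈ negligible r r₀ 2) (l : List Γ) :
    a * Smash.word ρ β l - b * Smash.word ρ β l ∈ negligible r r₀ (l.length + 2) := by
  rw [← sub_mul, add_comm]
  exact negligible_mul_mem (Smash.word_mem _ _) hab

theorem word_cons_cons_mem {p q p' q' p'' q'' : Γ}
    (h : Smash.gen ρ (β p) * Smash.gen ρ (β q) - (Smash.gen ρ (β p') * Smash.gen ρ (β q') +
      Smash.gen ρ (β p'') * Smash.gen ρ (β q'')) ∈ negligible r r₀ 2) (l : List Γ) :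
    Smash.word ρ β (p :: q :: l) -
      (Smash.word ρ β (p' :: q' :: l) + Smash.word ρ β (p'' :: q'' :: l)) ∈
      negligible r r₀ (l.length + 2) := by
  have := word_mul_mem (β := β) h l
  rw [add_mul, mul_assoc, mul_assoc, mul_assoc] at this
  simpa only [Smash.word_cons] using this

end Straightening

/-! ### Spanning in the gl(N) case. -/

section GlSpan

variable {N : ℕ} {R : CoxeterRootSystem N} {σ : Vec N → Vec N → R.CW}

/-- The vector `e_i ⊗ e_j`. -/
def glVec (p : Fin N × Fin N) : VC N ⊗[ℂ] VC N := cx (e p.1) ⊗ₜ cx (e p.2)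

theorem span_glVec : Submodule.span ℂ (Set.range (glVec (N := N))) = ⊤ := by
  rw [← ((vcBasis N).tensorProduct (vcBasis N)).span_eq]
  congr 2
  funext p
  rw [Module.Basis.tensorProduct_apply', vcBasis_apply, vcBasis_apply]
  rfl

theorem smE_mul_grpAlg_mem (ξ η : Vec N) (a : R.CW) :
    smE R ξ η * Smash.grpAlg _ a ∈ Smash.degreeLT (repTensor R) 2 :=
  Smash.component_le_degreeLT (by norm_num : 1 + 0 < 2)
    (Smash.mul_mem (Smash.gen_mem _) (Smash.grpAlg_mem a))

theorem grpAlg_mul_smE_mem (ξ η : Vec N) (a : R.CW) :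
    Smash.grpAlg _ a * smE R ξ η ∈ Smash.degreeLT (repTensor R) 2 :=
  Smash.component_le_degreeLT (by norm_num : 0 + 1 < 2)
    (Smash.mul_mem (Smash.grpAlg_mem a) (Smash.gen_mem _))

theorem gl_comm_negligible (p q : Fin N × Fin N) :
    Smash.gen (repTensor R) (glVec p) * Smash.gen _ (glVec q) -
      Smash.gen _ (glVec q) * Smash.gen _ (glVec p) ∈ negligible (GlRel R σ) (GlRel R 0) 2 := by
  refine mem_negligible_of_rel (GlRel.comm p.1 p.2 q.1 q.2) ?_ ?_
  · have := GlRel.comm (R := R) (σ := 0) p.1 p.2 q.1 q.2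
    simp only [Pi.zero_apply, map_zero, mul_zero, zero_mul, sub_zero, add_zero] at this
    exact this
  · exact add_mem (sub_mem (smE_mul_grpAlg_mem _ _ _) (grpAlg_mul_smE_mem _ _ _))
      (sub_mem (grpAlg_mul_smE_mem _ _ _) (smE_mul_grpAlg_mem _ _ _))

theorem gl_cross_negligible (i j k l : Fin N) :
    Smash.gen (repTensor R) (glVec (i, j)) * Smash.gen _ (glVec (k, l)) -
      Smash.gen _ (glVec (i, l)) * Smash.gen _ (glVec (k, j)) ∈
      negligible (GlRel R σ) (GlRel R 0) 2 := by
  refine mem_negligible_of_rel (GlRel.cross i j k l) ?_ ?_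
  · have := GlRel.cross (R := R) (σ := 0) i j k l
    simp only [Pi.zero_apply, map_zero, mul_zero, sub_zero] at this
    exact this
  · exact sub_mem (smE_mul_grpAlg_mem _ _ _) (smE_mul_grpAlg_mem _ _ _)

/-- Up to negligible terms letters commute and second indices can be exchanged, so only the two
multisets of indices matter. The first letter of `l` is assembled at the front of `l'`, and
induction treats the rest. -/
theorem gl_word_congr {l l' : List (Fin N × Fin N)}
    (hf : (l.map Prod.fst).Perm (l'.map Prod.fst)) (hs : (l.map Prod.snd).Perm (l'.map Prod.snd)) :
    Smash.word (repTensor R) glVec l - Smash.word _ glVec l' ∈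
      negligible (GlRel R σ) (GlRel R 0) l.length := by
  induction l generalizing l' with
  | nil =>
    have h1 := hf.length_eq
    rw [List.length_map, List.length_map, List.length_nil] at h1
    rw [List.length_eq_zero_iff.1 h1.symm, sub_self]
    exact zero_mem _
  | cons p l ih =>
    have hstep : ∀ {t : List (Fin N × Fin N)}, (l.map Prod.fst).Perm (t.map Prod.fst) →
        (l.map Prod.snd).Perm (t.map Prod.snd) →
        Smash.word (repTensor R) glVec (p :: l) - Smash.word _ glVec (p :: t) ∈
          negligible (GlRel R σ) (GlRel R 0) (p :: l).length := by
      intro t h1 h2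
      rw [Smash.word_cons, Smash.word_cons, ← mul_sub, List.length_cons, add_comm]
      exact mul_mem_negligible (Smash.gen_mem _) (ih h1 h2)
    have hlen : l'.length = (p :: l).length := by
      simpa using hf.length_eq.symm
    have hswap : ∀ {t : List (Fin N × Fin N)}, l'.Perm t →
        Smash.word (repTensor R) glVec t - Smash.word _ glVec l' ∈
          negligible (GlRel R σ) (GlRel R 0) (p :: l).length := by
      intro t ht
      rw [← hlen, ← neg_mem_iff, neg_sub]
      exact word_swap_mem _ gl_comm_negligible ht
    obtain ⟨⟨a, b⟩, hp1, ha⟩ :=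
      List.mem_map.1 (hf.mem_iff.1 (List.mem_map_of_mem List.mem_cons_self))
    -- A letter of `l'` with first index `p.1` is either `p` itself, or obtains the index `p.2` by
    -- exchange with a letter carrying it.
    by_cases hb : b = p.2
    · have hab : (a, b) = p := Prod.ext ha hb
      rw [hab] at hp1
      have hl' := List.perm_cons_erase hp1
      rw [← sub_add_sub_cancel]
      refine add_mem (hstep ?_ ?_) (hswap hl')
      · exact List.Perm.cons_inv (hf.trans (hl'.map Prod.fst))
      · exact List.Perm.cons_inv (hs.trans (hl'.map Prod.snd))
    · obtain ⟨⟨c, d⟩, hq1, hd⟩ :=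
        List.mem_map.1 (hs.mem_iff.1 (List.mem_map_of_mem List.mem_cons_self))
      have hl' := List.perm_cons_erase hp1
      have hq2 : (c, d) ∈ l'.erase (a, b) := by
        refine (List.mem_erase_of_ne fun h => ?_).2 hq1
        exact hb ((congrArg Prod.snd h).symm.trans hd)
      have hl2 := List.perm_cons_erase hq2
      set t := (l'.erase (a, b)).erase (c, d)
      have hl3 : l'.Perm ((a, b) :: (c, d) :: t) := hl'.trans (hl2.cons _)
      have hlen2 : t.length + 2 = (p :: l).length := by
        rw [← hlen, hl3.length_eq]
        rfl
      have ha : a = p.1 := ha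
      have hd : d = p.2 := hd
      have hx : Smash.word (repTensor R) glVec ((a, d) :: (c, b) :: t) -
          Smash.word _ glVec ((a, b) :: (c, d) :: t) ∈
          negligible (GlRel R σ) (GlRel R 0) (p :: l).length := by
        rw [← hlen2]
        have := word_mul_mem (β := glVec) (gl_cross_negligible (R := R) (σ := σ) a d c b) t
        simpa only [Smash.word_cons, mul_assoc] using this
      have had : (a, d) = p := Prod.ext ha hd
      have h1 := add_mem hx (hswap hl3)
      rw [sub_add_sub_cancel] at h1
      rw [had] at h1
      rw [← sub_add_sub_cancel]
      refine add_mem (hstep ?_ ?_) h1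
      · refine List.Perm.cons_inv (a := p.1) (hf.trans ((hl3.map Prod.fst).trans ?_))
        simp [ha]
      · refine List.Perm.cons_inv (a := p.2) (hs.trans ((hl3.map Prod.snd).trans ?_))
        simp only [List.map_cons, hd]
        exact List.Perm.swap _ _ _

/-- The monomials of the `gl(N)` quotient in the smash product. -/
def glMonomial (R : CoxeterRootSystem N) (a : GlWord N) : Smash (repTensor R) :=
  Smash.word (repTensor R) glVec a.1

theorem gl_word_mem (l : List (Fin N × Fin N)) : Smash.word (repTensor R) glVec l ∈
    Submodule.span ℂ (glMonomial R '' {a | a.1.length = l.length}) ⊔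
      negligible (GlRel R σ) (GlRel R 0) l.length := by
  obtain ⟨a, h1, h2⟩ := exists_glWord_perm l
  have hlen : a.1.length = l.length := by simpa using h1.length_eq.symm
  have := Submodule.add_mem_sup (Submodule.subset_span (R := ℂ) ⟨a, hlen, rfl⟩ :
    glMonomial R a ∈ Submodule.span ℂ (glMonomial R '' {a | a.1.length = l.length}))
    (gl_word_congr (σ := σ) h1 h2)
  rwa [glMonomial, add_sub_cancel] at this

theorem gl_component_le (n : ℕ) : Smash.component (repTensor R) n ≤
    Submodule.span ℂ (monomialFamily (glMonomial R) '' {a | a.1.1.length = n}) ⊔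
      negligible (GlRel R σ) (GlRel R 0) n :=
  component_le_of_word_mem (len := fun a : GlWord N => a.1.length) glVec span_glVec gl_word_mem n

end GlSpan

/-! ### Spanning in the so(N) case. -/

section SoSpan

variable {N : ℕ} {R : CoxeterRootSystem N} {σ : Vec N → Vec N → R.CW}

/-- The vector `e_i ∧ e_j`. -/
def soVec (p : Fin N × Fin N) : ⋀[ℂ]^2 (VC N) :=
  exteriorPower.ιMulti ℂ 2 ![cx (e p.1), cx (e p.2)]

theorem span_soVec :
    Submodule.span ℂ (Set.range fun p : {p : Fin N × Fin N // p.1 < p.2} => soVec p.1) = ⊤ := by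
  rw [eq_top_iff, ← exteriorPower.ιMulti_family_span_of_span (n := 2) ℂ span_cx, Submodule.span_le]
  rintro _ ⟨s, rfl⟩
  refine Submodule.subset_span ⟨⟨(Set.powersetCard.ofFinEmbEquiv.symm s 0,
    Set.powersetCard.ofFinEmbEquiv.symm s 1),
    (Set.powersetCard.ofFinEmbEquiv.symm s).strictMono (by simp)⟩, ?_⟩
  simp only [soVec, exteriorPower.ιMulti_family]
  congr 1
  funext i
  fin_cases i <;> rfl

theorem soVec_swap (i j : Fin N) : soVec (j, i) = -soVec (i, j) := by
  have := (exteriorPower.ιMulti ℂ 2).map_swap ![cx (e i), cx (e j)] (i := 0) (j := 1) (by simp)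
  rw [soVec, soVec, ← this]
  congr 1
  funext a
  fin_cases a <;> rfl

theorem smM_mul_grpAlg_mem (ξ η : Vec N) (a : R.CW) :
    smM R ξ η * Smash.grpAlg _ a ∈ Smash.degreeLT (repLambda R) 2 :=
  Smash.component_le_degreeLT (by norm_num : 1 + 0 < 2)
    (Smash.mul_mem (Smash.gen_mem _) (Smash.grpAlg_mem a))

theorem so_comm_negligible (p q : Fin N × Fin N) :
    Smash.gen (repLambda R) (soVec p) * Smash.gen _ (soVec q) -
      Smash.gen _ (soVec q) * Smash.gen _ (soVec p) ∈ negligible (SoRel R σ) (SoRel R 0) 2 := by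
  refine mem_negligible_of_rel (SoRel.comm (e p.1) (e p.2) (e q.1) (e q.2)) ?_ ?_
  · have := SoRel.comm (R := R) (σ := 0) (e p.1) (e p.2) (e q.1) (e q.2)
    simp only [Pi.zero_apply, map_zero, mul_zero, sub_zero, add_zero] at this
    exact this
  · exact sub_mem (sub_mem (add_mem (smM_mul_grpAlg_mem _ _ _) (smM_mul_grpAlg_mem _ _ _))
      (smM_mul_grpAlg_mem _ _ _)) (smM_mul_grpAlg_mem _ _ _)

/-- The Plücker relation, with M_jk and M_ki replaced by -M_kj and -M_ik. For i < k < j < l the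
crossing pair thus becomes a nested pair plus a disjoint pair, each letter having its smaller index
first. -/
theorem so_cross_negligible (i j k l : Fin N) :
    Smash.gen (repLambda R) (soVec (i, j)) * Smash.gen _ (soVec (k, l)) -
      (Smash.gen (repLambda R) (soVec (k, j)) * Smash.gen _ (soVec (i, l)) +
      Smash.gen (repLambda R) (soVec (i, k)) * Smash.gen _ (soVec (j, l))) ∈
      negligible (SoRel R σ) (SoRel R 0) 2 := by
  have h : smM R (e i) (e j) * smM R (e k) (e l) + smM R (e j) (e k) * smM R (e i) (e l) +
      smM R (e k) (e i) * smM R (e j) (e l) ∈ negligible (SoRel R σ) (SoRel R 0) 2 := by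
    refine mem_negligible_of_rel (SoRel.cross (e i) (e j) (e k) (e l)) ?_ ?_
    · simpa using SoRel.cross (R := R) (σ := 0) (e i) (e j) (e k) (e l)
    · exact add_mem (add_mem (smM_mul_grpAlg_mem _ _ _) (smM_mul_grpAlg_mem _ _ _))
        (smM_mul_grpAlg_mem _ _ _)
  have hneg : ∀ a b : Fin N, smM R (e b) (e a) = -Smash.gen (repLambda R) (soVec (a, b)) := by
    intro a b
    have := map_neg (Smash.genLin (repLambda R)) (soVec (a, b))
    rw [← soVec_swap] at this
    exact this
  rw [hneg k j, hneg i k, neg_mul, neg_mul] at h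
  convert h using 1
  simp only [smM, soVec]
  abel

/-- The monomials of the `so(N)` quotient in the smash product. -/
def soMonomial (R : CoxeterRootSystem N) (a : SoWord N) : Smash (repLambda R) :=
  Smash.word (repLambda R) soVec a.1

/-- Induction on `chordLength`. A word without crossings only has to be sorted; otherwise a crossing
pair is brought to the front and resolved into two words of smaller total length. -/
theorem so_word_mem (l : List (Fin N × Fin N)) (hl : ∀ p ∈ l, p.1 < p.2) :
    Smash.word (repLambda R) soVec l ∈
      Submodule.span ℂ (soMonomial R '' {a | a.1.length = l.length}) ⊔
      negligible (SoRel R σ) (SoRel R 0) l.length := by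
  induction hn : (chordLength l).toNat using Nat.strong_induction_on generalizing l with
  | _ n ih =>
    have hperm : ∀ {t : List (Fin N × Fin N)}, l.Perm t →
        Smash.word (repLambda R) soVec t ∈
          Submodule.span ℂ (soMonomial R '' {a | a.1.length = l.length}) ⊔
            negligible (SoRel R σ) (SoRel R 0) l.length →
        Smash.word (repLambda R) soVec l ∈
          Submodule.span ℂ (soMonomial R '' {a | a.1.length = l.length}) ⊔
            negligible (SoRel R σ) (SoRel R 0) l.length := by
      intro t ht h
      rw [← sub_add_cancel (Smash.word (repLambda R) soVec l) (Smash.word (repLambda R) soVec t)]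
      exact add_mem (Submodule.mem_sup_right (word_swap_mem _ so_comm_negligible ht)) h
    by_cases hc : NonCrossing l
    · obtain ⟨a, ha⟩ := exists_soWord_perm hc
      exact hperm ha (Submodule.mem_sup_left (Submodule.subset_span ⟨a, ha.length_eq.symm, rfl⟩))
    · simp only [NonCrossing, not_and, not_forall, not_le] at hc
      obtain ⟨⟨i, j⟩, hp, ⟨k, m⟩, hq, h1, h2, h3⟩ := hc hl
      have hl1 := List.perm_cons_erase hp
      have hq2 : (k, m) ∈ l.erase (i, j) := by
        refine (List.mem_erase_of_ne fun h => ?_).2 hq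
        exact h1.ne' (congrArg Prod.fst h)
      have hl2 := List.perm_cons_erase hq2
      set t := (l.erase (i, j)).erase (k, m)
      have hl3 : l.Perm ((i, j) :: (k, m) :: t) := hl1.trans (hl2.cons _)
      have h1 : i < k := h1
      have h2 : k < j := h2
      have h3 : j < m := h3
      have ht : ∀ p ∈ t, p.1 < p.2 := fun p hp =>
        hl p (hl3.mem_iff.2 (List.mem_cons_of_mem _ (List.mem_cons_of_mem _ hp)))
      have hlen : l.length = t.length + 2 := hl3.length_eq
      have hrec : ∀ t' : List (Fin N × Fin N), (∀ p ∈ t', p.1 < p.2) →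
          chordLength t' < chordLength ((i, j) :: (k, m) :: t) → t'.length = l.length →
          Smash.word (repLambda R) soVec t' ∈
            Submodule.span ℂ (soMonomial R '' {a | a.1.length = l.length}) ⊔
              negligible (SoRel R σ) (SoRel R 0) l.length := by
        intro t' ht' hlt hlen'
        rw [← chordLength_perm hl3] at hlt
        have h0 := chordLength_nonneg ht'
        have := ih _ (by omega) t' ht' rfl
        rwa [hlen'] at this
      refine hperm hl3 ?_
      have hx := word_cons_cons_mem (so_cross_negligible (R := R) (σ := σ) i j k m) t
      have hy := hrec ((k, j) :: (i, m) :: t) (by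
        intro p hp
        simp only [List.mem_cons] at hp
        rcases hp with rfl | rfl | hp
        · exact h2
        · exact (h1.trans h2).trans h3
        · exact ht p hp) (chordLength_nested_lt h1 h3 t) hlen.symm
      have hz := hrec ((i, k) :: (j, m) :: t) (by
        intro p hp
        simp only [List.mem_cons] at hp
        rcases hp with rfl | rfl | hp
        · exact h1
        · exact h3
        · exact ht p hp) (chordLength_disjoint_lt h2 t) hlen.symm
      rw [← hlen] at hx
      exact (Submodule.sub_mem_iff_left _ (add_mem hy hz)).1 (Submodule.mem_sup_right hx)

theorem so_component_le (n : ℕ) : Smash.component (repLambda R) n ≤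
    Submodule.span ℂ (monomialFamily (soMonomial R) '' {a | a.1.1.length = n}) ⊔
      negligible (SoRel R σ) (SoRel R 0) n := by
  refine component_le_of_word_mem (len := fun a : SoWord N => a.1.length)
    (fun p : {p : Fin N × Fin N // p.1 < p.2} => soVec p.1) span_soVec (fun l => ?_) n
  have := so_word_mem (R := R) (σ := σ) (l.map Subtype.val) (by
    intro p hp
    obtain ⟨q, _, rfl⟩ := List.mem_map.1 hp
    exact q.2)
  rw [List.length_map] at this
  convert this using 1
  simp [Smash.word, Function.comp_def]

end SoSpan

/-! ### Independence of the monomials as operators. -/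

section Independence

open MvPolynomial

variable {N : ℕ} {R : CoxeterRootSystem N} {I Γ : Type}

theorem linearIndependent_prod {G V : Type} [Fintype G] [AddCommGroup V] [Module ℂ V]
    (x : I × G → V) (h : ∀ (s : Finset I) (c : I → G → ℂ),
      ∑ i ∈ s, ∑ w, c i w • x (i, w) = 0 → ∀ i ∈ s, ∀ w, c i w = 0) : LinearIndependent ℂ x := by
  classical
  rw [linearIndependent_iff']
  intro t c hc a ha
  have := h (t.image Prod.fst) (fun i w => if (i, w) ∈ t then c (i, w) else 0) ?_ a.1
    (Finset.mem_image_of_mem _ ha) a.2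
  · rwa [if_pos ha] at this
  · rw [← Finset.sum_product', ← hc]
    symm
    refine Finset.sum_subset_zero_on_sdiff (fun b hb => ?_) (fun b hb => ?_) (fun b hb => ?_)
    · exact Finset.mem_product.2 ⟨Finset.mem_image_of_mem _ hb, Finset.mem_univ _⟩
    · rw [if_neg (Finset.mem_sdiff.1 hb).2, zero_smul]
    · rw [if_pos hb]

/-- Evaluation of the momenta at `k`. -/
def atMomentum (k : Vec N) :
    MvPolynomial (Fin N) (MvPolynomial (Fin N) ℂ) →+* MvPolynomial (Fin N) ℂ :=
  map (eval (coords k))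

/-- The delta function separates the group elements: the component of a relation at w involves only
the coefficients with second index w. -/
theorem linearIndependent_of_symbol [Fintype R.W] [DecidableEq R.W]
    {sy : I → MvPolynomial (Fin N) (MvPolynomial (Fin N) ℂ)} (hsy : LinearIndependent ℂ sy)
    {V : Type} [AddCommGroup V] [Module ℂ V] {x : I × R.W → V}
    (F : Vec N → V →ₗ[ℂ] (R.W → MvPolynomial (Fin N) ℂ))
    (hF : ∀ k i w v, F k (x (i, w)) v =
      atMomentum (v.1 k) (sy i) * (Pi.single w 1 : R.W → MvPolynomial _ ℂ) v) :
    LinearIndependent ℂ x := by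
  refine linearIndependent_prod x fun s c hc i hi w =>
    eq_zero_of_sum_generic hsy s (fun i => c i w) w (fun k _ => ?_) i hi
  have h := congrFun (congrArg (F k) hc) w
  simp only [map_sum, map_smul, Finset.sum_apply, Pi.smul_apply, hF, map_zero, Pi.zero_apply] at h
  rw [← h]
  refine Finset.sum_congr rfl fun i _ => ?_
  rw [Finset.sum_eq_single w]
  · rw [Pi.single_eq_same, mul_one]
    rfl
  · intro u _ hu
    rw [Pi.single_eq_of_ne hu.symm, mul_zero, smul_zero]
  · simp

theorem hasSymbol_prod_mul_opW [Fintype R.W] [DecidableEq R.W]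
    {sy : Γ → MvPolynomial (Fin N) (MvPolynomial (Fin N) ℂ)} {op : Γ → Module.End ℂ (RatFun N)}
    {k : Vec N} (hop : ∀ p T n s, HasSymbol R k T n s → HasSymbol R k (op p * T) (n + 1)
      (fun v => algebraMap _ (RatFun N) (atMomentum (v.1 k) (sy p)) * s v)) (l : List Γ) (w : R.W) :
    HasSymbol R k ((l.map op).prod * opW w.1) l.length
      (fun v => algebraMap _ (RatFun N) (atMomentum (v.1 k) (l.map sy).prod *
        (Pi.single w 1 : R.W → MvPolynomial _ ℂ) v)) := by
  induction l with
  | nil =>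
    have h := HasSymbol.opW_self (k := k) w
    rw [List.map_nil, List.map_nil, List.prod_nil, List.prod_nil, one_mul, List.length_nil]
    convert h using 2 with v
    by_cases hv : v = w
    · subst hv
      simp
    · simp [Pi.single_eq_of_ne hv]
  | cons p l ih =>
    have h := hop p _ _ _ ih
    simp only [List.map_cons, List.prod_cons, List.length_cons, map_mul, mul_assoc] at h ⊢
    exact h

/-- In a nontrivial relation let n be the maximal length of a word with a nonzero coefficient. Only
words of length n contribute to the symbol of degree n, and its component at u is a relation between
classical symbols at the momentum uk. -/
theorem linearIndependent_operators (wd : I → List Γ)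
    {sy : Γ → MvPolynomial (Fin N) (MvPolynomial (Fin N) ℂ)} {op : Γ → Module.End ℂ (RatFun N)}
    (hsy : LinearIndependent ℂ fun i => ((wd i).map sy).prod)
    (hop : ∀ [Fintype R.W], ∀ k p T n s, HasSymbol R k T n s → HasSymbol R k (op p * T) (n + 1)
      (fun v => algebraMap _ (RatFun N) (atMomentum (v.1 k) (sy p)) * s v)) :
    LinearIndependent ℂ fun a : I × R.W => ((wd a.1).map op).prod * opW a.2.1 := by
  classical
  have : Fintype R.W := Fintype.ofFinite _
  refine linearIndependent_prod _ fun s c hc => ?_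
  by_contra! hne
  obtain ⟨i₀, hi₀, w, hw⟩ := hne
  obtain ⟨i, hi, hmax⟩ := Finset.exists_max_image (s.filter fun i => ∃ w, c i w ≠ 0)
    (fun i => (wd i).length) ⟨i₀, Finset.mem_filter.2 ⟨hi₀, w, hw⟩⟩
  obtain ⟨his, u, hu⟩ := Finset.mem_filter.1 hi
  -- The coefficients are cut off to words of the top length, so that the index set and the
  -- independent family of symbols stay the same.
  have key : ∀ j ∈ s, (if (wd j).length = (wd i).length then c j u else 0) = 0 := by
    refine eq_zero_of_sum_generic hsy s _ u fun k hk => ?_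
    have h : HasSymbol R k (∑ j ∈ s, ∑ w, c j w • (((wd j).map op).prod * opW w.1))
        (wd i).length (∑ j ∈ s, ∑ w, (if (wd j).length = (wd i).length then c j w else 0) •
          fun v => algebraMap _ (RatFun N)
            (atMomentum (v.1 k) ((wd j).map sy).prod *
              (Pi.single w 1 : R.W → MvPolynomial _ ℂ) v)) := by
      refine HasSymbol.sum _ _ _ fun j hj => HasSymbol.sum _ _ _ fun w _ => ?_
      have h1 := hasSymbol_prod_mul_opW (hop k) (wd j) w
      rcases lt_trichotomy (wd j).length (wd i).length with hlt | heq | hgt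
      · rw [if_neg hlt.ne, zero_smul]
        have h2 := (h1.raise hlt).smul (c j w)
        rwa [smul_zero] at h2
      · rw [if_pos heq, ← heq]
        exact h1.smul _
      · have h0 : c j w = 0 := by
          by_contra h0
          exact (hmax j (Finset.mem_filter.2 ⟨hj, w, h0⟩)).not_gt hgt
        rw [if_neg hgt.ne', zero_smul, h0, zero_smul]
        exact HasSymbol.zero _
    rw [hc] at h
    have h2 := congrFun (h.eq_zero hk) u
    simp only [Finset.sum_apply, Pi.smul_apply, Pi.zero_apply] at h2
    refine IsFractionRing.injective (MvPolynomial (Fin N) ℂ) (RatFun N) ?_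
    rw [map_zero, map_sum, ← h2]
    refine Finset.sum_congr rfl fun j _ => ?_
    rw [Finset.sum_eq_single u]
    · rw [Pi.single_eq_same, mul_one, ← algebraMap_smul (R := ℂ) (MvPolynomial (Fin N) ℂ),
        smul_eq_mul, map_mul, ← IsScalarTower.algebraMap_apply, ← Algebra.smul_def]
      rfl
    · intro v _ hv
      rw [Pi.single_eq_of_ne hv.symm, mul_zero, map_zero, smul_zero]
    · simp
  have := key i his
  rw [if_pos rfl] at this
  exact hu this

theorem inner_e (i : Fin N) (k : Vec N) : inner ℝ (e i) k = k i := by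
  rw [e, EuclideanSpace.inner_single_left]
  simp

theorem atMomentum_glSymbol (k : Vec N) (p : Fin N × Fin N) :
    atMomentum k (glSymbol p) = X p.1 * C (coords k p.2) := by
  simp [atMomentum, glSymbol]

theorem atMomentum_soSymbol (k : Vec N) (p : Fin N × Fin N) :
    atMomentum k (soSymbol p) = X p.1 * C (coords k p.2) - X p.2 * C (coords k p.1) := by
  simp [atMomentum, soSymbol]

theorem hasSymbol_opE_mul [Fintype R.W] (P : R.PositiveHalf) (g : Vec N → ℂ) {k : Vec N}
    (p : Fin N × Fin N) {T : Module.End ℂ (RatFun N)} {n : ℕ} {s : R.W → RatFun N}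
    (h : HasSymbol R k T n s) : HasSymbol R k (opE P g (e p.1) (e p.2) * T) (n + 1)
      (fun v => algebraMap _ (RatFun N) (atMomentum (v.1 k) (glSymbol p)) * s v) := by
  have h1 := (h.nabla_mul P g (e p.2)).opX_mul (e p.1)
  rw [← mul_assoc] at h1
  refine Eq.mp (congrArg _ (funext fun v => ?_)) h1
  symm
  rw [atMomentum_glSymbol, inner_e, map_mul, mul_assoc, linRat, linForm_e,
    IsScalarTower.algebraMap_apply ℂ (MvPolynomial (Fin N) ℂ) (RatFun N)]
  rfl

theorem hasSymbol_opM_mul [Fintype R.W] (P : R.PositiveHalf) (g : Vec N → ℂ) {k : Vec N}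
    (p : Fin N × Fin N) {T : Module.End ℂ (RatFun N)} {n : ℕ} {s : R.W → RatFun N}
    (h : HasSymbol R k T n s) : HasSymbol R k (opM P g (e p.1) (e p.2) * T) (n + 1)
      (fun v => algebraMap _ (RatFun N) (atMomentum (v.1 k) (soSymbol p)) * s v) := by
  have h1 := (hasSymbol_opE_mul P g p h).add ((hasSymbol_opE_mul P g p.swap h).smul (-1))
  convert h1 using 1
  · exact (sub_mul _ _ _).trans
      ((sub_eq_add_neg _ _).trans (congrArg _ (neg_one_smul ℂ _).symm))
  · funext v
    have h2 : soSymbol p = glSymbol p - glSymbol p.swap := rfl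
    rw [h2, map_sub, map_sub]
    exact (sub_mul _ _ _).trans
      ((sub_eq_add_neg _ _).trans (congrArg _ (neg_one_smul ℂ _).symm))

theorem linearIndependent_glSymbol :
    LinearIndependent ℂ fun a : GlWord N => (a.1.map glSymbol).prod :=
  linearIndependent_of_leadingTerm _ _ (fun _ p _ => glSymbol_leadingTerm p) glWord_injective

theorem linearIndependent_soSymbol :
    LinearIndependent ℂ fun a : SoWord N => (a.1.map soSymbol).prod :=
  linearIndependent_of_leadingTerm _ _ (fun a p hp => soSymbol_leadingTerm (a.2.1 p hp))
    soWord_injective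

theorem linearIndependent_opE (P : R.PositiveHalf) (g : Vec N → ℂ) :
    LinearIndependent ℂ fun a : GlWord N × R.W =>
      (a.1.1.map fun p => opE P g (e p.1) (e p.2)).prod * opW a.2.1 :=
  linearIndependent_operators _ linearIndependent_glSymbol
    fun _ p _ _ _ h => hasSymbol_opE_mul P g p h

theorem linearIndependent_opM (P : R.PositiveHalf) (g : Vec N → ℂ) :
    LinearIndependent ℂ fun a : SoWord N × R.W =>
      (a.1.1.map fun p => opM P g (e p.1) (e p.2)).prod * opW a.2.1 :=
  linearIndependent_operators _ linearIndependent_soSymbol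
    fun _ p _ _ _ h => hasSymbol_opM_mul P g p h

end Independence

/-! ### A model of the homogeneous algebras: functions on W × V. -/

section SymbolRealization

open MvPolynomial

variable {N : ℕ} {R : CoxeterRootSystem N}

/-- The action of `w` on functions on `W` with polynomial values. -/
def symbolAct (R : CoxeterRootSystem N) (w : R.W) :
    Module.End ℂ (R.W → MvPolynomial (Fin N) ℂ) where
  toFun q v := polyHom w.1 (q (w⁻¹ * v))
  map_add' q q' := by
    funext v
    exact map_add _ _ _
  map_smul' c q := by
    funext v
    exact map_smul (polyHom w.1) c _

theorem symbolAct_apply (R : CoxeterRootSystem N) (w v : R.W)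
    (q : R.W → MvPolynomial (Fin N) ℂ) : symbolAct R w q v = polyHom w.1 (q (w⁻¹ * v)) := rfl

/-- The action of `W` on functions on `W` with polynomial values. -/
def symbolGrp (R : CoxeterRootSystem N) : R.W →* Module.End ℂ (R.W → MvPolynomial (Fin N) ℂ) where
  toFun := symbolAct R
  map_one' := by
    refine LinearMap.ext fun q => funext fun v => ?_
    rw [symbolAct_apply, inv_one, one_mul]
    exact polyHom_one _
  map_mul' w w' := by
    refine LinearMap.ext fun q => funext fun v => ?_
    rw [Module.End.mul_apply, symbolAct_apply, symbolAct_apply, symbolAct_apply, mul_inv_rev,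
      mul_assoc]
    exact polyHom_mul w.1 w'.1 _

theorem symbolGrp_apply (R : CoxeterRootSystem N) (w v : R.W) (q : R.W → MvPolynomial (Fin N) ℂ) :
    symbolGrp R w q v = polyHom w.1 (q (w⁻¹ * v)) := rfl

theorem symbolGrp_mul_lmul (R : CoxeterRootSystem N) (w : R.W)
    {f f' : R.W → MvPolynomial (Fin N) ℂ} (h : ∀ v, polyHom w.1 (f (w⁻¹ * v)) = f' v) :
    symbolGrp R w * Algebra.lmul ℂ _ f = Algebra.lmul ℂ _ f' * symbolGrp R w := by
  refine LinearMap.ext fun q => funext fun v => ?_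
  change polyHom w.1 (f (w⁻¹ * v) * q (w⁻¹ * v)) = f' v * polyHom w.1 (q (w⁻¹ * v))
  rw [map_mul, h]

theorem vcLift_X (ξ : Vec N) {G : Type} :
    vcLift (fun i (_ : G) => X i) (cx ξ) = fun _ => linForm (N := N) ξ := by
  rw [vcLift_cx]
  funext v
  simp only [Finset.sum_apply, Pi.smul_apply, linForm, smul_eq_C_mul]

theorem vcLift_coords (ξ : Vec N) {G : Type} (k : G → Vec N) :
    vcLift (fun i v => C (coords (k v) i)) (cx ξ) =
      fun v => C (σ := Fin N) ((inner ℝ ξ (k v) : ℝ) : ℂ) := by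
  rw [vcLift_cx]
  funext v
  rw [← eval_linForm]
  simp only [Finset.sum_apply, Pi.smul_apply, linForm, smul_eq_C_mul, map_sum, map_mul, eval_C,
    eval_X]

/-- The realization of the quadratic parts of the relations by functions on `W × V`, where the
momenta run through the orbit of `k`. -/
def symbolRealization (R : CoxeterRootSystem N) (k : Vec N) :
    Realization R 0 (Module.End ℂ (R.W → MvPolynomial (Fin N) ℂ)) where
  X := (Algebra.lmul ℂ (R.W → MvPolynomial (Fin N) ℂ)).toLinearMap ∘ₗ vcLift fun i _ => X i
  Y := (Algebra.lmul ℂ (R.W → MvPolynomial (Fin N) ℂ)).toLinearMap ∘ₗ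
    vcLift fun i v => C (coords (v.1 k) i)
  grp := symbolGrp R
  symm _ _ := rfl
  XX ξ η := by
    simp only [LinearMap.comp_apply, AlgHom.toLinearMap_apply, ← map_mul, mul_comm]
  YY ξ η := by
    simp only [LinearMap.comp_apply, AlgHom.toLinearMap_apply, ← map_mul, mul_comm]
  YX ξ η := by
    simp only [LinearMap.comp_apply, AlgHom.toLinearMap_apply, ← map_mul, Pi.zero_apply, map_zero]
    rw [mul_comm, sub_self]
  grp_X_cx w ξ := by
    refine symbolGrp_mul_lmul R w fun v => ?_
    rw [vcLift_X, vcLift_X, polyHom_linForm]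
  grp_Y_cx w ξ := by
    refine symbolGrp_mul_lmul R w fun v => ?_
    simp only [vcLift_coords]
    rw [← LinearIsometryEquiv.inner_map_map w.1 ξ]
    change polyHom w.1 (C ((inner ℝ _ ((w * (w⁻¹ * v)).1 k) : ℝ) : ℂ)) = _
    rw [mul_inv_cancel_left]
    exact algHom_C _ _

theorem symbolRealization_X (R : CoxeterRootSystem N) (k : Vec N) (i : Fin N) :
    (symbolRealization R k).X (cx (e i)) = Algebra.lmul ℂ (R.W → MvPolynomial (Fin N) ℂ)
      fun _ => X i := by
  rw [← linForm_e, ← vcLift_X]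
  rfl

theorem symbolRealization_Y (R : CoxeterRootSystem N) (k : Vec N) (i : Fin N) :
    (symbolRealization R k).Y (cx (e i)) = Algebra.lmul ℂ (R.W → MvPolynomial (Fin N) ℂ)
      fun v => C (coords (v.1 k) i) := by
  have h := vcLift_coords (e i) fun v : R.W => v.1 k
  simp only [inner_e] at h
  exact congrArg (Algebra.lmul ℂ _) h

/-- Applied to the delta function at 1, the group element moves the support to w, and the letters
then multiply by their symbols at the momenta vk. -/
theorem prod_lmul_symbolGrp_apply [DecidableEq R.W] {Γ : Type} {k : Vec N}
    {sy : Γ → MvPolynomial (Fin N) (MvPolynomial (Fin N) ℂ)}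
    {op : Γ → Module.End ℂ (R.W → MvPolynomial (Fin N) ℂ)}
    (hop : ∀ p, op p = Algebra.lmul ℂ _ fun v => atMomentum (v.1 k) (sy p)) (l : List Γ)
    (w v : R.W) : ((l.map op).prod * symbolGrp R w) (Pi.single 1 1) v =
      atMomentum (v.1 k) (l.map sy).prod * (Pi.single w 1 : R.W → MvPolynomial _ ℂ) v := by
  induction l with
  | nil =>
    rw [List.map_nil, List.map_nil, List.prod_nil, List.prod_nil, one_mul, map_one, one_mul,
      symbolGrp_apply]
    by_cases h : v = w
    · subst h
      simp
    · rw [Pi.single_eq_of_ne h, Pi.single_eq_of_ne (fun h' => h (inv_mul_eq_one.1 h').symm),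
        map_zero]
  | cons p l ih =>
    rw [List.map_cons, List.map_cons, List.prod_cons, List.prod_cons, map_mul, mul_assoc,
      mul_assoc, ← ih, hop]
    rfl

end SymbolRealization

/-! ### Isomorphisms onto generated subalgebras. -/

section Isomorphisms

variable {A B : Type} [Ring A] [Algebra ℂ A] [Ring B] [Algebra ℂ B]

theorem exists_algEquiv_adjoin (f : A →ₐ[ℂ] B) (hf : Function.Injective f) {s : Set A}
    (hs : Algebra.adjoin ℂ s = ⊤) {t : Set B} (ht : f '' s = t) :
    ∃ Φ : A ≃ₐ[ℂ] Algebra.adjoin ℂ t, ∀ a, (Φ a : B) = f a := by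
  have h : f.range = Algebra.adjoin ℂ t := by
    rw [← ht, ← AlgHom.map_adjoin, hs, Algebra.map_top]
  exact ⟨(AlgEquiv.ofInjective f hf).trans (Subalgebra.equivOfEq _ _ h), fun a => rfl⟩

theorem injective_of_linearIndependent {I : Type} (f : A →ₐ[ℂ] B) {m : I → A}
    (hm : ⊤ ≤ Submodule.span ℂ (Set.range m)) (hind : LinearIndependent ℂ fun i => f (m i)) :
    Function.Injective f := by
  rw [injective_iff_map_eq_zero]
  intro x hx
  obtain ⟨c, rfl⟩ := Finsupp.mem_span_range_iff_exists_finsupp.1 (hm (Submodule.mem_top (x := x)))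
  have : c = 0 := by
    refine linearIndependent_iff.1 hind c ?_
    rw [Finsupp.linearCombination_apply]
    simpa [Finsupp.sum, map_sum] using hx
  rw [this, Finsupp.sum_zero_index]

end Isomorphisms

/-! ### Monomials in the quotients: images, independence for zero S, spanning. -/

section Monomials

variable {N : ℕ} {R : CoxeterRootSystem N} {σ : Vec N → Vec N → R.CW} {T : Type} [Ring T]
  [Algebra ℂ T] (D : Realization R σ T)

theorem soHom_monomial (a : SoWord N × R.W) :
    D.soHom (RingQuot.mkAlgHom ℂ _ (monomialFamily (soMonomial R) a)) =
      (a.1.1.map fun p => D.X (cx (e p.1)) * D.Y (cx (e p.2)) -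
        D.X (cx (e p.2)) * D.Y (cx (e p.1))).prod * D.grp a.2 := by
  have h : ∀ p : Fin N × Fin N, D.soSmash (Smash.gen (repLambda R) (soVec p)) =
      D.X (cx (e p.1)) * D.Y (cx (e p.2)) - D.X (cx (e p.2)) * D.Y (cx (e p.1)) :=
    fun p => D.soSmash_M (e p.1) (e p.2)
  rw [D.soHom_mk, monomialFamily, soMonomial, Smash.word, map_mul, map_list_prod, D.soSmash_grp,
    List.map_map]
  simp only [Function.comp_def, h]

theorem glHom_monomial (a : GlWord N × R.W) :
    D.glHom (RingQuot.mkAlgHom ℂ _ (monomialFamily (glMonomial R) a)) =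
      (a.1.1.map fun p => D.X (cx (e p.1)) * D.Y (cx (e p.2))).prod * D.grp a.2 := by
  have h : ∀ p : Fin N × Fin N, D.glSmash (Smash.gen (repTensor R) (glVec p)) =
      D.X (cx (e p.1)) * D.Y (cx (e p.2)) :=
    fun p => D.glSmash_E (e p.1) (e p.2)
  rw [D.glHom_mk, monomialFamily, glMonomial, Smash.word, map_mul, map_list_prod, D.glSmash_grp,
    List.map_map]
  simp only [Function.comp_def, h]

/-- Setting g = 0 in the Dunkl operators would not do, since S_{ξη} is then the scalar (ξ, η) rather
than 0; hence the commutative model with momenta on an orbit. -/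
theorem linearIndependent_soMonomial_zero : LinearIndependent ℂ fun a : SoWord N × R.W =>
    RingQuot.mkAlgHom ℂ (SoRel R 0) (monomialFamily (soMonomial R) a) := by
  classical
  have : Fintype R.W := Fintype.ofFinite _
  refine linearIndependent_of_symbol linearIndependent_soSymbol (fun k =>
    (LinearMap.applyₗ (Pi.single 1 1)) ∘ₗ (symbolRealization R k).soHom.toLinearMap)
    fun k i w v => ?_
  rw [LinearMap.comp_apply, AlgHom.toLinearMap_apply, soHom_monomial]
  refine prod_lmul_symbolGrp_apply (fun p => ?_) i.1 w v
  simp only [symbolRealization_X, symbolRealization_Y, ← map_mul, ← map_sub, atMomentum_soSymbol]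
  rfl

theorem linearIndependent_glMonomial_zero : LinearIndependent ℂ fun a : GlWord N × R.W =>
    RingQuot.mkAlgHom ℂ (GlRel R 0) (monomialFamily (glMonomial R) a) := by
  classical
  have : Fintype R.W := Fintype.ofFinite _
  refine linearIndependent_of_symbol linearIndependent_glSymbol (fun k =>
    (LinearMap.applyₗ (Pi.single 1 1)) ∘ₗ (symbolRealization R k).glHom.toLinearMap)
    fun k i w v => ?_
  rw [LinearMap.comp_apply, AlgHom.toLinearMap_apply, glHom_monomial]
  refine prod_lmul_symbolGrp_apply (fun p => ?_) i.1 w v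
  simp only [symbolRealization_X, symbolRealization_Y, ← map_mul, atMomentum_glSymbol]
  rfl

theorem soQuot_monomial_eq (P : R.PositiveHalf) (g : Vec N → ℂ) (a : SoWord N × R.W) :
    SoQuot.monomial P g a =
      RingQuot.mkAlgHom ℂ (SoRel R (S P g)) (monomialFamily (soMonomial R) a) := by
  rw [monomialFamily, soMonomial, Smash.word, map_mul, map_list_prod, List.map_map]
  rfl

theorem glQuot_monomial_eq (P : R.PositiveHalf) (g : Vec N → ℂ) (a : GlWord N × R.W) :
    GlQuot.monomial P g a =
      RingQuot.mkAlgHom ℂ (GlRel R (S P g)) (monomialFamily (glMonomial R) a) := by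
  rw [monomialFamily, glMonomial, Smash.word, map_mul, map_list_prod, List.map_map]
  rfl

theorem span_soQuot_monomial (P : R.PositiveHalf) (g : Vec N → ℂ) :
    ⊤ ≤ Submodule.span ℂ (Set.range (SoQuot.monomial P g)) := by
  rw [funext (soQuot_monomial_eq P g)]
  exact span_monomials_eq_top (len := fun a : SoWord N => a.1.length) (m := soMonomial R)
    (r₀ := SoRel R 0) so_component_le

theorem span_glQuot_monomial (P : R.PositiveHalf) (g : Vec N → ℂ) :
    ⊤ ≤ Submodule.span ℂ (Set.range (GlQuot.monomial P g)) := by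
  rw [funext (glQuot_monomial_eq P g)]
  exact span_monomials_eq_top (len := fun a : GlWord N => a.1.length) (m := glMonomial R)
    (r₀ := GlRel R 0) gl_component_le

/-- The generators of the `so(N)` quotient. -/
def soGenerators (P : R.PositiveHalf) (g : Vec N → ℂ) : Set (SoQuot P g) :=
  {a | ∃ ξ η : Vec N, a = SoQuot.M P g ξ η} ∪ {a | ∃ w : R.W, a = SoQuot.grp P g w}

/-- The generators of the `gl(N)` quotient. -/
def glGenerators (P : R.PositiveHalf) (g : Vec N → ℂ) : Set (GlQuot P g) :=
  {a | ∃ ξ η : Vec N, a = GlQuot.E P g ξ η} ∪ {a | ∃ w : R.W, a = GlQuot.grp P g w}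

theorem adjoin_soGenerators (P : R.PositiveHalf) (g : Vec N → ℂ) :
    Algebra.adjoin ℂ (soGenerators P g) = ⊤ := by
  have h : Submodule.span ℂ (Set.range (SoQuot.monomial P g)) ≤
      Subalgebra.toSubmodule (Algebra.adjoin ℂ (soGenerators P g)) := by
    refine Submodule.span_le.2 ?_
    rintro _ ⟨a, rfl⟩
    refine Subalgebra.mul_mem _ (Subalgebra.list_prod_mem _ fun x hx => ?_)
      (Algebra.subset_adjoin (Or.inr ⟨a.2, rfl⟩))
    obtain ⟨p, _, rfl⟩ := List.mem_map.1 hx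
    exact Algebra.subset_adjoin (Or.inl ⟨_, _, rfl⟩)
  exact eq_top_iff.2 fun x _ => h (span_soQuot_monomial P g Submodule.mem_top)

theorem adjoin_glGenerators (P : R.PositiveHalf) (g : Vec N → ℂ) :
    Algebra.adjoin ℂ (glGenerators P g) = ⊤ := by
  have h : Submodule.span ℂ (Set.range (GlQuot.monomial P g)) ≤
      Subalgebra.toSubmodule (Algebra.adjoin ℂ (glGenerators P g)) := by
    refine Submodule.span_le.2 ?_
    rintro _ ⟨a, rfl⟩
    refine Subalgebra.mul_mem _ (Subalgebra.list_prod_mem _ fun x hx => ?_)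
      (Algebra.subset_adjoin (Or.inr ⟨a.2, rfl⟩))
    obtain ⟨p, _, rfl⟩ := List.mem_map.1 hx
    exact Algebra.subset_adjoin (Or.inl ⟨_, _, rfl⟩)
  exact eq_top_iff.2 fun x _ => h (span_glQuot_monomial P g Submodule.mem_top)

end Monomials

/-! ### Injectivity of the representations and assembly of the theorem. -/

section Main

variable {N : ℕ} {R : CoxeterRootSystem N} (P : R.PositiveHalf) {g : Vec N → ℂ}

section

variable {T : Type} [Ring T] [Algebra ℂ T] (D : Realization R (S P g) T)

theorem soHom_M (ξ η : Vec N) : D.soHom (SoQuot.M P g ξ η) =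
    D.X (cx ξ) * D.Y (cx η) - D.X (cx η) * D.Y (cx ξ) :=
  (D.soHom_mk _).trans (D.soSmash_M _ _)

theorem soHom_grp (w : R.W) : D.soHom (SoQuot.grp P g w) = D.grp w :=
  (D.soHom_mk _).trans (D.soSmash_grp _)

theorem glHom_E (ξ η : Vec N) : D.glHom (GlQuot.E P g ξ η) = D.X (cx ξ) * D.Y (cx η) :=
  (D.glHom_mk _).trans (D.glSmash_E _ _)

theorem glHom_grp (w : R.W) : D.glHom (GlQuot.grp P g w) = D.grp w :=
  (D.glHom_mk _).trans (D.glSmash_grp _)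

theorem image_soGenerators : D.soHom '' soGenerators P g =
    {a | ∃ ξ η : Vec N, a = D.X (cx ξ) * D.Y (cx η) - D.X (cx η) * D.Y (cx ξ)} ∪
      {a | ∃ w : R.W, a = D.grp w} := by
  rw [soGenerators, Set.image_union]
  congr 1
  · ext a
    constructor
    · rintro ⟨_, ⟨ξ, η, rfl⟩, rfl⟩
      exact ⟨ξ, η, soHom_M P D ξ η⟩
    · rintro ⟨ξ, η, rfl⟩
      exact ⟨_, ⟨ξ, η, rfl⟩, soHom_M P D ξ η⟩
  · ext a
    constructor
    · rintro ⟨_, ⟨w, rfl⟩, rfl⟩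
      exact ⟨w, soHom_grp P D w⟩
    · rintro ⟨w, rfl⟩
      exact ⟨_, ⟨w, rfl⟩, soHom_grp P D w⟩

theorem image_glGenerators : D.glHom '' glGenerators P g =
    {a | ∃ ξ η : Vec N, a = D.X (cx ξ) * D.Y (cx η)} ∪ {a | ∃ w : R.W, a = D.grp w} := by
  rw [glGenerators, Set.image_union]
  congr 1
  · ext a
    constructor
    · rintro ⟨_, ⟨ξ, η, rfl⟩, rfl⟩
      exact ⟨ξ, η, glHom_E P D ξ η⟩
    · rintro ⟨ξ, η, rfl⟩
      exact ⟨_, ⟨ξ, η, rfl⟩, glHom_E P D ξ η⟩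
  · ext a
    constructor
    · rintro ⟨_, ⟨w, rfl⟩, rfl⟩
      exact ⟨w, glHom_grp P D w⟩
    · rintro ⟨w, rfl⟩
      exact ⟨_, ⟨w, rfl⟩, glHom_grp P D w⟩

/-- Every realization factors through H_g(W), so injectivity of the Dunkl map passes to the map into
H_g(W). -/
theorem cherednikHom_comp_soHom :
    D.cherednikHom.comp (cherednikRealization P g).soHom = D.soHom := by
  refine AlgHom.ext_of_adjoin_eq_top (adjoin_soGenerators P g) ?_
  have hX : ∀ ξ, D.cherednikHom ((cherednikRealization P g).X (cx ξ)) = D.X (cx ξ) :=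
    fun ξ => (D.cherednikHom_mk _).trans (D.sumSmash_X ξ)
  have hY : ∀ ξ, D.cherednikHom ((cherednikRealization P g).Y (cx ξ)) = D.Y (cx ξ) :=
    fun ξ => (D.cherednikHom_mk _).trans (D.sumSmash_Y ξ)
  rintro _ (⟨ξ, η, rfl⟩ | ⟨w, rfl⟩)
  · rw [AlgHom.comp_apply, soHom_M, soHom_M, map_sub, map_mul, map_mul, hX, hX, hY, hY]
  · rw [AlgHom.comp_apply, soHom_grp, soHom_grp]
    exact (D.cherednikHom_mk _).trans (D.sumSmash_grp w)

theorem cherednikHom_comp_glHom :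
    D.cherednikHom.comp (cherednikRealization P g).glHom = D.glHom := by
  refine AlgHom.ext_of_adjoin_eq_top (adjoin_glGenerators P g) ?_
  have hX : ∀ ξ, D.cherednikHom ((cherednikRealization P g).X (cx ξ)) = D.X (cx ξ) :=
    fun ξ => (D.cherednikHom_mk _).trans (D.sumSmash_X ξ)
  have hY : ∀ ξ, D.cherednikHom ((cherednikRealization P g).Y (cx ξ)) = D.Y (cx ξ) :=
    fun ξ => (D.cherednikHom_mk _).trans (D.sumSmash_Y ξ)
  rintro _ (⟨ξ, η, rfl⟩ | ⟨w, rfl⟩)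
  · rw [AlgHom.comp_apply, glHom_E, glHom_E, map_mul, hX, hY]
  · rw [AlgHom.comp_apply, glHom_grp, glHom_grp]
    exact (D.cherednikHom_mk _).trans (D.sumSmash_grp w)

end

variable (hg : ∀ w ∈ R.W, ∀ α ∈ R.roots, g (w α) = g α)

theorem linearIndependent_soHom_monomial : LinearIndependent ℂ fun a : SoWord N × R.W =>
    (dunklRealization P hg).soHom (SoQuot.monomial P g a) := by
  simp only [soQuot_monomial_eq, soHom_monomial, dunklRealization_X, dunklRealization_Y]
  exact linearIndependent_opM P g

theorem linearIndependent_glHom_monomial : LinearIndependent ℂ fun a : GlWord N × R.W =>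
    (dunklRealization P hg).glHom (GlQuot.monomial P g a) := by
  simp only [glQuot_monomial_eq, glHom_monomial, dunklRealization_X, dunklRealization_Y]
  exact linearIndependent_opE P g

theorem linearIndependent_soQuot_monomial (hg : ∀ w ∈ R.W, ∀ α ∈ R.roots, g (w α) = g α) :
    LinearIndependent ℂ (SoQuot.monomial P g) :=
  LinearIndependent.of_comp (dunklRealization P hg).soHom.toLinearMap
    (linearIndependent_soHom_monomial P hg)

theorem linearIndependent_glQuot_monomial (hg : ∀ w ∈ R.W, ∀ α ∈ R.roots, g (w α) = g α) :
    LinearIndependent ℂ (GlQuot.monomial P g) :=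
  LinearIndependent.of_comp (dunklRealization P hg).glHom.toLinearMap
    (linearIndependent_glHom_monomial P hg)

theorem soHom_dunkl_injective : Function.Injective (dunklRealization P hg).soHom :=
  injective_of_linearIndependent _ (span_soQuot_monomial P g)
    (linearIndependent_soHom_monomial P hg)

theorem glHom_dunkl_injective : Function.Injective (dunklRealization P hg).glHom :=
  injective_of_linearIndependent _ (span_glQuot_monomial P g)
    (linearIndependent_glHom_monomial P hg)

/-- The map into H_g(W) is the first factor of the injective Dunkl map, so no basis of H_g(W) is
needed. -/
theorem soHom_cherednik_injective (hg : ∀ w ∈ R.W, ∀ α ∈ R.roots, g (w α) = g α) :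
    Function.Injective (cherednikRealization P g).soHom := by
  have h := soHom_dunkl_injective P hg
  rw [← cherednikHom_comp_soHom, AlgHom.coe_comp] at h
  exact h.of_comp

theorem glHom_cherednik_injective (hg : ∀ w ∈ R.W, ∀ α ∈ R.roots, g (w α) = g α) :
    Function.Injective (cherednikRealization P g).glHom := by
  have h := glHom_dunkl_injective P hg
  rw [← cherednikHom_comp_glHom, AlgHom.coe_comp] at h
  exact h.of_comp

theorem exists_soQuot_equiv_soAlgebra (hg : ∀ w ∈ R.W, ∀ α ∈ R.roots, g (w α) = g α) :
    ∃ Φ : SoQuot P g ≃ₐ[ℂ] soAlgebra P g,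
      (∀ ξ η, (Φ (SoQuot.M P g ξ η) : Module.End ℂ (RatFun N)) = opM P g ξ η) ∧
      ∀ w : R.W, (Φ (SoQuot.grp P g w) : Module.End ℂ (RatFun N)) = opW w.1 := by
  have himg := image_soGenerators P (dunklRealization P hg)
  simp only [dunklRealization_X, dunklRealization_Y] at himg
  obtain ⟨Φ, hΦ⟩ := exists_algEquiv_adjoin _ (soHom_dunkl_injective P hg)
    (adjoin_soGenerators P g) himg
  refine ⟨Φ, fun ξ η => (hΦ _).trans ?_, fun w => (hΦ _).trans (soHom_grp P _ w)⟩
  rw [soHom_M, dunklRealization_X, dunklRealization_Y, dunklRealization_X, dunklRealization_Y]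
  rfl

theorem exists_glQuot_equiv_glAlgebra (hg : ∀ w ∈ R.W, ∀ α ∈ R.roots, g (w α) = g α) :
    ∃ Φ : GlQuot P g ≃ₐ[ℂ] glAlgebra P g,
      (∀ ξ η, (Φ (GlQuot.E P g ξ η) : Module.End ℂ (RatFun N)) = opE P g ξ η) ∧
      ∀ w : R.W, (Φ (GlQuot.grp P g w) : Module.End ℂ (RatFun N)) = opW w.1 := by
  have himg := image_glGenerators P (dunklRealization P hg)
  simp only [dunklRealization_X, dunklRealization_Y] at himg
  obtain ⟨Φ, hΦ⟩ := exists_algEquiv_adjoin _ (glHom_dunkl_injective P hg)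
    (adjoin_glGenerators P g) himg
  refine ⟨Φ, fun ξ η => (hΦ _).trans ?_, fun w => (hΦ _).trans (glHom_grp P _ w)⟩
  rw [glHom_E, dunklRealization_X, dunklRealization_Y]
  rfl

theorem exists_soQuot_equiv_soSubalgebra (hg : ∀ w ∈ R.W, ∀ α ∈ R.roots, g (w α) = g α) :
    ∃ Ψ : SoQuot P g ≃ₐ[ℂ] Cherednik.soSubalgebra P g,
      (∀ ξ η, (Ψ (SoQuot.M P g ξ η) : Cherednik P g) =
        Cherednik.x P g ξ * Cherednik.y P g η - Cherednik.x P g η * Cherednik.y P g ξ) ∧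
      ∀ w : R.W, (Ψ (SoQuot.grp P g w) : Cherednik P g) = Cherednik.grp P g w := by
  have himg : (cherednikRealization P g).soHom '' soGenerators P g =
      {a | ∃ ξ η : Vec N, a = Cherednik.x P g ξ * Cherednik.y P g η -
        Cherednik.x P g η * Cherednik.y P g ξ} ∪ Set.range (Cherednik.grp P g) := by
    rw [image_soGenerators]
    congr 1
    ext a
    exact exists_congr fun w => eq_comm
  obtain ⟨Ψ, hΨ⟩ := exists_algEquiv_adjoin _ (soHom_cherednik_injective P hg)
    (adjoin_soGenerators P g) himg
  exact ⟨Ψ, fun ξ η => (hΨ _).trans (soHom_M P _ ξ η), fun w => (hΨ _).trans (soHom_grp P _ w)⟩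

theorem exists_glQuot_equiv_glSubalgebra (hg : ∀ w ∈ R.W, ∀ α ∈ R.roots, g (w α) = g α) :
    ∃ Ψ : GlQuot P g ≃ₐ[ℂ] Cherednik.glSubalgebra P g,
      (∀ ξ η, (Ψ (GlQuot.E P g ξ η) : Cherednik P g) =
        Cherednik.x P g ξ * Cherednik.y P g η) ∧
      ∀ w : R.W, (Ψ (GlQuot.grp P g w) : Cherednik P g) = Cherednik.grp P g w := by
  have himg : (cherednikRealization P g).glHom '' glGenerators P g =
      {a | ∃ ξ η : Vec N, a = Cherednik.x P g ξ * Cherednik.y P g η} ∪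
        Set.range (Cherednik.grp P g) := by
    rw [image_glGenerators]
    congr 1
    ext a
    exact exists_congr fun w => eq_comm
  obtain ⟨Ψ, hΨ⟩ := exists_algEquiv_adjoin _ (glHom_cherednik_injective P hg)
    (adjoin_glGenerators P g) himg
  exact ⟨Ψ, fun ξ η => (hΨ _).trans (glHom_E P _ ξ η), fun w => (hΨ _).trans (glHom_grp P _ w)⟩

theorem so_isPBW (hg : ∀ w ∈ R.W, ∀ α ∈ R.roots, g (w α) = g α) :
    IsPBW (repLambda R) (SoRel R (S P g)) (SoRel R 0) := by
  have h := linearIndependent_soQuot_monomial P hg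
  rw [funext (soQuot_monomial_eq P g)] at h
  exact isPBW_of_linearIndependent (len := fun a : SoWord N => a.1.length) (m := soMonomial R)
    so_component_le h linearIndependent_soMonomial_zero

theorem gl_isPBW (hg : ∀ w ∈ R.W, ∀ α ∈ R.roots, g (w α) = g α) :
    IsPBW (repTensor R) (GlRel R (S P g)) (GlRel R 0) := by
  have h := linearIndependent_glQuot_monomial P hg
  rw [funext (glQuot_monomial_eq P g)] at h
  exact isPBW_of_linearIndependent (len := fun a : GlWord N => a.1.length) (m := glMonomial R)
    gl_component_le h linearIndependent_glMonomial_zero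

end Main

end DunklAngular

end

open DunklAngular in
theorem mainTheorem11 (N : ℕ) (R : CoxeterRootSystem N) (P : R.PositiveHalf)
    (g : Vec N → ℂ) (hg : ∀ w ∈ R.W, ∀ α ∈ R.roots, g (w α) = g α) :
    ((∃ Φ : SoQuot P g ≃ₐ[ℂ] soAlgebra P g,
        (∀ ξ η, (Φ (SoQuot.M P g ξ η) : Module.End ℂ (RatFun N)) = opM P g ξ η) ∧
        ∀ w : R.W, (Φ (SoQuot.grp P g w) : Module.End ℂ (RatFun N)) = opW w.1) ∧
      (∃ Ψ : SoQuot P g ≃ₐ[ℂ] Cherednik.soSubalgebra P g,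
        (∀ ξ η, (Ψ (SoQuot.M P g ξ η) : Cherednik P g) =
          Cherednik.x P g ξ * Cherednik.y P g η - Cherednik.x P g η * Cherednik.y P g ξ) ∧
        ∀ w : R.W, (Ψ (SoQuot.grp P g w) : Cherednik P g) = Cherednik.grp P g w) ∧
      (∃ b : Module.Basis (SoWord N × R.W) ℂ (SoQuot P g), ∀ a, b a = SoQuot.monomial P g a) ∧
      IsPBW (repLambda R) (SoRel R (S P g)) (SoRel R 0)) ∧
    ((∃ Φ : GlQuot P g ≃ₐ[ℂ] glAlgebra P g,
        (∀ ξ η, (Φ (GlQuot.E P g ξ η) : Module.End ℂ (RatFun N)) = opE P g ξ η) ∧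
        ∀ w : R.W, (Φ (GlQuot.grp P g w) : Module.End ℂ (RatFun N)) = opW w.1) ∧
      (∃ Ψ : GlQuot P g ≃ₐ[ℂ] Cherednik.glSubalgebra P g,
        (∀ ξ η, (Ψ (GlQuot.E P g ξ η) : Cherednik P g) =
          Cherednik.x P g ξ * Cherednik.y P g η) ∧
        ∀ w : R.W, (Ψ (GlQuot.grp P g w) : Cherednik P g) = Cherednik.grp P g w) ∧
      (∃ b : Module.Basis (GlWord N × R.W) ℂ (GlQuot P g), ∀ a, b a = GlQuot.monomial P g a) ∧
      IsPBW (repTensor R) (GlRel R (S P g)) (GlRel R 0)) :=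
  ⟨⟨exists_soQuot_equiv_soAlgebra P hg, exists_soQuot_equiv_soSubalgebra P hg,
    ⟨Module.Basis.mk (linearIndependent_soQuot_monomial P hg) (span_soQuot_monomial P g),
      Module.Basis.mk_apply _ _⟩, so_isPBW P hg⟩,
   ⟨exists_glQuot_equiv_glAlgebra P hg, exists_glQuot_equiv_glSubalgebra P hg,
    ⟨Module.Basis.mk (linearIndependent_glQuot_monomial P hg) (span_glQuot_monomial P g),
      Module.Basis.mk_apply _ _⟩, gl_isPBW P hg⟩⟩
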